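/- **Conventions.** Let $D_k$ be a closed disk with $k$ open holes $H_1,\dots,H_k$ aligned along a line. (If the line is horizontal they are numbered from left to right; rotating clockwise by $90^\circ$ gives the vertical picture, in which they are numbered from top to bottom. All words like "above" for curves refer to the horizontal picture.) A *convex curve* enclosing adjacent holes $H_a,\dots,H_b$ is the boundary of a round subdisk containing exactly these holes; the *counterclockwise half-twist* along that subdisk is the homeomorphism supported in it that rotates a smaller concentric disk, still containing $H_a,\dots,H_b$, counterclockwise by $\pi$ (the angle going linearly down to $0$ in the collar). The *mirror image* $\overline\alpha$ of a curve $\alpha\subset D_k$ is its reflection in the line of the holes. Two simple closed curves in $D_k$ are *isotopic* if they are joined by a homotopy in $D_k$ through simple closed curves. **Blowup sequences.** A blowup sequence $(0)\to(1,1)\to\cdots\to\mathbf n=(n_1,\dots,n_k)$ starts with the initial blowup $(0)\to(1,1)$ (or is just $(0)$) and continues with interior blowups at the $i$-th term, $1\le i\le r-1$, $(n_1,\dots,n_r)\mapsto(n_1,\dots,n_{i-1},n_i+1,1,n_{i+1}+1,n_{i+2},\dots,n_r)$, and exterior blowups $(n_1,\dots,n_r)\mapsto(n_1,\dots,n_{r-1},n_r+1,1)$.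 **The curves.** For $1\le s\le k$ let $\gamma_s\subset D_k$ be the convex curve enclosing $H_1,\dots,H_s$. The curves $\alpha_1,\dots,\alpha_{k-1}\subset D_k$ are defined along the blowup sequence. For $(0)$ there are none; for $(1,1)$, $\alpha_1\subset D_2$ is parallel to the boundary of $H_2$. At an interior blowup of an $r$-tuple at the $i$-th term, the hole $H_{i+1}$ of $D_r$ is split into two adjacent holes $H_{i+1},H_{i+2}$ of $D_{r+1}$, the curves $\alpha_1,\dots,\alpha_{r-1}$ being carried along, and $\alpha_r$ is the curve enclosing $H_1,\dots,H_i$ and $H_{i+2}$ that passes above $H_{i+1}$. At an exterior blowup a hole $H_{r+1}$ is added to the right of all others, and $\alpha_r$ is parallel to its boundary. **The wiring diagrams.** An unbraided wiring diagram consists of wires running from right to left and of marked points at which one or several locally consecutive wires meet, the order of these wires being reversed there. The diagram $\mathcal W_{\mathbf n}$ is defined along the blowup sequence. For $(0)$ it is one wire $w_1$ without marked points; for $(1,1)$ it has $w_1$ above $w_2$ and one marked point $x_1$, on $w_2$ only. At an interior blowup of an $r$-tuple at the $i$-th term, let $w_j$ be the $(i+1)$-st wire from the top on the right-hand side; a new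 wire $w_{r+1}$ starts right below $w_j$ on the right-hand side, passes through all the marked points on $w_j$, otherwise stays parallel to $w_j$, and finally meets the $i$ wires that are topmost on the right-hand side in a new marked point $x_r$, to the left of all previous ones. At an exterior blowup a new wire $w_{r+1}$, with a single new free marked point $x_r$ to the left of all previous ones, is added below all the wires. For a $k$-tuple $\mathbf m=(m_1,\dots,m_k)$ of nonnegative integers, $\mathcal W_{\mathbf n}(\mathbf m)$ is obtained by adding to the left of $\mathcal W_{\mathbf n}$, from right to left, $m_1$ marked points called $y_1$, then $m_2$ marked points called $y_2$, $\dots$, then $m_k$ marked points called $y_k$, where at each $y_s$ exactly the $s$ wires that are topmost on the right-hand side of the diagram meet. (For lens spaces one takes $\mathbf m=\mathbf b-\mathbf n$, where $\frac p{p-q}=[b_1,\dots,b_k]$ and $n_i\le b_i$ for all $i$.) **Vanishing cycles.** If the wires through a marked point $z$ occupy the local positions $a,\dots,b$ from the top, let $\delta(z)\subset D_k$ be the convex curve enclosing $H_a,\dots,H_b$ and $\Delta(z)$ the counterclockwise half-twist along the subdisk it bounds. If $z_1,z_2,\dots$ are all the marked points from right to left, the vanishing cycle of $z_j$ is $V(z_j)=\Delta(z_1)\circ\cdots\circ\Delta(z_{j-1})(\delta(z_j))$.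 **Proposition.** For every blowup sequence $(0)\to(1,1)\to\cdots\to\mathbf n$ with $\mathbf n$ of length $k$, and every $k$-tuple $\mathbf m$ of nonnegative integers, $\mathcal W_{\mathbf n}(\mathbf m)$ is well defined (its wires are distinct, and at every marked point there is at least one wire and the wires through it are locally consecutive), and (a) for every $1\le s\le k$, the vanishing cycle $V(y_s)$ of every marked point $y_s\in\mathcal W_{\mathbf n}(\mathbf m)$ is isotopic to $\gamma_s$ in $D_k$; (b) for every $1\le t\le k-1$, the vanishing cycle $V(x_t)$ of the marked point $x_t\in\mathcal W_{\mathbf n}(\mathbf m)$ is isotopic to $\overline\alpha_t$ in $D_k$. -/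

import Mathlib

/-! ## The disk with holes, its convex curves, half-twists, and isotopy of curves

The disk with `k` holes is placed in `ℂ` with its holes aligned along the real axis, the `j`-th hole
(`1 ≤ j ≤ k`) being centred at `j`.  Rotating the picture clockwise by a right angle gives the
vertical disk, in which the `j`-th hole from the left becomes the `j`-th hole from the top, and the
reflection in the real axis becomes the reflection in the imaginary axis. -/

/-- The common radius of the holes of the disk with `k` holes. -/
noncomputable def holeRadius (k : ℕ) : ℝ := (1 / 2) ^ (k + 2)

/-- `D_k`, the closed disk with `k` open holes. -/
def diskWithHoles (k : ℕ) : Set ℂ :=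
  Metric.closedBall (((k : ℂ) + 1) / 2) ((k : ℝ) + 1) \
    ⋃ j ∈ Finset.Icc 1 k, Metric.ball (j : ℂ) (holeRadius k)

/-- The subsets `C` and `C'` are isotopic simple closed curves in `X`: there is a homotopy in `X`
from the one to the other, every stage of which is a simple closed curve. -/
def IsotopicIn (X C C' : Set ℂ) : Prop :=
  ∃ H : unitInterval × Circle → ℂ, Continuous H ∧
    (∀ t, Function.Injective fun θ => H (t, θ)) ∧
    (∀ t θ, H (t, θ) ∈ X) ∧
    (Set.range fun θ => H (0, θ)) = C ∧
    (Set.range fun θ => H (1, θ)) = C'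

/-- The centre of the round subdisk that contains exactly the holes `a, a + 1, …, b`. -/
noncomputable def blockCenter (a b : ℕ) : ℂ := ((a : ℂ) + b) / 2

/-- The number `b - a + 1` of holes `a, …, b`, as a real number. -/
noncomputable def blockSize (a b : ℕ) : ℝ := (b : ℝ) - a + 1

/-- The radius of the round subdisk that contains exactly the holes `a, …, b`. -/
noncomputable def outerRadius (a b : ℕ) : ℝ := blockSize a b / 2 - 1 / (blockSize a b + 3)

/-- The radius of a smaller concentric disk that still contains the holes `a, …, b`. -/
noncomputable def innerRadius (a b : ℕ) : ℝ := blockSize a b / 2 - 1 / (blockSize a b + 2)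

/-- The convex curve enclosing the adjacent holes `a, …, b`. -/
noncomputable def convexCurve (a b : ℕ) : Set ℂ :=
  Metric.sphere (blockCenter a b) (outerRadius a b)

/-- The counterclockwise half-twist along the subdisk enclosed by `convexCurve a b`: the identity
outside the subdisk, the rotation by the angle `π` on the smaller disk, and the rotation of each
circle in the collar between them by an angle that interpolates linearly. -/
noncomputable def halfTwist (a b : ℕ) (z : ℂ) : ℂ :=
  blockCenter a b +
    Complex.exp
      (((Real.pi * max 0 (min 1
          ((outerRadius a b - ‖z - blockCenter a b‖) / (outerRadius a b - innerRadius a b))) : ℝ)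
        : ℂ) * Complex.I) * (z - blockCenter a b)

/-- The curve `γ_s`, the convex curve enclosing the holes `1, …, s`. -/
noncomputable def gammaCurve (s : ℕ) : Set ℂ := convexCurve 1 s

/-- The mirror image of a curve: its reflection in the line along which the holes are aligned. -/
def mirrorImage (C : Set ℂ) : Set ℂ := (starRingEnd ℂ) '' C

/-! ## Blowup sequences -/

/-- The interior blowup at the `i`-th term (`1 ≤ i < n.length`):
`(…, n_i, n_{i+1}, …) ↦ (…, n_i + 1, 1, n_{i+1} + 1, …)`. -/
def interiorBlowupTuple (n : List ℕ) (i : ℕ) : List ℕ :=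
  n.take (i - 1) ++ [n.getD (i - 1) 0 + 1, 1, n.getD i 0 + 1] ++ n.drop (i + 1)

/-- The exterior blowup `(n_1, …, n_r) ↦ (n_1, …, n_{r-1}, n_r + 1, 1)`. -/
def exteriorBlowupTuple (n : List ℕ) : List ℕ := n.dropLast ++ [n.getLastD 0 + 1, 1]

/-- `BlowupSequence n` is the type of blowup sequences `(0) → (1,1) → ⋯ → n`. -/
inductive BlowupSequence : List ℕ → Type
  | zero : BlowupSequence [0]
  | initial : BlowupSequence [1, 1]
  | interior {n : List ℕ} (σ : BlowupSequence n) (i : ℕ) (one_le : 1 ≤ i) (lt : i < n.length) :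
      BlowupSequence (interiorBlowupTuple n i)
  | exterior {n : List ℕ} (σ : BlowupSequence n) (two_le : 2 ≤ n.length) :
      BlowupSequence (exteriorBlowupTuple n)

/-! ## The stabilization algorithm -/

/-- The embedding of the disk with `r` holes into the disk with `r + 1` holes that splits the hole
`p` into the adjacent holes `p` and `p + 1`.  It stretches a thin vertical strip through the middle
of the hole `p` horizontally by one unit, and moves everything to the right of the strip by one
unit. -/
noncomputable def splitHole (r p : ℕ) (z : ℂ) : ℂ :=
  z + ((max 0 (min 1 ((z.re - p + holeRadius (r + 1)) / (2 * holeRadius (r + 1)))) : ℝ) : ℂ)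

/-- The vertices, in cyclic order, of the polygon enclosing the holes `1, …, i` and `i + 2` that
passes above the hole `i + 1`. -/
noncomputable def armVertex (i : ℕ) : Fin 8 → ℂ :=
  ![⟨3 / 4, -1 / 4⟩, ⟨i + 1 / 4, -1 / 4⟩, ⟨i + 1 / 4, 1 / 4⟩, ⟨i + 7 / 4, 1 / 4⟩,
    ⟨i + 7 / 4, -1 / 4⟩, ⟨i + 9 / 4, -1 / 4⟩, ⟨i + 9 / 4, 3 / 4⟩, ⟨3 / 4, 3 / 4⟩]

/-- The curve enclosing the holes `1, …, i` and `i + 2`, which passes above the hole `i + 1`. -/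
noncomputable def armCurve (i : ℕ) : Set ℂ :=
  ⋃ j : Fin 8, segment ℝ (armVertex i j) (armVertex i (j + 1))

/-- The curves `α_t`, for `1 ≤ t ≤ k - 1`, that the stabilization algorithm produces in the disk with
`k = n.length` holes (the value at any other `t` is irrelevant).  At an interior blowup at the `i`-th
term the hole `i + 1` is split, and at an exterior blowup a hole is inserted to the right of all the
others. -/
noncomputable def BlowupSequence.alphaCurve : {n : List ℕ} → BlowupSequence n → ℕ → Set ℂ
  | _, .zero, _ => ∅
  | _, .initial, _ => convexCurve 2 2
  | _, .interior (n := n) σ i _ _, t =>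
      if t = n.length then armCurve i else splitHole n.length (i + 1) '' σ.alphaCurve t
  | _, .exterior (n := n) σ _, t =>
      if t = n.length then convexCurve (n.length + 1) (n.length + 1) else σ.alphaCurve t

/-! ## Unbraided wiring diagrams -/

/-- The names of the marked points: `x_t` and `y_s`. -/
inductive MarkLabel : Type
  | x (t : ℕ) : MarkLabel
  | y (s : ℕ) : MarkLabel

/-- A marked point of a wiring diagram, with the set of the wires that pass through it.  It is a free
marked point if there is just one such wire. -/
structure MarkedPoint where
  label : MarkLabel
  wires : Finset ℕ

/-- An unbraided wiring diagram: its wires from top to bottom on the right-hand side of the diagram,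
and its marked points from right to left. -/
structure WiringDiagram where
  right : List ℕ
  marks : List MarkedPoint

namespace WiringDiagram

/-- The set of the wires through the marked point number `j`, where the marked points are numbered
`0, 1, 2, …` from right to left. -/
def wiresAt (W : WiringDiagram) (j : ℕ) : Finset ℕ :=
  ((W.marks[j]?).map MarkedPoint.wires).getD ∅

/-- The local geometric order, from top to bottom, of the wires just to the right of the marked point
number `j`.  Wires meeting at a marked point are consecutive there, and passing the point reverses
their order. -/
def localOrder (W : WiringDiagram) : ℕ → List ℕ
  | 0 => W.right
  | j + 1 =>
      let L := W.localOrder j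
      let S := W.wiresAt j
      let u := L.findIdx (fun w => decide (w ∈ S))
      L.take u ++ ((L.drop u).take S.card).reverse ++ L.drop (u + S.card)

/-- The number of wires above the wires through the marked point number `j`. -/
def above (W : WiringDiagram) (j : ℕ) : ℕ :=
  (W.localOrder j).findIdx (fun w => decide (w ∈ W.wiresAt j))

/-- The local position, counted from the top and starting with `1`, of the highest wire through the
marked point number `j`. -/
def top (W : WiringDiagram) (j : ℕ) : ℕ := W.above j + 1

/-- The local position of the lowest wire through the marked point number `j`. -/
def bottom (W : WiringDiagram) (j : ℕ) : ℕ := W.above j + (W.wiresAt j).card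

/-- The diagram is geometrically realizable: its wires are distinct, every marked point lies on a
wire, and the wires through a marked point are consecutive in the local geometric order. -/
def IsRealizable (W : WiringDiagram) : Prop :=
  W.right.Nodup ∧ ∀ j < W.marks.length, (W.wiresAt j).Nonempty ∧
    (((W.localOrder j).drop (W.above j)).take (W.wiresAt j).card).toFinset = W.wiresAt j

/-- The composition of the counterclockwise half-twists that correspond to the marked points number
`0, …, j - 1`, the one that corresponds to the point number `0` being applied last. -/
noncomputable def twistComp (W : WiringDiagram) : ℕ → ℂ → ℂ
  | 0 => id
  | j + 1 => W.twistComp j ∘ halfTwist (W.top j) (W.bottom j)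

/-- The vanishing cycle associated to the marked point number `j`. -/
noncomputable def vanishingCycle (W : WiringDiagram) (j : ℕ) : Set ℂ :=
  W.twistComp j '' convexCurve (W.top j) (W.bottom j)

/-- The effect on a wiring diagram with `r` wires of an interior blowup at the `i`-th term.  The new
wire `r + 1` starts right below the `(i + 1)`-st wire `w` on the right-hand side, passes through all
the marked points on `w`, and finally meets the top `i` wires (in the order on the right-hand side)
in a new marked point `x_r`, to the left of all the others. -/
def interiorBlowup (W : WiringDiagram) (i : ℕ) : WiringDiagram where
  right := W.right.take (i + 1) ++ [W.right.length + 1] ++ W.right.drop (i + 1)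
  marks :=
    W.marks.map (fun P =>
      if W.right.getD i 0 ∈ P.wires then ⟨P.label, insert (W.right.length + 1) P.wires⟩ else P) ++
    [⟨.x W.right.length, insert (W.right.length + 1) (W.right.take i).toFinset⟩]

/-- The effect on a wiring diagram with `r` wires of an exterior blowup: a new wire `r + 1` below all
the others, with a single free marked point `x_r`, to the left of all the others. -/
def exteriorBlowup (W : WiringDiagram) : WiringDiagram where
  right := W.right ++ [W.right.length + 1]
  marks := W.marks ++ [⟨.x W.right.length, {W.right.length + 1}⟩]

/-- The twisting algorithm: to the left of all marked points, `m_1` marked points `y_1`, then `m_2`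
marked points `y_2`, and so on, are added, where `y_s` lies on the top `s` wires (in the order on the
right-hand side). -/
def twist (W : WiringDiagram) {k : ℕ} (m : Fin k → ℕ) : WiringDiagram where
  right := W.right
  marks := W.marks ++ (List.finRange k).flatMap fun s =>
    List.replicate (m s) ⟨.y (s + 1), (W.right.take (s + 1)).toFinset⟩

end WiringDiagram

/-- The blowup algorithm: the wiring diagram `W_n` constructed from a blowup sequence ending at `n`. -/
def BlowupSequence.wiringDiagram : {n : List ℕ} → BlowupSequence n → WiringDiagram
  | _, .zero => ⟨[1], []⟩
  | _, .initial => ⟨[1, 2], [⟨.x 1, {2}⟩]⟩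
  | _, .interior σ i _ _ => σ.wiringDiagram.interiorBlowup i
  | _, .exterior σ _ => σ.wiringDiagram.exteriorBlowup

/-! Sweeping a diagram composes half-twists, and up to isotopy the composition depends only on the
number c_s of marked points on the s-th wire from the top. Let T_s be the half-twist along the first
s holes and put c_{k+1} = 1. The composition is isotopic to the product, for s = 1, …, k, of the
half-twist along the hole s and T_s^(c_s - c_{s+1}). This product is `nf`, the local order that goes
with it is `ord`, and `IsNormal` says that a diagram has this form.

A new point on the first s wires raises c_1, …, c_s by one, so it inserts a factor T_s. Its position
in the local order is accounted for by the factors that come after s: they commute with the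
half-twist of the point or conjugate it to the one along the reflected block (`Passes.outward`).
What remains of the vanishing cycle is the image of γ_s under a product of half-twists along blocks
of the first s holes, and these fix γ_s. This is `passes_initial_block`, and it yields (a).

An interior blowup doubles a wire. Doubling does not change the composition if the original wire is
counted as two parallel ones, so the whole argument is carried out for wires v that stand for μ v
parallel wires, with arbitrary positive weights (`Run.double`). The new point then meets the wires
above the doubled wire and one of its two copies. With S the weight above and β, γ the weights of
the copies, the block β + γ is half-twisted before the new half-twist along S + γ holes. That the
result is again a normal form is a relation between half-twists along three adjacent blocks
(`mapIso_three_blocks`, `mapIso_interior`). The vanishing cycle is the image of the convex curve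
about the first S + γ holes under the half-twist along the last β + γ. The first γ holes of the
rotating block travel below the other β, so this image is the arm that passes below the middle
block, the mirror image of the new α with its holes split (`isotopicIn_tw_conv_lowerArm`). Older
curves need no new work: splitting a hole of the curve corresponds to adding the weights of the two
copies of the wire, and the induction hypothesis `Realizes` covers all weights.

The three-block relation is proved by comparing two motions of the hole centres with the same end:
one rigid half-turn, and three successive rotations of pairs of blocks that keep blocks parallel.
The straight homotopy between the two motions has no collisions, and homotopies of motions lift to
ambient isotopies (`exists_ambient_lift`, `MapIso.of_motions`). The image of the convex curve is
found by following a region under a graph whose top separates the two groups of rotating holes at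
every angle (`isotopicIn_tw_conv_armTop`).

All of this takes place in the plane minus the centres of the holes. The end curves lie in
`safeRegion`, away from the holes and the outer boundary, and radial maps that fix this region push
an isotopy into the disk with holes (`isotopicIn_diskWithHoles`). -/

/-! ## Partial twists along round disks -/

/-- The function that is `1` up to the inner radius, `0` from the outer radius on, and linear in
between. -/
noncomputable def collar (r₁ r₂ ρ : ℝ) : ℝ := max 0 (min 1 ((r₂ - ρ) / (r₂ - r₁)))

/-- The rotation by `θ` of the disk of radius `r₁`, damped linearly to the identity in the collar of
outer radius `r₂`. -/
noncomputable def twistMap (c : ℂ) (r₁ r₂ θ : ℝ) (z : ℂ) : ℂ :=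
  c + Complex.exp (((θ * collar r₁ r₂ ‖z - c‖ : ℝ) : ℂ) * Complex.I) * (z - c)

theorem continuous_collar (r₁ r₂ : ℝ) : Continuous (collar r₁ r₂) := by
  unfold collar; fun_prop

theorem collar_of_le {r₁ r₂ ρ : ℝ} (h : r₁ < r₂) (hρ : ρ ≤ r₁) : collar r₁ r₂ ρ = 1 := by
  have : 1 ≤ (r₂ - ρ) / (r₂ - r₁) := by rw [le_div_iff₀ (by linarith)]; linarith
  simp [collar, min_eq_left this]

theorem collar_of_ge {r₁ r₂ ρ : ℝ} (h : r₁ < r₂) (hρ : r₂ ≤ ρ) : collar r₁ r₂ ρ = 0 := by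
  have : (r₂ - ρ) / (r₂ - r₁) ≤ 0 := div_nonpos_of_nonpos_of_nonneg (by linarith) (by linarith)
  rw [collar, min_eq_right (by linarith), max_eq_left this]

theorem norm_twistMap_sub (c : ℂ) (r₁ r₂ θ : ℝ) (z : ℂ) :
    ‖twistMap c r₁ r₂ θ z - c‖ = ‖z - c‖ := by
  rw [twistMap, add_sub_cancel_left, norm_mul, Complex.norm_exp_ofReal_mul_I, one_mul]

theorem twistMap_of_le {c : ℂ} {r₁ r₂ : ℝ} (h : r₁ < r₂) (θ : ℝ) {z : ℂ} (hz : ‖z - c‖ ≤ r₁) :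
    twistMap c r₁ r₂ θ z = c + Complex.exp (θ * Complex.I) * (z - c) := by
  rw [twistMap, collar_of_le h hz, mul_one]

theorem twistMap_of_ge {c : ℂ} {r₁ r₂ : ℝ} (h : r₁ < r₂) (θ : ℝ) {z : ℂ} (hz : r₂ ≤ ‖z - c‖) :
    twistMap c r₁ r₂ θ z = z := by
  rw [twistMap, collar_of_ge h hz]; simp

theorem twistMap_twistMap (c : ℂ) (r₁ r₂ θ θ' : ℝ) (z : ℂ) :
    twistMap c r₁ r₂ θ (twistMap c r₁ r₂ θ' z) = twistMap c r₁ r₂ (θ + θ') z := by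
  have h := norm_twistMap_sub c r₁ r₂ θ' z
  rw [twistMap, h, twistMap, add_sub_cancel_left, twistMap, ← mul_assoc, ← Complex.exp_add]
  congr 3; push_cast; ring

theorem twistMap_zero (c : ℂ) (r₁ r₂ : ℝ) (z : ℂ) : twistMap c r₁ r₂ 0 z = z := by
  simp [twistMap]

theorem continuous_twistMap (c : ℂ) (r₁ r₂ : ℝ) :
    Continuous fun p : ℝ × ℂ => twistMap c r₁ r₂ p.1 p.2 := by
  have := continuous_collar r₁ r₂
  unfold twistMap; fun_prop

/-- The partial twist as a homeomorphism. -/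
noncomputable def twistHomeo (c : ℂ) (r₁ r₂ θ : ℝ) : ℂ ≃ₜ ℂ where
  toFun := twistMap c r₁ r₂ θ
  invFun := twistMap c r₁ r₂ (-θ)
  left_inv z := by rw [twistMap_twistMap, neg_add_cancel, twistMap_zero]
  right_inv z := by rw [twistMap_twistMap, add_neg_cancel, twistMap_zero]
  continuous_toFun := (continuous_twistMap c r₁ r₂).comp (by fun_prop : Continuous fun z : ℂ => (θ, z))
  continuous_invFun :=
    (continuous_twistMap c r₁ r₂).comp (by fun_prop : Continuous fun z : ℂ => (-θ, z))

theorem norm_exp_mul_I_mul (θ : ℝ) (z : ℂ) : ‖Complex.exp (θ * Complex.I) * z‖ = ‖z‖ := by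
  rw [norm_mul, Complex.norm_exp_ofReal_mul_I, one_mul]

/-- On the disk of radius `r₁` the outer twist is a rigid rotation, which conjugates a twist
supported there to the same twist about the rotated centre. Since the outer twist preserves the
distance to `c`, no point from outside the small disk enters its rotated copy. -/
theorem twistMap_nested {c c' : ℂ} {r₁ r₂ s₁ s₂ : ℝ} (hr : r₁ < r₂) (hs : s₁ < s₂) (θ θ' : ℝ)
    (hd : ‖c' - c‖ + s₂ ≤ r₁) (z : ℂ) :
    twistMap c r₁ r₂ θ (twistMap c' s₁ s₂ θ' z) =
      twistMap (c + Complex.exp (θ * Complex.I) * (c' - c)) s₁ s₂ θ' (twistMap c r₁ r₂ θ z) := by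
  set e := Complex.exp (θ * Complex.I) with he
  have hn : ∀ w : ℂ, ‖e * w‖ = ‖w‖ := norm_exp_mul_I_mul θ
  by_cases hz : s₂ ≤ ‖z - c'‖
  · rw [twistMap_of_ge hs θ' hz, eq_comm]
    apply twistMap_of_ge hs
    by_cases hzc : ‖z - c‖ ≤ r₁
    · rw [twistMap_of_le hr θ hzc, ← he]
      have : c + e * (z - c) - (c + e * (c' - c)) = e * (z - c') := by ring
      rwa [this, hn]
    · push Not at hzc
      have h1 := norm_twistMap_sub c r₁ r₂ θ z
      have h2 := norm_sub_le (twistMap c r₁ r₂ θ z - (c + e * (c' - c))) (-(e * (c' - c)))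
      have h3 : twistMap c r₁ r₂ θ z - (c + e * (c' - c)) - -(e * (c' - c))
        = twistMap c r₁ r₂ θ z - c := by ring
      rw [h3, h1, norm_neg, hn] at h2
      linarith
  · push Not at hz
    have h1 : ‖twistMap c' s₁ s₂ θ' z - c'‖ = ‖z - c'‖ := norm_twistMap_sub ..
    have key : ∀ w : ℂ, ‖w - c'‖ = ‖z - c'‖ → ‖w - c‖ ≤ r₁ := fun w hw => by
      have := norm_add_le (w - c') (c' - c)
      rw [sub_add_sub_cancel] at this; linarith
    rw [twistMap_of_le hr θ (key _ h1), twistMap_of_le hr θ (key _ rfl), ← he, twistMap, twistMap]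
    have h4 : c + e * (z - c) - (c + e * (c' - c)) = e * (z - c') := by ring
    rw [h4, hn]; ring

/-- Each twist preserves its own disk and is the identity off it, and the disks have disjoint
interiors. -/
theorem twistMap_disjoint {c c' : ℂ} {r₁ r₂ s₁ s₂ : ℝ} (hr : r₁ < r₂) (hs : s₁ < s₂) (θ θ' : ℝ)
    (hd : r₂ + s₂ ≤ ‖c' - c‖) (z : ℂ) :
    twistMap c r₁ r₂ θ (twistMap c' s₁ s₂ θ' z) = twistMap c' s₁ s₂ θ' (twistMap c r₁ r₂ θ z) := by
  have tri : ∀ w : ℂ, ‖c' - c‖ ≤ ‖w - c‖ + ‖w - c'‖ := fun w => by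
    have := norm_sub_le (w - c) (w - c'); rwa [sub_sub_sub_cancel_left] at this
  by_cases hz : s₂ ≤ ‖z - c'‖
  · rw [twistMap_of_ge hs θ' hz]
    by_cases hzc : r₂ ≤ ‖z - c‖
    · rw [twistMap_of_ge hr θ hzc, twistMap_of_ge hs θ' hz]
    · rw [twistMap_of_ge hs]
      have := tri (twistMap c r₁ r₂ θ z)
      rw [norm_twistMap_sub] at this
      push Not at hzc; linarith
  · push Not at hz
    have h1 := tri z
    have h2 := tri (twistMap c' s₁ s₂ θ' z)
    rw [norm_twistMap_sub] at h2
    rw [twistMap_of_ge hr θ (z := z) (by linarith), twistMap_of_ge hr θ (by linarith)]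

/-! ## The half-twist along a block of holes -/

/-- The centre of the block of the holes `p + 1, …, p + s`. -/
noncomputable def cen (p s : ℕ) : ℝ := p + ((s : ℝ) + 1) / 2

/-- The outer radius of a block of `s` holes. -/
noncomputable def outR (s : ℕ) : ℝ := (s : ℝ) / 2 - 1 / ((s : ℝ) + 3)

/-- The inner radius of a block of `s` holes. -/
noncomputable def innR (s : ℕ) : ℝ := (s : ℝ) / 2 - 1 / ((s : ℝ) + 2)

theorem blockCenter_eq (p s : ℕ) : blockCenter (p + 1) (p + s) = (cen p s : ℂ) := by
  simp only [blockCenter, cen]; push_cast; ring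

theorem outerRadius_eq (p s : ℕ) : outerRadius (p + 1) (p + s) = outR s := by
  simp only [outerRadius, blockSize, outR]; push_cast; ring_nf

theorem innerRadius_eq (p s : ℕ) : innerRadius (p + 1) (p + s) = innR s := by
  simp only [innerRadius, blockSize, innR]; push_cast; ring_nf

theorem innR_lt_outR (s : ℕ) : innR s < outR s := by
  unfold innR outR
  have : 1 / ((s : ℝ) + 3) < 1 / ((s : ℝ) + 2) :=
    one_div_lt_one_div_of_lt (by positivity) (by linarith)
  linarith

theorem outR_lt (s : ℕ) : outR s < (s : ℝ) / 2 := by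
  have : 0 < 1 / ((s : ℝ) + 3) := by positivity
  unfold outR; linarith

theorem quarter_le_outR {s : ℕ} (hs : 1 ≤ s) : (s : ℝ) / 2 - 1 / 4 ≤ outR s := by
  have h : (1 : ℝ) ≤ s := by exact_mod_cast hs
  have : 1 / ((s : ℝ) + 3) ≤ 1 / 4 := one_div_le_one_div_of_le (by norm_num) (by linarith)
  unfold outR; linarith

theorem third_le_innR {s : ℕ} (hs : 1 ≤ s) : (s : ℝ) / 2 - 1 / 3 ≤ innR s := by
  have h : (1 : ℝ) ≤ s := by exact_mod_cast hs
  have : 1 / ((s : ℝ) + 2) ≤ 1 / 3 := one_div_le_one_div_of_le (by norm_num) (by linarith)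
  unfold innR; linarith

/-- This is the reason for the constants `3` and `2` in the radii: a proper subblock has `y + 3 ≤ s
+ 2`, so its whole subdisk, collar included, lies where the twist along the large block is rigid. -/
theorem outR_le_innR {x y z s : ℕ} (h : x + y + z = s) (hxz : 0 < x + z) :
    |(x : ℝ) - z| / 2 + outR y ≤ innR s := by
  have h1 : |(x : ℝ) - z| ≤ x + z := by
    rw [abs_le]; constructor <;> linarith [(Nat.cast_nonneg x : (0:ℝ) ≤ x), (Nat.cast_nonneg z : (0:ℝ) ≤ z)]
  have h2 : (s : ℝ) = x + y + z := by rw [← h]; push_cast; ring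
  have h3 : (1 : ℝ) ≤ x + z := by exact_mod_cast hxz
  have : 1 / ((s : ℝ) + 2) ≤ 1 / ((y : ℝ) + 3) :=
    one_div_le_one_div_of_le (by positivity) (by linarith)
  unfold innR outR; linarith

/-- The partial twist by the angle `θ` along the block of the holes `p + 1, …, p + s`. -/
noncomputable def ptw (θ : ℝ) (p s : ℕ) : ℂ ≃ₜ ℂ := twistHomeo (cen p s) (innR s) (outR s) θ

/-- The half-twist along the block of the holes `p + 1, …, p + s`. -/
noncomputable def tw (p s : ℕ) : ℂ ≃ₜ ℂ := ptw Real.pi p s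

theorem ptw_apply (θ : ℝ) (p s : ℕ) (z : ℂ) :
    ptw θ p s z = twistMap (cen p s) (innR s) (outR s) θ z := rfl

theorem coe_tw (p s : ℕ) : ⇑(tw p s) = halfTwist (p + 1) (p + s) := by
  funext z
  simp only [tw, ptw_apply, twistMap, halfTwist, blockCenter_eq, outerRadius_eq, innerRadius_eq,
    collar]

/-- The convex curve enclosing the holes `p + 1, …, p + s`. -/
noncomputable def conv (p s : ℕ) : Set ℂ := Metric.sphere (cen p s : ℂ) (outR s)

theorem convexCurve_eq (p s : ℕ) : convexCurve (p + 1) (p + s) = conv p s := by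
  rw [convexCurve, conv, blockCenter_eq, outerRadius_eq]

theorem ptw_of_le (θ : ℝ) {p s : ℕ} {z : ℂ} (h : ‖z - cen p s‖ ≤ innR s) :
    ptw θ p s z = cen p s + Complex.exp (θ * Complex.I) * (z - cen p s) :=
  twistMap_of_le (innR_lt_outR s) θ h

theorem ptw_of_ge (θ : ℝ) {p s : ℕ} {z : ℂ} (h : outR s ≤ ‖z - cen p s‖) : ptw θ p s z = z :=
  twistMap_of_ge (innR_lt_outR s) θ h

theorem norm_ptw_sub (θ : ℝ) (p s : ℕ) (z : ℂ) : ‖ptw θ p s z - cen p s‖ = ‖z - cen p s‖ :=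
  norm_twistMap_sub ..

theorem tw_of_le {p s : ℕ} {z : ℂ} (h : ‖z - cen p s‖ ≤ innR s) :
    tw p s z = 2 * cen p s - z := by
  rw [tw, ptw_of_le _ h, Complex.exp_pi_mul_I]; ring

theorem continuous_ptw (p s : ℕ) : Continuous fun q : ℝ × ℂ => ptw q.1 p s q.2 :=
  continuous_twistMap ..

theorem ptw_symm (θ : ℝ) (p s : ℕ) : (ptw θ p s).symm = ptw (-θ) p s := by
  ext z; rfl

theorem ptw_inv (θ : ℝ) (p s : ℕ) : (ptw θ p s)⁻¹ = ptw (-θ) p s := ptw_symm θ p s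

theorem ptw_zero (p s : ℕ) : ptw 0 p s = 1 := by
  ext z; exact twistMap_zero ..

theorem norm_cen_sub (p s p' s' : ℕ) : ‖(cen p' s' : ℂ) - cen p s‖ = |cen p' s' - cen p s| := by
  rw [← Complex.ofReal_sub, Complex.norm_real, Real.norm_eq_abs]

theorem cen_sub_nested {x y z s : ℕ} (p : ℕ) (h : x + y + z = s) :
    cen (p + x) y - cen p s = ((x : ℝ) - z) / 2 := by
  have h2 : (s : ℝ) = x + y + z := by rw [← h]; push_cast; ring
  unfold cen; rw [h2]; push_cast; ring

theorem norm_cen_sub_nested {x y z s : ℕ} (p : ℕ) (h : x + y + z = s) :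
    ‖(cen (p + x) y : ℂ) - cen p s‖ = |(x : ℝ) - z| / 2 := by
  rw [norm_cen_sub, cen_sub_nested p h, abs_div, abs_two]

theorem reflect_cen {x y z s : ℕ} (p : ℕ) (h : x + y + z = s) :
    (cen p s : ℂ) + Complex.exp (Real.pi * Complex.I) * (cen (p + x) y - cen p s)
      = cen (p + z) y := by
  have h2 : (s : ℝ) = x + y + z := by rw [← h]; push_cast; ring
  rw [Complex.exp_pi_mul_I, ← Complex.ofReal_one, ← Complex.ofReal_sub, ← Complex.ofReal_neg,
    ← Complex.ofReal_mul, ← Complex.ofReal_add]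
  unfold cen; rw [h2]; push_cast; ring

/-- The half-turn of the large block exchanges the numbers `x` and `z` of holes on the two sides of
the subblock. If the subblock is everything, the radius estimate fails but both sides coincide. -/
theorem tw_mul_tw_nested {p x y z s : ℕ} (h : x + y + z = s) :
    tw p s * tw (p + x) y = tw (p + z) y * tw p s := by
  rcases Nat.eq_zero_or_pos (x + z) with h0 | h0
  · obtain ⟨rfl, rfl⟩ : x = 0 ∧ z = 0 := by omega
    have : y = s := by omega
    subst this; rfl
  · ext w
    change twistMap _ _ _ _ (twistMap _ _ _ _ w) = twistMap _ _ _ _ (twistMap _ _ _ _ w)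
    rw [twistMap_nested (innR_lt_outR s) (innR_lt_outR y) _ _ _ w, reflect_cen p h]
    rw [norm_cen_sub_nested p h]
    exact outR_le_innR h h0

theorem outR_add_outR_le {p s p' s' : ℕ} (h : p + s ≤ p') :
    outR s + outR s' ≤ ‖(cen p' s' : ℂ) - cen p s‖ := by
  have h' : (p : ℝ) + s ≤ p' := by exact_mod_cast h
  rw [norm_cen_sub]
  refine le_trans ?_ (le_abs_self _)
  have := outR_lt s; have := outR_lt s'
  unfold cen; linarith

theorem ptw_commute_disjoint (θ θ' : ℝ) {p s p' s' : ℕ} (h : p + s ≤ p') :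
    Commute (ptw θ p s) (ptw θ' p' s') := by
  ext w
  exact twistMap_disjoint (innR_lt_outR s) (innR_lt_outR s') θ θ' (outR_add_outR_le h) w

theorem tw_commute_disjoint {p s p' s' : ℕ} (h : p + s ≤ p') : Commute (tw p s) (tw p' s') :=
  ptw_commute_disjoint _ _ h

theorem tw_image_conv_nested {p x y z s : ℕ} (h : x + y + z = s) :
    tw p s '' conv (p + x) y = conv (p + z) y := by
  rcases Nat.eq_zero_or_pos (x + z) with h0 | h0
  · obtain ⟨rfl, rfl⟩ : x = 0 ∧ z = 0 := by omega
    have : y = s := by omega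
    subst this
    rw [add_zero, (tw p y).image_eq_preimage_symm]
    ext w
    simp only [Set.mem_preimage, conv, mem_sphere_iff_norm]
    rw [tw, ptw_symm, norm_ptw_sub]
  · have hle := outR_le_innR h h0
    have h1 := norm_cen_sub_nested p h
    have hle' := outR_le_innR (x := z) (y := y) (z := x) (s := s) (by omega) (by omega)
    have h1' := norm_cen_sub_nested (x := z) (y := y) (z := x) (s := s) p (by omega)
    have h3 : (cen (p + z) y : ℂ) = 2 * cen p s - cen (p + x) y := by
      have := reflect_cen p h
      rw [Complex.exp_pi_mul_I] at this; rw [← this]; ring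
    have mem : ∀ {x z : ℕ} {w : ℂ}, ‖(cen (p + x) y : ℂ) - cen p s‖ = |(x : ℝ) - z| / 2 →
        |(x : ℝ) - z| / 2 + outR y ≤ innR s → w ∈ conv (p + x) y → ‖w - cen p s‖ ≤ innR s := by
      intro x z w h1 h2 hw
      rw [conv, mem_sphere_iff_norm] at hw
      have := norm_add_le (w - cen (p + x) y) (cen (p + x) y - cen p s)
      rw [sub_add_sub_cancel] at this; linarith
    ext w
    constructor
    · rintro ⟨v, hv, rfl⟩
      rw [tw_of_le (mem h1 hle hv), conv, mem_sphere_iff_norm, h3]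
      rw [conv, mem_sphere_iff_norm] at hv
      rw [← hv, ← norm_neg]; congr 1; ring
    · intro hw
      have hin := mem h1' hle' hw
      refine ⟨2 * cen p s - w, ?_, ?_⟩
      · rw [conv, mem_sphere_iff_norm] at hw ⊢
        rw [h3] at hw
        rw [← hw, ← norm_neg]; congr 1; ring
      · rw [tw_of_le]
        · ring
        · rwa [show 2 * (cen p s : ℂ) - w - cen p s = -(w - cen p s) by ring, norm_neg]

theorem Set.image_eq_self_of_forall {α : Type*} {f : α → α} {s : Set α} (h : ∀ x ∈ s, f x = x) :
    f '' s = s := by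
  rw [Set.image_congr h, Set.image_id']

theorem tw_image_conv_of_le {p s p' s' : ℕ} (h : p + s ≤ p' ∨ p' + s' ≤ p) :
    tw p s '' conv p' s' = conv p' s' := by
  apply Set.image_eq_self_of_forall
  intro w hw
  apply ptw_of_ge
  have h1 : outR s + outR s' ≤ ‖(cen p' s' : ℂ) - cen p s‖ := by
    rcases h with h | h
    · exact outR_add_outR_le h
    · rw [norm_sub_rev, add_comm]; exact outR_add_outR_le h
  rw [conv, mem_sphere_iff_norm] at hw
  have := norm_sub_le (w - cen p s) (w - cen p' s')
  rw [sub_sub_sub_cancel_left] at this; linarith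

/-- A proper subblock is twisted strictly inside the large curve, which is therefore fixed
pointwise; for the full block the curve is only preserved as a set. -/
theorem tw_image_conv_of_subset {p x y z s : ℕ} (h : x + y + z = s) :
    tw (p + x) y '' conv p s = conv p s := by
  rcases Nat.eq_zero_or_pos (x + z) with h0 | h0
  · obtain ⟨rfl, rfl⟩ : x = 0 ∧ z = 0 := by omega
    have : y = s := by omega
    subst this
    exact tw_image_conv_nested (x := 0) (z := 0) (by omega)
  · apply Set.image_eq_self_of_forall
    intro w hw
    apply ptw_of_ge
    have hle := outR_le_innR h h0
    have h1 := norm_cen_sub_nested p h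
    rw [conv, mem_sphere_iff_norm] at hw
    have := norm_add_le (w - cen (p + x) y) (cen (p + x) y - cen p s)
    rw [sub_add_sub_cancel] at this
    linarith [innR_lt_outR s]

/-! ## The holes and the region away from the holes -/

/-- The centres of the holes of the disk with `k` holes. -/
def holes (k : ℕ) : Set ℂ := {z | ∃ j : ℕ, 1 ≤ j ∧ j ≤ k ∧ z = (j : ℂ)}

theorem finite_holes (k : ℕ) : (holes k).Finite := by
  apply ((Set.finite_Icc 1 k).image (fun j : ℕ => (j : ℂ))).subset
  rintro z ⟨j, h1, h2, rfl⟩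
  exact ⟨j, ⟨h1, h2⟩, rfl⟩

theorem norm_nat_sub_cen_le {j p s : ℕ} (h1 : p + 1 ≤ j) (h2 : j ≤ p + s) :
    ‖(j : ℂ) - cen p s‖ ≤ ((s : ℝ) - 1) / 2 := by
  have h1' : (p : ℝ) + 1 ≤ j := by exact_mod_cast h1
  have h2' : (j : ℝ) ≤ p + s := by exact_mod_cast h2
  rw [← Complex.ofReal_natCast, ← Complex.ofReal_sub, Complex.norm_real, Real.norm_eq_abs, abs_le]
  unfold cen; constructor <;> linarith

theorem le_norm_nat_sub_cen {j p s : ℕ} (h : j ≤ p ∨ p + s + 1 ≤ j) :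
    ((s : ℝ) + 1) / 2 ≤ ‖(j : ℂ) - cen p s‖ := by
  rw [← Complex.ofReal_natCast, ← Complex.ofReal_sub, Complex.norm_real, Real.norm_eq_abs, le_abs]
  unfold cen
  rcases h with h | h
  · have h' : (j : ℝ) ≤ p := by exact_mod_cast h
    right; linarith
  · have h' : (p : ℝ) + s + 1 ≤ j := by exact_mod_cast h
    left; linarith

theorem ptw_nat_of_mem (θ : ℝ) {j p s : ℕ} (h1 : p + 1 ≤ j) (h2 : j ≤ p + s) :
    ptw θ p s j = cen p s + Complex.exp (θ * Complex.I) * (j - cen p s) := by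
  apply ptw_of_le
  have := norm_nat_sub_cen_le h1 h2
  have := third_le_innR (s := s) (by omega)
  linarith

theorem ptw_nat_of_not_mem (θ : ℝ) {j p s : ℕ} (h : j ≤ p ∨ p + s + 1 ≤ j) :
    ptw θ p s j = j := by
  apply ptw_of_ge
  have := le_norm_nat_sub_cen h
  have := outR_lt s
  linarith

theorem tw_nat_of_mem {j p s : ℕ} (h1 : p + 1 ≤ j) (h2 : j ≤ p + s) :
    tw p s j = ((2 * p + s + 1 - j : ℕ) : ℂ) := by
  rw [tw, ptw_nat_of_mem _ h1 h2, Complex.exp_pi_mul_I, Nat.cast_sub (by omega), cen]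
  push_cast; ring

theorem tw_mapsTo_holes {p s k : ℕ} (h : p + s ≤ k) : Set.MapsTo (tw p s) (holes k) (holes k) := by
  rintro _ ⟨j, h1, h2, rfl⟩
  by_cases hj : j ≤ p ∨ p + s + 1 ≤ j
  · exact ⟨j, h1, h2, ptw_nat_of_not_mem _ hj⟩
  · exact ⟨2 * p + s + 1 - j, by omega, by omega, tw_nat_of_mem (by omega) (by omega)⟩

/-- The region of the disk with `k` holes that keeps some distance from the holes and from the outer
boundary. -/
def safeRegion (k : ℕ) : Set ℂ :=
  {z | (∀ j : ℕ, 1 ≤ j → j ≤ k → 5 / 4 * holeRadius k ≤ ‖z - j‖) ∧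
    ‖z - ((k : ℂ) + 1) / 2‖ ≤ ((k : ℝ) + 1) / 2}

theorem holeRadius_pos (k : ℕ) : 0 < holeRadius k := by unfold holeRadius; positivity

theorem holeRadius_succ (k : ℕ) : holeRadius (k + 1) = holeRadius k / 2 := by
  unfold holeRadius; rw [show k + 1 + 2 = k + 2 + 1 by ring, pow_succ]
  ring

theorem holeRadius_le (k : ℕ) : holeRadius k ≤ 1 / 4 := by
  unfold holeRadius
  calc (1 / 2 : ℝ) ^ (k + 2) ≤ (1 / 2) ^ 2 := pow_le_pow_of_le_one (by norm_num) (by norm_num) (by omega)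
    _ = 1 / 4 := by norm_num

theorem holeRadius_le_of_pos {k : ℕ} (hk : 1 ≤ k) : holeRadius k ≤ 1 / 8 := by
  obtain ⟨k, rfl⟩ := Nat.exists_eq_add_of_le' hk
  rw [holeRadius_succ]; linarith [holeRadius_le k]

theorem norm_cen_sub_center {p s k : ℕ} (h : p + s ≤ k) :
    ‖(cen p s : ℂ) - ((k : ℂ) + 1) / 2‖ ≤ ((k : ℝ) - s) / 2 := by
  have h' : (p : ℝ) + s ≤ k := by exact_mod_cast h
  have h0 : (0 : ℝ) ≤ p := Nat.cast_nonneg p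
  have : (cen p s : ℂ) - ((k : ℂ) + 1) / 2 = ((cen p s - ((k : ℝ) + 1) / 2 : ℝ) : ℂ) := by
    push_cast; ring
  rw [this, Complex.norm_real, Real.norm_eq_abs, abs_le]
  unfold cen; constructor <;> linarith

/-- An image point close to a hole of the block must come from the rigid part of the twist, which is
a point reflection permuting the holes of the block, so the preimage is equally close to a hole. A
hole outside the block is too far from the supporting disk to matter. -/
theorem tw_mapsTo_safeRegion {p s k : ℕ} (hs : 1 ≤ s) (h : p + s ≤ k) :
    Set.MapsTo (tw p s) (safeRegion k) (safeRegion k) := by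
  rintro z ⟨hz1, hz2⟩
  have hout := outR_lt s
  have hinn := third_le_innR hs
  have hr := holeRadius_le_of_pos (show 1 ≤ k by omega)
  have hnorm := norm_ptw_sub Real.pi p s z
  by_cases hz : outR s ≤ ‖z - cen p s‖
  · rw [tw, ptw_of_ge _ hz]; exact ⟨hz1, hz2⟩
  refine ⟨fun j hj1 hj2 => ?_, ?_⟩
  · by_contra hcon
    push Not at hcon
    by_cases hj : j ≤ p ∨ p + s + 1 ≤ j
    · have h1 := le_norm_nat_sub_cen hj
      have h2 := norm_sub_le (tw p s z - cen p s) (tw p s z - j)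
      rw [sub_sub_sub_cancel_left] at h2
      rw [tw] at h2 hcon
      linarith
    · have hj1' : p + 1 ≤ j := by omega
      have hj2' : j ≤ p + s := by omega
      have h1 := norm_nat_sub_cen_le hj1' hj2'
      have h2 := norm_add_le (tw p s z - j) (j - cen p s)
      rw [sub_add_sub_cancel] at h2
      have h3 : ‖z - cen p s‖ ≤ innR s := by
        rw [← hnorm]; rw [tw] at h2 hcon; linarith
      have h4 := hz1 (2 * p + s + 1 - j) (by omega) (by omega)
      rw [tw_of_le h3] at hcon
      have h5 : ((2 * p + s + 1 - j : ℕ) : ℂ) = 2 * cen p s - j := by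
        rw [Nat.cast_sub (by omega), cen]; push_cast; ring
      rw [h5, ← norm_neg] at h4
      have h6 : -(z - (2 * (cen p s : ℂ) - j)) = 2 * cen p s - z - j := by ring
      rw [h6] at h4; linarith
  · push Not at hz
    have h1 := norm_cen_sub_center h
    have h2 := norm_add_le (tw p s z - cen p s) (cen p s - ((k : ℂ) + 1) / 2)
    rw [sub_add_sub_cancel] at h2
    rw [tw] at h2 ⊢
    linarith

theorem conv_subset_safeRegion {p s k : ℕ} (hs : 1 ≤ s) (h : p + s ≤ k) :
    conv p s ⊆ safeRegion k := by
  intro z hz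
  rw [conv, mem_sphere_iff_norm] at hz
  have hout := outR_lt s
  have hout' := quarter_le_outR hs
  have hr := holeRadius_le_of_pos (show 1 ≤ k by omega)
  refine ⟨fun j hj1 hj2 => ?_, ?_⟩
  · by_cases hj : j ≤ p ∨ p + s + 1 ≤ j
    · have h1 := le_norm_nat_sub_cen hj
      have h2 := norm_sub_le (z - cen p s) (z - j)
      rw [sub_sub_sub_cancel_left] at h2
      linarith
    · have h1 := norm_nat_sub_cen_le (j := j) (p := p) (s := s) (by omega) (by omega)
      have h2 := norm_add_le (z - j) (j - cen p s)
      rw [sub_add_sub_cancel] at h2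
      linarith
  · have h1 := norm_cen_sub_center h
    have h2 := norm_add_le (z - cen p s) (cen p s - ((k : ℂ) + 1) / 2)
    rw [sub_add_sub_cancel] at h2
    linarith

theorem conv_subset_compl_holes {p s k : ℕ} (hs : 1 ≤ s) (h : p + s ≤ k) :
    conv p s ⊆ (holes k)ᶜ := by
  rintro z hz ⟨j, h1, h2, rfl⟩
  have := (conv_subset_safeRegion hs h hz).1 j h1 h2
  rw [sub_self, norm_zero] at this
  linarith [holeRadius_pos k]

/-! ## Isotopies of simple closed curves -/

-- Makes symmetry and concatenation of homotopies with a constraint on every stage available.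
open ContinuousMap in
theorem isotopicIn_iff_homotopicWith {X C C' : Set ℂ} :
    IsotopicIn X C C' ↔ ∃ f g : C(Circle, ℂ),
      HomotopicWith f g (fun h => Function.Injective h ∧ ∀ θ, h θ ∈ X) ∧
        Set.range f = C ∧ Set.range g = C' := by
  constructor
  · rintro ⟨H, hc, hi, hX, h0, h1⟩
    have hc' : ∀ t, Continuous fun θ => H (t, θ) := fun t => by fun_prop
    refine ⟨⟨_, hc' 0⟩, ⟨_, hc' 1⟩, ⟨⟨⟨⟨H, hc⟩, fun _ => rfl, fun _ => rfl⟩, fun t => ⟨hi t, hX t⟩⟩⟩,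
      h0, h1⟩
  · rintro ⟨f, g, ⟨H⟩, rfl, rfl⟩
    refine ⟨H, H.continuous, fun t => (H.prop t).1, fun t => (H.prop t).2, ?_, ?_⟩
    · simp only [HomotopyWith.apply_zero]
    · simp only [HomotopyWith.apply_one]

theorem IsotopicIn.symm {X C C' : Set ℂ} (h : IsotopicIn X C C') : IsotopicIn X C' C := by
  rw [isotopicIn_iff_homotopicWith] at h ⊢
  obtain ⟨f, g, H, hf, hg⟩ := h
  exact ⟨g, f, H.symm, hg, hf⟩

/-- Two injective continuous parametrizations of the same curve differ by a homeomorphism of the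
circle. -/
theorem exists_circle_homeomorph {f g : C(Circle, ℂ)} (hf : Function.Injective f)
    (hg : Function.Injective g) (h : Set.range f = Set.range g) :
    ∃ e : Circle ≃ₜ Circle, ∀ θ, g (e θ) = f θ := by
  have ef := (f.continuous.isClosedEmbedding hf).isEmbedding
  have eg := (g.continuous.isClosedEmbedding hg).isEmbedding
  refine ⟨(ef.toHomeomorph.trans (Homeomorph.setCongr h)).trans eg.toHomeomorph.symm, fun θ => ?_⟩
  have := eg.toHomeomorph.apply_symm_apply (Homeomorph.setCongr h (ef.toHomeomorph θ))
  exact congrArg Subtype.val this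

-- The two isotopies meet in the same subset but in different parametrizations of it; the second is
-- reparametrized by a homeomorphism of the circle before they are concatenated.
open ContinuousMap in
theorem IsotopicIn.trans {X C C' C'' : Set ℂ} (h : IsotopicIn X C C') (h' : IsotopicIn X C' C'') :
    IsotopicIn X C C'' := by
  rw [isotopicIn_iff_homotopicWith] at h h' ⊢
  obtain ⟨f, g, H, hf, hg⟩ := h
  obtain ⟨f', g', ⟨H'⟩, hf', hg'⟩ := h'
  have ig : Function.Injective g := by
    obtain ⟨H⟩ := H.symm
    convert (H.prop 0).1; ext θ; exact (H.apply_zero θ).symm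
  have if' : Function.Injective f' := by
    convert (H'.prop 0).1; ext θ; exact (H'.apply_zero θ).symm
  obtain ⟨e, he⟩ := exists_circle_homeomorph ig if' (hg.trans hf'.symm)
  refine ⟨f, g'.comp ⟨e, e.continuous⟩, H.trans ?_, hf, ?_⟩
  · refine ⟨⟨⟨⟨fun p => H' (p.1, e p.2), by have := H'.continuous; fun_prop⟩, fun θ => ?_,
      fun θ => ?_⟩, fun t => ⟨?_, fun θ => (H'.prop t).2 (e θ)⟩⟩⟩
    · exact (H'.apply_zero (e θ)).trans (he θ)
    · exact H'.apply_one (e θ)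
    · exact (H'.prop t).1.comp e.injective
  · rw [ContinuousMap.coe_comp, Set.range_comp]
    change g' '' Set.range e = C''
    rw [e.surjective.range_eq, Set.image_univ, hg']

theorem IsotopicIn.image {X Y C C' : Set ℂ} (h : IsotopicIn X C C') {f : ℂ → ℂ}
    (hc : ContinuousOn f X) (hi : Set.InjOn f X) (hm : Set.MapsTo f X Y) :
    IsotopicIn Y (f '' C) (f '' C') := by
  obtain ⟨H, hH, hinj, hX, rfl, rfl⟩ := h
  refine ⟨f ∘ H, hc.comp_continuous hH fun p => hX p.1 p.2, fun t a b hab => ?_,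
    fun t θ => hm (hX t θ), ?_, ?_⟩
  · exact hinj t (hi (hX t a) (hX t b) hab)
  · rw [← Set.range_comp]; rfl
  · rw [← Set.range_comp]; rfl

theorem IsotopicIn.mono {X Y C C' : Set ℂ} (h : IsotopicIn X C C') (hXY : X ⊆ Y) :
    IsotopicIn Y C C' := by
  obtain ⟨H, hH, hinj, hX, h0, h1⟩ := h
  exact ⟨H, hH, hinj, fun t θ => hXY (hX t θ), h0, h1⟩

/-! ## Isotopies of homeomorphisms of the plane relative to the holes -/

/-- The homeomorphisms of the plane that permute the centres of the `k` holes. -/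
def holeStabilizer (k : ℕ) : Subgroup (ℂ ≃ₜ ℂ) where
  carrier := {f | f '' holes k = holes k}
  mul_mem' {f g} hf hg := by
    change (f ∘ g) '' holes k = holes k
    rw [Set.image_comp]
    exact (congrArg _ hg).trans hf
  one_mem' := Set.image_id _
  inv_mem' {f} hf := by
    change f.symm '' holes k = holes k
    nth_rewrite 1 [← (hf : f '' holes k = holes k)]
    exact f.toEquiv.symm_image_image _

theorem mem_holeStabilizer_of_mapsTo {k : ℕ} {f : ℂ ≃ₜ ℂ} (h : Set.MapsTo f (holes k) (holes k)) :
    f ∈ holeStabilizer k := by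
  change f '' holes k = holes k
  exact Set.eq_of_subset_of_ncard_le h.image_subset
    (by rw [Set.ncard_image_of_injective _ f.injective]) (finite_holes k)

theorem tw_mem_holeStabilizer {p s k : ℕ} (h : p + s ≤ k) : tw p s ∈ holeStabilizer k :=
  mem_holeStabilizer_of_mapsTo (tw_mapsTo_holes h)

theorem mapsTo_of_mem_holeStabilizer {k : ℕ} {f : ℂ ≃ₜ ℂ} (h : f ∈ holeStabilizer k) :
    Set.MapsTo f (holes k) (holes k) := by
  intro z hz
  rw [← (h : f '' holes k = holes k)]
  exact Set.mem_image_of_mem f hz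

theorem mapsTo_compl_of_mem_holeStabilizer {k : ℕ} {f : ℂ ≃ₜ ℂ} (h : f ∈ holeStabilizer k) :
    Set.MapsTo f (holes k)ᶜ (holes k)ᶜ := by
  intro z hz hfz
  rw [← (h : f '' holes k = holes k)] at hfz
  obtain ⟨w, hw, hwz⟩ := hfz
  exact hz (f.injective hwz ▸ hw)

/-- Isotopy of homeomorphisms of the plane through injective maps that preserve the set of the
centres of the `k` holes. -/
def MapIso (k : ℕ) (f g : ℂ ≃ₜ ℂ) : Prop :=
  ContinuousMap.HomotopicWith (f : C(ℂ, ℂ)) (g : C(ℂ, ℂ))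
    (fun h => Function.Injective h ∧ Set.MapsTo h (holes k) (holes k))

theorem MapIso.of_family {k : ℕ} {f g : ℂ ≃ₜ ℂ} (F : unitInterval × ℂ → ℂ) (hF : Continuous F)
    (hi : ∀ t, Function.Injective fun z => F (t, z))
    (hm : ∀ t, Set.MapsTo (fun z => F (t, z)) (holes k) (holes k))
    (h0 : ∀ z, F (0, z) = f z) (h1 : ∀ z, F (1, z) = g z) : MapIso k f g :=
  ⟨⟨⟨⟨F, hF⟩, h0, h1⟩, fun t => ⟨hi t, hm t⟩⟩⟩

theorem MapIso.refl {k : ℕ} {f : ℂ ≃ₜ ℂ} (hf : f ∈ holeStabilizer k) : MapIso k f f :=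
  ContinuousMap.HomotopicWith.refl _ ⟨f.injective, mapsTo_of_mem_holeStabilizer hf⟩

theorem MapIso.trans {k : ℕ} {f g h : ℂ ≃ₜ ℂ} (h₁ : MapIso k f g) (h₂ : MapIso k g h) :
    MapIso k f h :=
  ContinuousMap.HomotopicWith.trans h₁ h₂

theorem MapIso.mul_left {k : ℕ} {f g : ℂ ≃ₜ ℂ} (H : MapIso k f g) {h : ℂ ≃ₜ ℂ}
    (hh : h ∈ holeStabilizer k) : MapIso k (h * f) (h * g) := by
  obtain ⟨F⟩ := H
  refine MapIso.of_family (fun p => h (F p)) (by have := F.continuous; fun_prop)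
    (fun t => h.injective.comp (F.prop t).1)
    (fun t => (mapsTo_of_mem_holeStabilizer hh).comp (F.prop t).2) (fun z => ?_) (fun z => ?_)
  · exact congrArg h (F.apply_zero z)
  · exact congrArg h (F.apply_one z)

theorem MapIso.mul_right {k : ℕ} {f g : ℂ ≃ₜ ℂ} (H : MapIso k f g) {h : ℂ ≃ₜ ℂ}
    (hh : h ∈ holeStabilizer k) : MapIso k (f * h) (g * h) := by
  obtain ⟨F⟩ := H
  refine MapIso.of_family (fun p => F (p.1, h p.2)) (by have := F.continuous; fun_prop)
    (fun t => (F.prop t).1.comp h.injective)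
    (fun t => (F.prop t).2.comp (mapsTo_of_mem_holeStabilizer hh)) (fun z => ?_) (fun z => ?_)
  · exact F.apply_zero (h z)
  · exact F.apply_one (h z)

/-- The hypothesis `hC` just says that `C` is a simple closed curve avoiding the centres. Every
stage is injective and maps the finite set of centres into itself, hence onto itself, so nothing
else can hit a centre. -/
theorem MapIso.isotopicIn {k : ℕ} {f g : ℂ ≃ₜ ℂ} (H : MapIso k f g) {C : Set ℂ}
    (hC : IsotopicIn (holes k)ᶜ C C) : IsotopicIn (holes k)ᶜ (f '' C) (g '' C) := by
  obtain ⟨F⟩ := H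
  obtain ⟨K, hK, hinj, hX, rfl, -⟩ := hC
  refine ⟨fun p => F (p.1, K (0, p.2)), by have := F.continuous; fun_prop,
    fun t => (F.prop t).1.comp (hinj 0), fun t θ => ?_, ?_, ?_⟩
  · intro hcon
    have hm : Set.MapsTo (fun z => F (t, z)) (holes k) (holes k) := (F.prop t).2
    have hi : Function.Injective fun z => F (t, z) := (F.prop t).1
    have himg : (fun z => F (t, z)) '' holes k = holes k :=
      Set.eq_of_subset_of_ncard_le hm.image_subset
        (by rw [Set.ncard_image_of_injective _ hi]) (finite_holes k)
    obtain ⟨w, hw, hwz⟩ := himg.ge hcon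
    exact hX 0 θ (hi hwz ▸ hw)
  · rw [← Set.range_comp]; congr 1; ext θ; exact F.apply_zero _
  · rw [← Set.range_comp]; congr 1; ext θ; exact F.apply_one _

theorem IsotopicIn.image_homeo {k : ℕ} {C C' : Set ℂ} (h : IsotopicIn (holes k)ᶜ C C')
    {f : ℂ ≃ₜ ℂ} (hf : f ∈ holeStabilizer k) : IsotopicIn (holes k)ᶜ (f '' C) (f '' C') :=
  h.image f.continuous.continuousOn f.injective.injOn (mapsTo_compl_of_mem_holeStabilizer hf)

/-! ## Lifting motions of finite configurations to isotopies of the plane -/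

/-- The map that pushes each point `x j` of a configuration to `y j`, supported near the `x j`. -/
noncomputable def pushMap {K : Type*} [Fintype K] (δ : ℝ) (x y : K → ℂ) (z : ℂ) : ℂ :=
  z + ∑ j, ((max 0 (1 - ‖z - x j‖ / δ) : ℝ) : ℂ) * (y j - x j)

theorem pushMap_self {K : Type*} [Fintype K] (δ : ℝ) (x : K → ℂ) (z : ℂ) :
    pushMap δ x x z = z := by simp [pushMap]

theorem pushMap_apply {K : Type*} [Fintype K] {δ : ℝ} (hδ : 0 < δ) {x : K → ℂ}
    (hx : ∀ j l, j ≠ l → δ ≤ ‖x j - x l‖) (y : K → ℂ) (j : K) : pushMap δ x y (x j) = y j := by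
  classical
  rw [pushMap, Finset.sum_eq_single j]
  · simp
  · intro l _ hl
    have : 1 - ‖x j - x l‖ / δ ≤ 0 := by
      rw [sub_nonpos, le_div_iff₀ hδ, one_mul]; exact hx j l hl.symm
    rw [max_eq_left this]; simp
  · simp

/-- Each bump has Lipschitz constant `1 / δ`, so the displacement is a contraction as soon as the
total length of the pushes is below `δ`, and identity plus contraction is injective. -/
theorem pushMap_injective {K : Type*} [Fintype K] {δ : ℝ} (hδ : 0 < δ) {x y : K → ℂ}
    (h : ∑ j, ‖y j - x j‖ < δ) : Function.Injective (pushMap δ x y) := by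
  intro z w hzw
  by_contra hne
  have hpos : 0 < ‖z - w‖ := norm_pos_iff.2 (sub_ne_zero.2 hne)
  have h1 : z - w = ∑ j, (((max 0 (1 - ‖w - x j‖ / δ) : ℝ) : ℂ) -
      ((max 0 (1 - ‖z - x j‖ / δ) : ℝ) : ℂ)) * (y j - x j) := by
    simp only [sub_mul, Finset.sum_sub_distrib]
    simp only [pushMap] at hzw
    linear_combination hzw
  have h2 : ‖z - w‖ ≤ ∑ j, ‖z - w‖ / δ * ‖y j - x j‖ := by
    nth_rewrite 1 [h1]
    refine (norm_sum_le _ _).trans (Finset.sum_le_sum fun j _ => ?_)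
    rw [norm_mul]
    refine mul_le_mul_of_nonneg_right ?_ (norm_nonneg _)
    rw [← Complex.ofReal_sub, Complex.norm_real, Real.norm_eq_abs]
    have h3 := abs_max_sub_max_le_abs (1 - ‖w - x j‖ / δ) (1 - ‖z - x j‖ / δ) 0
    rw [max_comm _ 0, max_comm _ 0] at h3
    refine h3.trans ?_
    have h4 : 1 - ‖w - x j‖ / δ - (1 - ‖z - x j‖ / δ) = (‖z - x j‖ - ‖w - x j‖) / δ := by ring
    rw [h4, abs_div, abs_of_pos hδ]
    gcongr
    have := abs_norm_sub_norm_le (z - x j) (w - x j)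
    rwa [sub_sub_sub_cancel_right] at this
  rw [← Finset.mul_sum] at h2
  have h5 : ‖z - w‖ / δ * ∑ j, ‖y j - x j‖ < ‖z - w‖ / δ * δ := by gcongr
  rw [div_mul_cancel₀ _ hδ.ne'] at h5
  linarith

theorem continuous_pushMap {K T : Type*} [Fintype K] [TopologicalSpace T] (δ : ℝ) {x y : T → K → ℂ}
    {z : T → ℂ} (hx : Continuous x) (hy : Continuous y) (hz : Continuous z) :
    Continuous fun t => pushMap δ (x t) (y t) (z t) := by
  unfold pushMap
  refine hz.add (continuous_finsetSum _ fun j _ => ?_)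
  have hxj := (continuous_apply j).comp hx
  have hyj := (continuous_apply j).comp hy
  simp only [Function.comp_def] at hxj hyj
  fun_prop

-- One short time step: the lift that reaches time `τ t` is followed by a push from time `τ t` to
-- time `υ t`.
open unitInterval in
theorem exists_ambient_lift_step {K : Type*} [Fintype K] {m : I × I → K → ℂ} (hm : Continuous m)
    {δ : ℝ} (hδ : 0 < δ) (hsep : ∀ p j l, j ≠ l → δ ≤ ‖m p j - m p l‖) {τ υ : I → I}
    (hτ : Continuous τ) (hυ : Continuous υ) (hτ0 : τ 0 = 0) (hυ0 : υ 0 = 0)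
    (hsmall : ∀ s t, ∑ j, ‖m (s, υ t) j - m (s, τ t) j‖ < δ)
    (h : ∃ G : I × I × ℂ → ℂ, Continuous G ∧ (∀ s t, Function.Injective fun z => G (s, t, z)) ∧
      (∀ s z, G (s, 0, z) = z) ∧ ∀ s t j, G (s, t, m (s, 0) j) = m (s, τ t) j) :
    ∃ G : I × I × ℂ → ℂ, Continuous G ∧ (∀ s t, Function.Injective fun z => G (s, t, z)) ∧
      (∀ s z, G (s, 0, z) = z) ∧ ∀ s t j, G (s, t, m (s, 0) j) = m (s, υ t) j := by
  obtain ⟨G, hG, hGi, hG0, hGm⟩ := h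
  have h1 : Continuous fun p : I × I × ℂ => (p.1, τ p.2.1) := by fun_prop
  have h2 : Continuous fun p : I × I × ℂ => (p.1, υ p.2.1) := by fun_prop
  refine ⟨fun p => pushMap δ (m (p.1, τ p.2.1)) (m (p.1, υ p.2.1)) (G p),
    continuous_pushMap δ (hm.comp h1) (hm.comp h2) hG,
    fun s t => (pushMap_injective hδ (hsmall s t)).comp (hGi s t), fun s z => ?_, fun s t j => ?_⟩
  · simp only [hτ0, hυ0, pushMap_self, hG0]
  · simp only [hGm]
    exact pushMap_apply hδ (fun j l h => hsep _ j l h) _ j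

open unitInterval in
/-- A homotopy of motions of a finite configuration lifts to a family of ambient isotopies. -/
theorem exists_ambient_lift {K : Type*} [Fintype K] (m : I × I → K → ℂ) (hm : Continuous m)
    (hinj : ∀ p, Function.Injective (m p)) :
    ∃ G : I × I × ℂ → ℂ, Continuous G ∧ (∀ s t, Function.Injective fun z => G (s, t, z)) ∧
      (∀ s z, G (s, 0, z) = z) ∧ ∀ s t j, G (s, t, m (s, 0) j) = m (s, t) j := by
  -- A uniform separation of the points exists because the parameter square is compact.
  obtain ⟨δ, hδ, hsep⟩ : ∃ δ : ℝ, 0 < δ ∧ ∀ p j l, j ≠ l → δ ≤ ‖m p j - m p l‖ := by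
    have h1 : ∀ q : K × K, ∀ᶠ δ : ℝ in nhdsWithin 0 (Set.Ioi 0),
        ∀ p, q.1 ≠ q.2 → δ ≤ ‖m p q.1 - m p q.2‖ := by
      rintro ⟨j, l⟩
      by_cases hjl : j = l
      · exact Filter.Eventually.of_forall fun δ p h => absurd hjl h
      have hc : Continuous fun p => ‖m p j - m p l‖ := by fun_prop
      obtain ⟨p₀, -, hp₀⟩ := isCompact_univ.exists_isMinOn Set.univ_nonempty hc.continuousOn
      have hpos : 0 < ‖m p₀ j - m p₀ l‖ :=
        norm_pos_iff.2 (sub_ne_zero.2 fun h => hjl (hinj p₀ h))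
      filter_upwards [Ioc_mem_nhdsGT hpos] with δ hδ p _
      exact hδ.2.trans (hp₀ (Set.mem_univ p))
    obtain ⟨δ, h2, h3⟩ := ((Filter.eventually_all.2 h1).and self_mem_nhdsWithin).exists
    exact ⟨δ, h3, fun p j l => h2 (j, l) p⟩
  -- If each point moves by at most `ε`, the total displacement stays below `δ`; the `+ 1` gives
  -- strictness and covers an empty configuration.
  set ε := δ / (Fintype.card K + 1) with hε
  have hε0 : 0 < ε := by positivity
  obtain ⟨η, hη, huc⟩ := Metric.uniformContinuous_iff.1
    (CompactSpace.uniformContinuous_of_continuous hm) ε hε0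
  obtain ⟨N, hN⟩ := exists_nat_one_div_lt hη
  obtain ⟨τ, hτ, hτ0, hτz, hτN, hstep⟩ : ∃ τ : ℕ → I → I, (∀ n, Continuous (τ n)) ∧
      (∀ n, τ n 0 = 0) ∧ (∀ t, τ 0 t = 0) ∧ (∀ t, τ (N + 1) t = t) ∧
      ∀ n s t, dist ((s, τ (n + 1) t) : I × I) (s, τ n t) < η := by
    -- Time is truncated at `n / (N + 1)`: stage `0` is constant, stage `N + 1` is the true time,
    -- and consecutive stages differ by at most `1 / (N + 1) < η`.
    refine ⟨fun n t => ⟨min t ((n : ℝ) / (N + 1)), le_min t.2.1 (by positivity),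
      (min_le_left _ _).trans t.2.2⟩, fun n => Continuous.subtype_mk (by fun_prop) _, fun n =>
      Subtype.ext (min_eq_left ?_), fun t => Subtype.ext ?_, fun t => Subtype.ext ?_, ?_⟩
    · change (0 : ℝ) ≤ _; positivity
    · simpa using t.2.1
    · push_cast; rw [div_self (by positivity)]; exact min_eq_left t.2.2
    · intro n s t
      rw [Prod.dist_eq, dist_self, max_eq_right dist_nonneg, Subtype.dist_eq, Real.dist_eq]
      refine lt_of_le_of_lt ?_ hN
      have h := abs_min_sub_min_le_max (t : ℝ) (((n + 1 : ℕ) : ℝ) / (N + 1)) t ((n : ℝ) / (N + 1))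
      refine h.trans ?_
      rw [sub_self, abs_zero, max_eq_right (abs_nonneg _), ← sub_div]
      push_cast
      rw [add_sub_cancel_left, abs_of_pos (by positivity)]
  have main : ∀ n : ℕ, ∃ G : I × I × ℂ → ℂ, Continuous G ∧
      (∀ s t, Function.Injective fun z => G (s, t, z)) ∧
      (∀ s z, G (s, 0, z) = z) ∧ ∀ s t j, G (s, t, m (s, 0) j) = m (s, τ n t) j := by
    intro n
    induction n with
    | zero =>
      refine ⟨fun p => p.2.2, by fun_prop, fun s t => Function.injective_id, fun s z => rfl,
        fun s t j => ?_⟩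
      rw [hτz]
    | succ n ih =>
      refine exists_ambient_lift_step hm hδ hsep (hτ n) (hτ (n + 1)) (hτ0 n) (hτ0 (n + 1))
        (fun s t => ?_) ih
      have h1 := huc (hstep n s t)
      have h2 : ∀ j, ‖m (s, τ (n + 1) t) j - m (s, τ n t) j‖ ≤ ε := fun j => by
        rw [← dist_eq_norm]; exact (dist_le_pi_dist _ _ j).trans h1.le
      calc _ ≤ ∑ _j : K, ε := Finset.sum_le_sum fun j _ => h2 j
        _ = Fintype.card K * ε := by simp
        _ < (Fintype.card K + 1) * ε := by nlinarith
        _ = δ := by rw [hε]; field_simp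
  obtain ⟨G, h1, h2, h3, h4⟩ := main (N + 1)
  refine ⟨G, h1, h2, h3, fun s t j => by rw [h4, hτN]⟩

open unitInterval in
/-- Two ambient isotopies end in isotopic homeomorphisms if the motions of the holes that they
induce have the same end and the straight homotopy between them is free of collisions. -/
theorem MapIso.of_motions {k : ℕ} (a b : I → (ℂ ≃ₜ ℂ))
    (ha : Continuous fun p : I × ℂ => a p.1 p.2) (ha' : Continuous fun p : I × ℂ => (a p.1).symm p.2)
    (hb : Continuous fun p : I × ℂ => b p.1 p.2) (hb' : Continuous fun p : I × ℂ => (b p.1).symm p.2)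
    (ha0 : ∀ z, a 0 z = z) (hb0 : ∀ z, b 0 z = z) (ha1 : a 1 ∈ holeStabilizer k)
    (hab : ∀ z ∈ holes k, a 1 z = b 1 z)
    (hcol : ∀ (s t : I) (j l : ℕ), 1 ≤ j → j < l → l ≤ k →
      ((1 - s : ℝ) : ℂ) * (a t j - a t l) + ((s : ℝ) : ℂ) * (b t j - b t l) ≠ 0) :
    MapIso k (a 1) (b 1) := by
  let pt : Fin k → ℂ := fun j => ((j + 1 : ℕ) : ℂ)
  have hpt : ∀ j, pt j ∈ holes k := fun j => ⟨j + 1, by omega, by omega, rfl⟩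
  have hpt' : ∀ z ∈ holes k, ∃ j, pt j = z := by
    rintro _ ⟨j, h1, h2, rfl⟩
    exact ⟨⟨j - 1, by omega⟩, by simp only [pt, Nat.sub_add_cancel h1]⟩
  -- The straight homotopy, with parameter `p.1`, between the two motions of the centres in the time
  -- `p.2`.
  let m : I × I → Fin k → ℂ := fun p j =>
    ((1 - p.1 : ℝ) : ℂ) * a p.2 (pt j) + ((p.1 : ℝ) : ℂ) * b p.2 (pt j)
  have hm : Continuous m := by
    refine continuous_pi fun j => ?_
    have h1 : Continuous fun p : I × I => a p.2 (pt j) :=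
      ha.comp (by fun_prop : Continuous fun p : I × I => (p.2, pt j))
    have h2 : Continuous fun p : I × I => b p.2 (pt j) :=
      hb.comp (by fun_prop : Continuous fun p : I × I => (p.2, pt j))
    simp only [m]; fun_prop
  have hinj : ∀ p, Function.Injective (m p) := by
    intro p
    have key : ∀ j l : Fin k, j < l → m p j ≠ m p l := by
      intro j l hjl heq
      refine hcol p.1 p.2 (j + 1) (l + 1) (by omega) (by simpa using hjl) (by omega) ?_
      simp only [m, pt] at heq
      linear_combination heq
    intro j l heq
    rcases lt_trichotomy j l with h | h | h
    · exact absurd heq (key j l h)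
    · exact h
    · exact absurd heq.symm (key l j h)
  obtain ⟨G, hG, hGi, hG0, hGm⟩ := exists_ambient_lift m hm hinj
  have hm0 : ∀ s j, m (s, 0) j = pt j := fun s j => by
    simp only [m, ha0, hb0]; push_cast; ring
  have hm1 : ∀ s j, m (s, 1) j = a 1 (pt j) := fun s j => by
    simp only [m, ← hab _ (hpt j)]; push_cast; ring
  have hst := mapsTo_of_mem_holeStabilizer ha1
  let g : I → C(ℂ, ℂ) := fun s => ⟨fun z => G (s, 1, z), by fun_prop⟩
  -- If `G s` lifts the same motion as `c`, then `c 1 ∘ (c t)⁻¹ ∘ G s t` runs from `c 1` to the end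
  -- of the lift. On the centres it always equals `c 1`, because `(c t)⁻¹ ∘ G s t` fixes each of
  -- them.
  have side : ∀ (s : I) (c : I → (ℂ ≃ₜ ℂ)), (Continuous fun p : I × ℂ => c p.1 p.2) →
      (Continuous fun p : I × ℂ => (c p.1).symm p.2) → (∀ z, c 0 z = z) →
      (∀ z ∈ holes k, a 1 z = c 1 z) → (∀ t j, m (s, t) j = c t (pt j)) →
      ContinuousMap.HomotopicWith (c 1 : C(ℂ, ℂ)) (g s)
        (fun h => Function.Injective h ∧ Set.MapsTo h (holes k) (holes k)) := by
    intro s c hc hc' hc0 hac hmc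
    refine ⟨⟨⟨⟨fun p => c 1 ((c p.1).symm (G (s, p.1, p.2))), ?_⟩, ?_, ?_⟩, fun t => ⟨?_, ?_⟩⟩⟩
    · exact (c 1).continuous.comp (hc'.comp
        (by fun_prop : Continuous fun p : I × ℂ => (p.1, G (s, p.1, p.2))))
    · intro z
      change c 1 ((c 0).symm (G (s, 0, z))) = c 1 z
      rw [hG0]; congr 1
      exact (c 0).symm_apply_eq.2 (hc0 z).symm
    · intro z
      exact (c 1).apply_symm_apply _
    · exact (c 1).injective.comp ((c t).symm.injective.comp (hGi s t))
    · intro z hz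
      obtain ⟨j, rfl⟩ := hpt' z hz
      change c 1 ((c t).symm (G (s, t, pt j))) ∈ holes k
      have := hGm s t j
      rw [hm0] at this
      rw [this, hmc, (c t).symm_apply_apply, ← hac _ (hpt j)]
      exact hst (hpt j)
  have h1 := side 0 a ha ha' ha0 (fun _ _ => rfl) (fun t j => by simp [m])
  have h2 := side 1 b hb hb' hb0 hab (fun t j => by simp [m])
  -- The ends of the two lifts are joined by varying `s` at time `1`, where the configuration does
  -- not depend on `s`.
  have h3 : ContinuousMap.HomotopicWith (g 0) (g 1)
      (fun h => Function.Injective h ∧ Set.MapsTo h (holes k) (holes k)) := by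
    refine ⟨⟨⟨⟨fun p => G (p.1, 1, p.2), by fun_prop⟩, fun _ => rfl, fun _ => rfl⟩,
      fun s => ⟨hGi s 1, ?_⟩⟩⟩
    intro z hz
    obtain ⟨j, rfl⟩ := hpt' z hz
    change G (s, 1, pt j) ∈ holes k
    have := hGm s 1 j
    rw [hm0] at this
    rw [this, hm1]
    exact hst (hpt j)
  exact (h1.trans h3).trans h2.symm

/-! ## The relation between the half-twists along the pairs of three adjacent blocks -/

theorem complex_eq_center_add_rotation (θ x c : ℝ) :
    (c : ℂ) + Complex.exp (θ * Complex.I) * (x - c)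
      = ⟨c + Real.cos θ * (x - c), Real.sin θ * (x - c)⟩ := by
  rw [Complex.exp_mul_I, ← Complex.ofReal_cos, ← Complex.ofReal_sin]
  apply Complex.ext <;> simp [-Complex.ofReal_cos, -Complex.ofReal_sin]

theorem ptw_nat (θ : ℝ) {j p s : ℕ} (h1 : p + 1 ≤ j) (h2 : j ≤ p + s) :
    ptw θ p s j = ⟨cen p s + Real.cos θ * (j - cen p s), Real.sin θ * (j - cen p s)⟩ := by
  rw [ptw_nat_of_mem θ h1 h2, ← complex_eq_center_add_rotation, Complex.ofReal_natCast]

theorem ptw_pi_nat {j p s : ℕ} (h1 : p + 1 ≤ j) (h2 : j ≤ p + s) :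
    ptw Real.pi p s j = ((2 * p + s + 1 - j : ℕ) : ℂ) := tw_nat_of_mem h1 h2

/-- The motion of a hole when a block rotates while one of its subblocks is kept parallel. -/
theorem ptw_ptw_neg_nat (θ : ℝ) {j p x y z s : ℕ} (h : x + y + z = s) (h1 : p + x + 1 ≤ j)
    (h2 : j ≤ p + x + y) :
    ptw θ p s (ptw (-θ) (p + x) y j) =
      ⟨cen p s + Real.cos θ * (((x : ℝ) - z) / 2) + (j - cen (p + x) y),
        Real.sin θ * (((x : ℝ) - z) / 2)⟩ := by
  have hs : (s : ℝ) = x + y + z := by rw [← h]; push_cast; ring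
  have hexp : Complex.exp (θ * Complex.I) * Complex.exp ((-θ : ℝ) * Complex.I) = 1 := by
    rw [← Complex.exp_add, Complex.ofReal_neg, neg_mul, add_neg_cancel, Complex.exp_zero]
  have hc := cen_sub_nested p h
  have hcC : (cen (p + x) y : ℂ) = cen p s + (((x : ℝ) - z) / 2 : ℝ) := by
    rw [← hc]; push_cast; ring
  rw [ptw_nat_of_mem (-θ) h1 h2, ptw_of_le]
  · have : Complex.exp (θ * Complex.I) * (cen (p + x) y +
        Complex.exp ((-θ : ℝ) * Complex.I) * (j - cen (p + x) y) - cen p s)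
        = Complex.exp (θ * Complex.I) * ((((x : ℝ) - z) / 2 : ℝ) : ℂ) + (j - cen (p + x) y) := by
      linear_combination ((j : ℂ) - cen (p + x) y) * hexp + Complex.exp (θ * Complex.I) * hcC
    rw [this, Complex.exp_mul_I, ← Complex.ofReal_cos, ← Complex.ofReal_sin]
    apply Complex.ext <;> simp [add_assoc, -Complex.ofReal_cos, -Complex.ofReal_sin]
  · have e : (cen (p + x) y : ℂ) + Complex.exp ((-θ : ℝ) * Complex.I) * (j - cen (p + x) y) - cen p s
        = Complex.exp ((-θ : ℝ) * Complex.I) * (j - cen (p + x) y) + (cen (p + x) y - cen p s) := by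
      ring
    rw [e]
    refine (norm_add_le _ _).trans ?_
    rw [norm_exp_mul_I_mul, norm_cen_sub_nested p h]
    have h3 := norm_nat_sub_cen_le h1 h2
    have h4 := third_le_innR (s := s) (by omega)
    have h5 : |(x : ℝ) - z| ≤ x + z := by
      rw [abs_le]
      constructor <;> linarith [(Nat.cast_nonneg x : (0:ℝ) ≤ x), (Nat.cast_nonneg z : (0:ℝ) ≤ z)]
    linarith

section ThreeBlocks

variable (u v w : ℕ)

/-- The rotation of the blocks of sizes `w`, `v`, the second one being kept parallel. -/
noncomputable def firstStage (θ : ℝ) : ℂ ≃ₜ ℂ := ptw θ 0 (v + w) * ptw (-θ) w v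

/-- The rotation of the blocks of sizes `w`, `u`, both being kept parallel. -/
noncomputable def secondStage (θ : ℝ) : ℂ ≃ₜ ℂ :=
  ptw θ v (u + w) * (ptw (-θ) v w * ptw (-θ) (v + w) u)

/-- The rotation of the blocks of sizes `v`, `u`. -/
noncomputable def thirdStage (θ : ℝ) : ℂ ≃ₜ ℂ := ptw θ 0 (u + v)

variable {u v w}

theorem firstStage_left (θ : ℝ) {j : ℕ} (h1 : 1 ≤ j) (h2 : j ≤ w) :
    firstStage v w θ j = ⟨cen 0 (v + w) + Real.cos θ * (j - cen 0 (v + w)),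
      Real.sin θ * (j - cen 0 (v + w))⟩ := by
  change ptw θ 0 (v + w) (ptw (-θ) w v j) = _
  rw [ptw_nat_of_not_mem _ (by omega), ptw_nat _ (by omega) (by omega)]

theorem firstStage_middle (θ : ℝ) {j : ℕ} (h1 : w + 1 ≤ j) (h2 : j ≤ v + w) :
    firstStage v w θ j = ⟨j - w / 2 + Real.cos θ * (w / 2), Real.sin θ * (w / 2)⟩ := by
  change ptw θ 0 (v + w) (ptw (-θ) w v j) = _
  have := ptw_ptw_neg_nat θ (j := j) (p := 0) (x := w) (y := v) (z := 0) (s := v + w) (by omega)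
    (by omega) (by omega)
  rw [zero_add] at this
  rw [this]
  apply Complex.ext
  · simp only [cen]; push_cast; ring
  · simp

theorem firstStage_right (θ : ℝ) {j : ℕ} (h : v + w + 1 ≤ j) : firstStage v w θ j = j := by
  change ptw θ 0 (v + w) (ptw (-θ) w v j) = _
  rw [ptw_nat_of_not_mem _ (by omega), ptw_nat_of_not_mem _ (by omega)]

theorem firstStage_pi_left {j : ℕ} (h1 : 1 ≤ j) (h2 : j ≤ w) :
    firstStage v w Real.pi j = ((v + w + 1 - j : ℕ) : ℂ) := by
  rw [firstStage_left _ h1 h2, Nat.cast_sub (by omega), cen]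
  apply Complex.ext <;> simp
  ring

theorem firstStage_pi_middle {j : ℕ} (h1 : w + 1 ≤ j) (h2 : j ≤ v + w) :
    firstStage v w Real.pi j = ((j - w : ℕ) : ℂ) := by
  rw [firstStage_middle _ h1 h2, Nat.cast_sub (by omega)]
  apply Complex.ext <;> simp
  ring

theorem secondStage_left (θ : ℝ) {j : ℕ} (h : j ≤ v) : secondStage u v w θ j = j := by
  change ptw θ v (u + w) (ptw (-θ) v w (ptw (-θ) (v + w) u j)) = _
  rw [ptw_nat_of_not_mem _ (by omega), ptw_nat_of_not_mem _ (by omega), ptw_nat_of_not_mem _ (by omega)]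

theorem secondStage_middle (θ : ℝ) {j : ℕ} (h1 : v + 1 ≤ j) (h2 : j ≤ v + w) :
    secondStage u v w θ j = ⟨j + u / 2 - Real.cos θ * (u / 2), - (Real.sin θ * (u / 2))⟩ := by
  change ptw θ v (u + w) (ptw (-θ) v w (ptw (-θ) (v + w) u j)) = _
  have := ptw_ptw_neg_nat θ (j := j) (p := v) (x := 0) (y := w) (z := u) (s := u + w) (by omega)
    (by omega) (by omega)
  rw [add_zero] at this
  rw [ptw_nat_of_not_mem _ (by omega), this]
  apply Complex.ext
  · simp only [cen]; push_cast; ring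
  · simp only [CharP.cast_eq_zero]; ring

theorem secondStage_right (θ : ℝ) {j : ℕ} (h1 : v + w + 1 ≤ j) (h2 : j ≤ u + v + w) :
    secondStage u v w θ j = ⟨j - w / 2 + Real.cos θ * (w / 2), Real.sin θ * (w / 2)⟩ := by
  have hcomm := (ptw_commute_disjoint (-θ) (-θ) (p := v) (s := w) (p' := v + w) (s' := u) le_rfl).eq
  rw [secondStage, hcomm]
  change ptw θ v (u + w) (ptw (-θ) (v + w) u (ptw (-θ) v w j)) = _
  have := ptw_ptw_neg_nat θ (j := j) (p := v) (x := w) (y := u) (z := 0) (s := u + w) (by omega)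
    (by omega) (by omega)
  rw [ptw_nat_of_not_mem _ (by omega), this]
  apply Complex.ext
  · simp only [cen]; push_cast; ring
  · simp

theorem secondStage_outside (θ : ℝ) {j : ℕ} (h : u + v + w + 1 ≤ j) :
    secondStage u v w θ j = j := by
  change ptw θ v (u + w) (ptw (-θ) v w (ptw (-θ) (v + w) u j)) = _
  rw [ptw_nat_of_not_mem _ (by omega), ptw_nat_of_not_mem _ (by omega), ptw_nat_of_not_mem _ (by omega)]

theorem secondStage_pi_middle {j : ℕ} (h1 : v + 1 ≤ j) (h2 : j ≤ v + w) :
    secondStage u v w Real.pi j = ((j + u : ℕ) : ℂ) := by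
  rw [secondStage_middle _ h1 h2]
  apply Complex.ext <;> simp
  ring

theorem secondStage_pi_right {j : ℕ} (h1 : v + w + 1 ≤ j) (h2 : j ≤ u + v + w) :
    secondStage u v w Real.pi j = ((j - w : ℕ) : ℂ) := by
  rw [secondStage_right _ h1 h2, Nat.cast_sub (by omega)]
  apply Complex.ext <;> simp
  ring

/-! ### Absence of collisions between the three stages and the rigid rotation -/

/-- Two differences of positions whose convex combinations do not vanish. -/
def Separated (d e : ℂ) : Prop :=
  (d.re < 0 ∧ e.re < 0) ∨ (0 < d.re ∧ 0 < e.re) ∨ (d.im ≤ 0 ∧ e.im < 0)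

theorem Separated.combination_ne_zero {d e : ℂ} (h : Separated d e) (hd : d ≠ 0)
    (s : unitInterval) : ((1 - s : ℝ) : ℂ) * d + ((s : ℝ) : ℂ) * e ≠ 0 := by
  intro h0
  have hs0 := s.2.1
  have hs1 := s.2.2
  have hre := congrArg Complex.re h0
  have him := congrArg Complex.im h0
  simp only [Complex.add_re, Complex.re_ofReal_mul, Complex.add_im, Complex.im_ofReal_mul,
    Complex.zero_re, Complex.zero_im] at hre him
  rcases hs0.eq_or_lt with hs | hs
  · rw [← hs] at h0
    simp at h0
    exact hd h0
  · rcases h with ⟨h1, h2⟩ | ⟨h1, h2⟩ | ⟨h1, h2⟩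
    · nlinarith
    · nlinarith
    · nlinarith

/-- The rotation of all the three blocks. -/
theorem whole_nat (θ : ℝ) {j n : ℕ} (h1 : 1 ≤ j) (h2 : j ≤ n) :
    ptw θ 0 n j = ⟨(n + 1) / 2 + Real.cos θ * (j - (n + 1) / 2), Real.sin θ * (j - (n + 1) / 2)⟩ := by
  rw [ptw_nat _ (by omega) (by omega), cen]; simp

theorem convex_bounds {C a b x : ℝ} (h1 : -1 ≤ C) (h2 : C ≤ 1) (ha : a ≤ x) (hb : x ≤ b) :
    a ≤ (a + b) / 2 + C * (x - (a + b) / 2) ∧ (a + b) / 2 + C * (x - (a + b) / 2) ≤ b := by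
  constructor
  · nlinarith [mul_nonneg (by linarith : 0 ≤ 1 + C) (sub_nonneg.2 ha),
      mul_nonneg (by linarith : 0 ≤ 1 - C) (sub_nonneg.2 hb)]
  · nlinarith [mul_nonneg (by linarith : 0 ≤ 1 + C) (sub_nonneg.2 hb),
      mul_nonneg (by linarith : 0 ≤ 1 - C) (sub_nonneg.2 ha)]

/-- While `cos φ > 0`, the rigid rotation puts the hole `j` both to the left of and below the hole
`l > j` of the three blocks. If `l` lies in the third block, the first stage keeps `j` to its left;
if both are in the rotating blocks, `j` never gets above `l`. A hole `l` beyond the three blocks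
stays to the right in both motions. -/
theorem separated_firstStage {θ φ : ℝ} (hθ : 0 ≤ Real.sin θ) (hφ : 0 < Real.sin φ)
    (hφ' : 0 < Real.cos φ) {j l : ℕ} (hj : 1 ≤ j) (hjl : j < l) :
    Separated (firstStage v w θ j - firstStage v w θ l)
      (ptw φ 0 (u + v + w) j - ptw φ 0 (u + v + w) l) := by
  have hC1 := Real.neg_one_le_cos θ
  have hC2 := Real.cos_le_one θ
  have hD1 := Real.neg_one_le_cos φ
  have hD2 := Real.cos_le_one φ
  have hj' : (1 : ℝ) ≤ j := by exact_mod_cast hj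
  have hjl' : (j : ℝ) + 1 ≤ l := by exact_mod_cast hjl
  have hv : (0 : ℝ) ≤ v := Nat.cast_nonneg v
  have hw : (0 : ℝ) ≤ w := Nat.cast_nonneg w
  have hu : (0 : ℝ) ≤ u := Nat.cast_nonneg u
  have hre : ∀ i : ℕ, 1 ≤ i → i ≤ v + w →
      (firstStage v w θ i).re ≤ v + w ∧ (w + 1 ≤ i → (firstStage v w θ i).re ≤ i) := by
    intro i h1 h2
    have h1' : (1 : ℝ) ≤ i := by exact_mod_cast h1
    have h2' : (i : ℝ) ≤ v + w := by exact_mod_cast h2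
    by_cases hi : i ≤ w
    · refine ⟨?_, fun h => by omega⟩
      rw [firstStage_left _ h1 hi]
      have := (convex_bounds hC1 hC2 h1' h2').2
      simp only [cen]; push_cast
      convert this using 1; ring
    · have : (firstStage v w θ i).re ≤ i := by
        rw [firstStage_middle _ (by omega) h2]
        change (i : ℝ) - w / 2 + Real.cos θ * (w / 2) ≤ i
        nlinarith
      exact ⟨this.trans h2', fun _ => this⟩
  by_cases hl : l ≤ u + v + w
  · have him : (ptw φ 0 (u + v + w) j - ptw φ 0 (u + v + w) l).im < 0 := by
      rw [whole_nat φ hj (by omega), whole_nat φ (by omega) hl, Complex.sub_im]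
      change Real.sin φ * _ - Real.sin φ * _ < 0
      nlinarith
    have hreb : (ptw φ 0 (u + v + w) j - ptw φ 0 (u + v + w) l).re < 0 := by
      rw [whole_nat φ hj (by omega), whole_nat φ (by omega) hl, Complex.sub_re]
      change _ + Real.cos φ * _ - (_ + Real.cos φ * _) < 0
      nlinarith
    by_cases h3 : v + w + 1 ≤ l
    · left
      refine ⟨?_, hreb⟩
      rw [Complex.sub_re, firstStage_right _ h3, Complex.natCast_re]
      by_cases h4 : v + w + 1 ≤ j
      · rw [firstStage_right _ h4, Complex.natCast_re]; linarith
      · have := (hre j hj (by omega)).1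
        have h3' : (v : ℝ) + w + 1 ≤ l := by exact_mod_cast h3
        linarith
    · refine Or.inr (Or.inr ⟨?_, him⟩)
      rw [Complex.sub_im]
      by_cases h4 : l ≤ w
      · rw [firstStage_left _ hj (by omega), firstStage_left _ (by omega) h4]
        change Real.sin θ * _ - Real.sin θ * _ ≤ 0
        nlinarith
      · rw [firstStage_middle _ (j := l) (by omega) (by omega)]
        by_cases h5 : j ≤ w
        · rw [firstStage_left _ hj h5]
          have h5' : (j : ℝ) ≤ w := by exact_mod_cast h5
          simp only [cen]; push_cast
          nlinarith
        · rw [firstStage_middle _ (j := j) (by omega) (by omega)]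
          simp
  · left
    have hl' : (u : ℝ) + v + w + 1 ≤ l := by exact_mod_cast (by omega : u + v + w + 1 ≤ l)
    rw [Complex.sub_re, Complex.sub_re, firstStage_right (j := l) _ (by omega),
      ptw_nat_of_not_mem (j := l) _ (by omega), Complex.natCast_re]
    constructor
    · by_cases h4 : v + w + 1 ≤ j
      · rw [firstStage_right _ h4, Complex.natCast_re]; linarith
      · have := (hre j hj (by omega)).1
        linarith
    · by_cases h4 : j ≤ u + v + w
      · rw [whole_nat φ hj h4]
        have := (convex_bounds hD1 hD2 hj' (by exact_mod_cast h4 : (j : ℝ) ≤ ((u + v + w : ℕ) : ℝ))).2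
        push_cast at this ⊢
        change _ + _ * _ - _ < 0
        rw [add_comm (1 : ℝ)] at this
        linarith
      · rw [ptw_nat_of_not_mem (j := j) _ (by omega), Complex.natCast_re]; linarith

/-- Within the three blocks heights alone suffice: the block of size `w` is at or below the axis,
that of size `v` rests on it, and that of size `u` is at or above it, in the original order of the
blocks. Hence no sign of `cos φ` is needed. -/
theorem separated_secondStage {θ φ : ℝ} (hθ : 0 ≤ Real.sin θ) (hφ : 0 < Real.sin φ)
    {j l : ℕ} (hj : 1 ≤ j) (hjl : j < l) :
    Separated
      (secondStage u v w θ (firstStage v w Real.pi j) -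
        secondStage u v w θ (firstStage v w Real.pi l))
      (ptw φ 0 (u + v + w) j - ptw φ 0 (u + v + w) l) := by
  have hC1 := Real.neg_one_le_cos θ
  have hC2 := Real.cos_le_one θ
  have hD1 := Real.neg_one_le_cos φ
  have hD2 := Real.cos_le_one φ
  have hj' : (1 : ℝ) ≤ j := by exact_mod_cast hj
  have hjl' : (j : ℝ) + 1 ≤ l := by exact_mod_cast hjl
  have hv : (0 : ℝ) ≤ v := Nat.cast_nonneg v
  have hw : (0 : ℝ) ≤ w := Nat.cast_nonneg w
  have hu : (0 : ℝ) ≤ u := Nat.cast_nonneg u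
  have h3 : ∀ i : ℕ, 1 ≤ i → i ≤ w → secondStage u v w θ (firstStage v w Real.pi i) =
      ⟨v + w + 1 - i + u / 2 - Real.cos θ * (u / 2), - (Real.sin θ * (u / 2))⟩ := fun i h1 h2 => by
    rw [firstStage_pi_left h1 h2, secondStage_middle _ (by omega) (by omega),
      Nat.cast_sub (by omega)]
    push_cast; rfl
  have h2 : ∀ i : ℕ, w + 1 ≤ i → i ≤ v + w →
      secondStage u v w θ (firstStage v w Real.pi i) = ⟨i - w, 0⟩ := fun i h1 h2 => by
    rw [firstStage_pi_middle h1 h2, secondStage_left _ (by omega), Nat.cast_sub (by omega)]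
    apply Complex.ext <;> simp
  have h1 : ∀ i : ℕ, v + w + 1 ≤ i → i ≤ u + v + w →
      secondStage u v w θ (firstStage v w Real.pi i) =
      ⟨i - w / 2 + Real.cos θ * (w / 2), Real.sin θ * (w / 2)⟩ := fun i h1 h2 => by
    rw [firstStage_right _ h1, secondStage_right _ h1 h2]
  have h0 : ∀ i : ℕ, u + v + w + 1 ≤ i →
      secondStage u v w θ (firstStage v w Real.pi i) = i := fun i h1 => by
    rw [firstStage_right _ (by omega), secondStage_outside _ h1]
  by_cases hl : l ≤ u + v + w
  · refine Or.inr (Or.inr ⟨?_, ?_⟩)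
    · rw [Complex.sub_im]
      have hSw : 0 ≤ Real.sin θ * (w / 2) := by positivity
      have hSu : 0 ≤ Real.sin θ * (u / 2) := by positivity
      rcases (by omega : j ≤ w ∨ (w + 1 ≤ j ∧ j ≤ v + w) ∨ v + w + 1 ≤ j) with a | a | a
      · rw [h3 j hj a]
        rcases (by omega : l ≤ w ∨ (w + 1 ≤ l ∧ l ≤ v + w) ∨ v + w + 1 ≤ l) with b | b | b
        · rw [h3 l (by omega) b]; simp
        · rw [h2 l b.1 b.2]; simpa using hSu
        · rw [h1 l b hl]; change -_ - _ ≤ (0 : ℝ); linarith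
      · rw [h2 j a.1 a.2]
        rcases (by omega : (w + 1 ≤ l ∧ l ≤ v + w) ∨ v + w + 1 ≤ l) with b | b
        · rw [h2 l b.1 b.2]; simp
        · rw [h1 l b hl]; simpa using hSw
      · rw [h1 j a (by omega), h1 l (by omega) hl]; simp
    · rw [whole_nat φ hj (by omega), whole_nat φ (by omega) hl, Complex.sub_im]
      change Real.sin φ * _ - Real.sin φ * _ < 0
      nlinarith
  · left
    have hl' : (u : ℝ) + v + w + 1 ≤ l := by exact_mod_cast (by omega : u + v + w + 1 ≤ l)
    rw [Complex.sub_re, Complex.sub_re, h0 l (by omega),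
      ptw_nat_of_not_mem (j := l) _ (by omega), Complex.natCast_re]
    constructor
    · rcases (by omega : j ≤ w ∨ (w + 1 ≤ j ∧ j ≤ v + w) ∨ (v + w + 1 ≤ j ∧ j ≤ u + v + w) ∨
        u + v + w + 1 ≤ j) with a | a | a | a
      · rw [h3 j hj a]
        change _ - _ * _ - _ < (0 : ℝ)
        nlinarith
      · rw [h2 j a.1 a.2]
        change _ - _ - _ < (0 : ℝ)
        linarith
      · rw [h1 j a.1 a.2]
        change _ + _ * _ - _ < (0 : ℝ)
        nlinarith
      · rw [h0 j a, Complex.natCast_re]; linarith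
    · by_cases h4 : j ≤ u + v + w
      · rw [whole_nat φ hj h4]
        have := (convex_bounds hD1 hD2 hj' (by exact_mod_cast h4 : (j : ℝ) ≤ ((u + v + w : ℕ) : ℝ))).2
        push_cast at this ⊢
        change _ + _ * _ - _ < 0
        rw [add_comm (1 : ℝ)] at this
        linarith
      · rw [ptw_nat_of_not_mem (j := j) _ (by omega), Complex.natCast_re]; linarith

theorem stages_pi_left {j : ℕ} (h1 : 1 ≤ j) (h2 : j ≤ w) :
    secondStage u v w Real.pi (firstStage v w Real.pi j) = ((u + v + w + 1 - j : ℕ) : ℂ) := by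
  rw [firstStage_pi_left h1 h2, secondStage_pi_middle (by omega) (by omega)]
  congr 1; omega

theorem stages_pi_right {j : ℕ} (h1 : w + 1 ≤ j) (h2 : j ≤ u + v + w) :
    secondStage u v w Real.pi (firstStage v w Real.pi j) = ((j - w : ℕ) : ℂ) := by
  by_cases h : j ≤ v + w
  · rw [firstStage_pi_middle h1 h, secondStage_left _ (by omega)]
  · rw [firstStage_right _ (by omega), secondStage_pi_right (by omega) h2]

theorem stages_pi_outside {j : ℕ} (h : u + v + w + 1 ≤ j) :
    secondStage u v w Real.pi (firstStage v w Real.pi j) = j := by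
  rw [firstStage_right _ (by omega), secondStage_outside _ (by omega)]

/-- Now `cos φ < 0`, so the rigid rotation has reversed the horizontal order of the three blocks.
The original first block is already at the far right in reversed order, and pairs involving it are
separated horizontally; the other pairs turn together and are separated by height. -/
theorem separated_thirdStage {θ φ : ℝ} (hθ : 0 ≤ Real.sin θ) (hφ : 0 < Real.sin φ)
    (hφ' : Real.cos φ < 0) {j l : ℕ} (hj : 1 ≤ j) (hjl : j < l) :
    Separated
      (thirdStage u v θ (secondStage u v w Real.pi (firstStage v w Real.pi j)) -
        thirdStage u v θ (secondStage u v w Real.pi (firstStage v w Real.pi l)))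
      (ptw φ 0 (u + v + w) j - ptw φ 0 (u + v + w) l) := by
  have hC1 := Real.neg_one_le_cos θ
  have hC2 := Real.cos_le_one θ
  have hD1 := Real.neg_one_le_cos φ
  have hD2 := Real.cos_le_one φ
  have hj' : (1 : ℝ) ≤ j := by exact_mod_cast hj
  have hjl' : (j : ℝ) + 1 ≤ l := by exact_mod_cast hjl
  have hv : (0 : ℝ) ≤ v := Nat.cast_nonneg v
  have hw : (0 : ℝ) ≤ w := Nat.cast_nonneg w
  have hu : (0 : ℝ) ≤ u := Nat.cast_nonneg u
  have h3 : ∀ i : ℕ, 1 ≤ i → i ≤ w →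
      thirdStage u v θ (secondStage u v w Real.pi (firstStage v w Real.pi i)) =
      ((u + v + w + 1 - i : ℕ) : ℂ) := fun i h1 h2 => by
    rw [stages_pi_left h1 h2, thirdStage, ptw_nat_of_not_mem _ (by omega)]
  have h1 : ∀ i : ℕ, w + 1 ≤ i → i ≤ u + v + w →
      thirdStage u v θ (secondStage u v w Real.pi (firstStage v w Real.pi i)) =
      ⟨((u + v : ℕ) + 1) / 2 + Real.cos θ * ((i - w : ℝ) - ((u + v : ℕ) + 1) / 2),
        Real.sin θ * ((i - w : ℝ) - ((u + v : ℕ) + 1) / 2)⟩ := fun i h1 h2 => by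
    rw [stages_pi_right h1 h2, thirdStage, whole_nat _ (by omega) (by omega),
      Nat.cast_sub (by omega)]
  have h0 : ∀ i : ℕ, u + v + w + 1 ≤ i →
      thirdStage u v θ (secondStage u v w Real.pi (firstStage v w Real.pi i)) = i := fun i h1 => by
    rw [stages_pi_outside h1, thirdStage, ptw_nat_of_not_mem _ (by omega)]
  have hre : ∀ i : ℕ, w + 1 ≤ i → i ≤ u + v + w →
      (thirdStage u v θ (secondStage u v w Real.pi (firstStage v w Real.pi i))).re ≤ u + v := by
    intro i hi1 hi2
    have hi1' : (w : ℝ) + 1 ≤ i := by exact_mod_cast hi1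
    have hi2' : (i : ℝ) ≤ u + v + w := by exact_mod_cast hi2
    rw [h1 i hi1 hi2]
    have := (convex_bounds (a := 1) (b := u + v) (x := i - w) hC1 hC2 (by linarith)
      (by linarith)).2
    rw [add_comm (1 : ℝ)] at this
    push_cast; exact this
  by_cases hl : l ≤ u + v + w
  · have him : (ptw φ 0 (u + v + w) j - ptw φ 0 (u + v + w) l).im < 0 := by
      rw [whole_nat φ hj (by omega), whole_nat φ (by omega) hl, Complex.sub_im]
      change Real.sin φ * _ - Real.sin φ * _ < 0
      nlinarith
    have hreb : 0 < (ptw φ 0 (u + v + w) j - ptw φ 0 (u + v + w) l).re := by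
      rw [whole_nat φ hj (by omega), whole_nat φ (by omega) hl, Complex.sub_re]
      change 0 < _ + Real.cos φ * _ - (_ + Real.cos φ * _)
      nlinarith
    by_cases a : j ≤ w
    · refine Or.inr (Or.inl ⟨?_, hreb⟩)
      rw [Complex.sub_re, h3 j hj a, Complex.natCast_re, Nat.cast_sub (by omega)]
      have a' : (j : ℝ) ≤ w := by exact_mod_cast a
      by_cases b : l ≤ w
      · rw [h3 l (by omega) b, Complex.natCast_re, Nat.cast_sub (by omega)]
        push_cast; linarith
      · have := hre l (by omega) hl
        push_cast; linarith
    · refine Or.inr (Or.inr ⟨?_, him⟩)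
      rw [Complex.sub_im, h1 j (by omega) (by omega), h1 l (by omega) hl]
      change Real.sin θ * _ - Real.sin θ * _ ≤ 0
      nlinarith
  · left
    have hl' : (u : ℝ) + v + w + 1 ≤ l := by exact_mod_cast (by omega : u + v + w + 1 ≤ l)
    rw [Complex.sub_re, Complex.sub_re, h0 l (by omega),
      ptw_nat_of_not_mem (j := l) _ (by omega), Complex.natCast_re]
    constructor
    · rcases (by omega : j ≤ w ∨ (w + 1 ≤ j ∧ j ≤ u + v + w) ∨ u + v + w + 1 ≤ j) with a | a | a
      · rw [h3 j hj a, Complex.natCast_re, Nat.cast_sub (by omega)]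
        push_cast; linarith
      · have := hre j a.1 a.2
        linarith
      · rw [h0 j a, Complex.natCast_re]; linarith
    · by_cases h4 : j ≤ u + v + w
      · rw [whole_nat φ hj h4]
        have := (convex_bounds hD1 hD2 hj' (by exact_mod_cast h4 : (j : ℝ) ≤ ((u + v + w : ℕ) : ℝ))).2
        push_cast at this ⊢
        change _ + _ * _ - _ < 0
        rw [add_comm (1 : ℝ)] at this
        linarith
      · rw [ptw_nat_of_not_mem (j := j) _ (by omega), Complex.natCast_re]; linarith

end ThreeBlocks

/-! ### The staged motion over the whole time interval -/

/-- A family of homeomorphisms that is continuous in the parameter, together with its inverse. -/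
def IsContFamily (a : unitInterval → (ℂ ≃ₜ ℂ)) : Prop :=
  (Continuous fun p : unitInterval × ℂ => a p.1 p.2) ∧
    Continuous fun p : unitInterval × ℂ => (a p.1).symm p.2

theorem IsContFamily.mul {a b : unitInterval → (ℂ ≃ₜ ℂ)} (ha : IsContFamily a)
    (hb : IsContFamily b) : IsContFamily fun t => a t * b t :=
  ⟨ha.1.comp (continuous_fst.prodMk hb.1), hb.2.comp (continuous_fst.prodMk ha.2)⟩

theorem isContFamily_ptw {f : unitInterval → ℝ} (hf : Continuous f) (p s : ℕ) :
    IsContFamily fun t => ptw (f t) p s := by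
  have h : ∀ {g : unitInterval → ℝ}, Continuous g →
      Continuous fun q : unitInterval × ℂ => ptw (g q.1) p s q.2 := fun hg =>
    (continuous_ptw p s).comp ((hg.comp continuous_fst).prodMk continuous_snd)
  refine ⟨h hf, (h hf.neg).congr fun q => ?_⟩
  rw [ptw_symm]; rfl

theorem homeo_mul_apply (f g : ℂ ≃ₜ ℂ) (z : ℂ) : (f * g) z = f (g z) := rfl

/-- The angle of the stage that takes place during the time interval `[a, a + 1 / 3]`. -/
noncomputable def stageAngle (a t : ℝ) : ℝ := Real.pi * max 0 (min 1 (3 * (t - a)))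

theorem continuous_stageAngle (a : ℝ) : Continuous (stageAngle a) := by
  unfold stageAngle; fun_prop

theorem stageAngle_of_le {a t : ℝ} (h : t ≤ a) : stageAngle a t = 0 := by
  rw [stageAngle, min_eq_right (by linarith), max_eq_left (by linarith), mul_zero]

theorem stageAngle_of_ge {a t : ℝ} (h : a + 1 / 3 ≤ t) : stageAngle a t = Real.pi := by
  rw [stageAngle, min_eq_left (by linarith), max_eq_right (by linarith), mul_one]

theorem sin_stageAngle_nonneg (a t : ℝ) : 0 ≤ Real.sin (stageAngle a t) := by
  apply Real.sin_nonneg_of_nonneg_of_le_pi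
  · exact mul_nonneg Real.pi_pos.le (le_max_left _ _)
  · have : max 0 (min 1 (3 * (t - a))) ≤ 1 := max_le zero_le_one (min_le_left _ _)
    rw [stageAngle]; nlinarith [Real.pi_pos]

theorem firstStage_zero (v w : ℕ) : firstStage v w 0 = 1 := by
  simp [firstStage, ptw_zero]

theorem secondStage_zero (u v w : ℕ) : secondStage u v w 0 = 1 := by
  simp [secondStage, ptw_zero]

theorem thirdStage_zero (u v : ℕ) : thirdStage u v 0 = 1 := ptw_zero _ _

/-- Each stage takes a third of the time while the rigid rotation runs uniformly. Its angle is at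
most `π / 3` in the first stage and exceeds `2π / 3` in the third, which supplies the signs of the
cosine required there. -/
theorem mapIso_stages {u v w k : ℕ} (h : u + v + w ≤ k) :
    MapIso k (thirdStage u v Real.pi * secondStage u v w Real.pi * firstStage v w Real.pi)
      (tw 0 (u + v + w)) := by
  let a : unitInterval → (ℂ ≃ₜ ℂ) := fun t => thirdStage u v (stageAngle (2 / 3) t) *
    secondStage u v w (stageAngle (1 / 3) t) * firstStage v w (stageAngle 0 t)
  let b : unitInterval → (ℂ ≃ₜ ℂ) := fun t => ptw (Real.pi * t) 0 (u + v + w)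
  have hf : ∀ c, Continuous fun t : unitInterval => stageAngle c t := fun c =>
    (continuous_stageAngle c).comp continuous_subtype_val
  have ha : IsContFamily a :=
    ((isContFamily_ptw (hf _) _ _).mul ((isContFamily_ptw (hf _) _ _).mul
      ((isContFamily_ptw (hf _).neg _ _).mul (isContFamily_ptw (hf _).neg _ _)))).mul
      ((isContFamily_ptw (hf _) _ _).mul (isContFamily_ptw (hf _).neg _ _))
  have hb : IsContFamily b := isContFamily_ptw (by fun_prop) _ _
  have ha1 : a 1 = thirdStage u v Real.pi * secondStage u v w Real.pi * firstStage v w Real.pi := by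
    simp only [a]
    rw [stageAngle_of_ge (by norm_num), stageAngle_of_ge (by norm_num),
      stageAngle_of_ge (by norm_num)]
  have hb1 : b 1 = tw 0 (u + v + w) := by simp [b, tw]
  have ha0 : a 0 = 1 := by
    simp only [a]
    rw [stageAngle_of_le (by norm_num), stageAngle_of_le (by norm_num),
      stageAngle_of_le (by norm_num), firstStage_zero, secondStage_zero, thirdStage_zero]
    simp
  have hb0 : b 0 = 1 := by simp [b, ptw_zero]
  have hab : ∀ j : ℕ, 1 ≤ j → a 1 j = b 1 j := by
    intro j hj
    rw [ha1, hb1]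
    change thirdStage u v Real.pi (secondStage u v w Real.pi (firstStage v w Real.pi j)) = _
    by_cases h1 : j ≤ w
    · rw [stages_pi_left hj h1, thirdStage, ptw_nat_of_not_mem _ (by omega),
        tw_nat_of_mem (by omega) (by omega)]
      congr 1; omega
    by_cases h2 : j ≤ u + v + w
    · rw [stages_pi_right (by omega) h2, thirdStage, ptw_pi_nat (by omega) (by omega),
        tw_nat_of_mem (by omega) (by omega)]
      congr 1; omega
    · rw [stages_pi_outside (by omega), thirdStage, ptw_nat_of_not_mem _ (by omega), tw,
        ptw_nat_of_not_mem _ (by omega)]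
  have hbt : ∀ t, b t = ptw (Real.pi * t) 0 (u + v + w) := fun t => rfl
  rw [← ha1, ← hb1]
  refine MapIso.of_motions a b ha.1 ha.2 hb.1 hb.2 (fun z => by rw [ha0]; rfl)
    (fun z => by rw [hb0]; rfl) ?_ ?_ ?_
  · apply mem_holeStabilizer_of_mapsTo
    rintro _ ⟨j, h1, h2, rfl⟩
    rw [hab j h1, hb1]
    exact tw_mapsTo_holes (by omega) ⟨j, h1, h2, rfl⟩
  · rintro _ ⟨j, h1, -, rfl⟩
    exact hab j h1
  · intro s t j l hj hjl _
    refine Separated.combination_ne_zero ?_ (sub_ne_zero.2 fun heq => ?_) s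
    swap
    · have := (a t).injective heq
      exact absurd (by exact_mod_cast this) hjl.ne
    have ht0 := t.2.1
    have ht1 := t.2.2
    have hpi := Real.pi_pos
    have hjl' : (j : ℝ) < l := by exact_mod_cast hjl
    -- The two ends are treated apart, since the sine of the angle of the rigid rotation vanishes
    -- there.
    rcases ht0.eq_or_lt with h0 | h0
    · have : t = 0 := Subtype.ext h0.symm
      rw [this, ha0, hb0]
      left
      change ((j : ℂ) - l).re < 0 ∧ ((j : ℂ) - l).re < 0
      simpa using hjl
    rcases ht1.eq_or_lt with h1 | h1
    · have : t = 1 := Subtype.ext h1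
      rw [this, hab j hj, hab l (by omega), hb1]
      by_cases hl : l ≤ u + v + w
      · right; left
        rw [tw_nat_of_mem (by omega) (by omega), tw_nat_of_mem (by omega) (by omega)]
        have : 0 < (((2 * 0 + (u + v + w) + 1 - j : ℕ) : ℂ) -
            ((2 * 0 + (u + v + w) + 1 - l : ℕ) : ℂ)).re := by
          rw [Complex.sub_re, Complex.natCast_re, Complex.natCast_re, sub_pos]
          exact_mod_cast (by omega)
        exact ⟨this, this⟩
      · left
        rw [tw, ptw_nat_of_not_mem (j := l) _ (by omega)]
        have : (ptw Real.pi 0 (u + v + w) (j : ℂ) - (l : ℂ)).re < 0 := by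
          by_cases hj' : j ≤ u + v + w
          · rw [ptw_pi_nat (by omega) (by omega), Complex.sub_re, Complex.natCast_re,
              Complex.natCast_re, sub_neg]
            exact_mod_cast (by omega)
          · rw [ptw_nat_of_not_mem _ (by omega), Complex.sub_re, Complex.natCast_re,
              Complex.natCast_re, sub_neg]
            exact hjl'
        exact ⟨this, this⟩
    have hsin : 0 < Real.sin (Real.pi * t) :=
      Real.sin_pos_of_pos_of_lt_pi (by positivity) (by nlinarith)
    rcases le_or_gt (t : ℝ) (1 / 3) with h2 | h2
    · have e : a t = firstStage v w (stageAngle 0 t) := by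
        simp only [a]
        rw [stageAngle_of_le (a := 2 / 3) (by linarith), stageAngle_of_le (a := 1 / 3) h2,
          secondStage_zero, thirdStage_zero, one_mul, one_mul]
      rw [e, hbt]
      refine separated_firstStage (sin_stageAngle_nonneg _ _) hsin ?_ hj hjl
      apply Real.cos_pos_of_mem_Ioo
      constructor <;> nlinarith
    rcases le_or_gt (t : ℝ) (2 / 3) with h3 | h3
    · have e : a t = secondStage u v w (stageAngle (1 / 3) t) * firstStage v w Real.pi := by
        simp only [a]
        rw [stageAngle_of_le (a := 2 / 3) h3, stageAngle_of_ge (a := 0) (by linarith),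
          thirdStage_zero, one_mul]
      rw [e, hbt, homeo_mul_apply, homeo_mul_apply]
      exact separated_secondStage (sin_stageAngle_nonneg _ _) hsin hj hjl
    · have e : a t = thirdStage u v (stageAngle (2 / 3) t) * secondStage u v w Real.pi *
          firstStage v w Real.pi := by
        simp only [a]
        rw [stageAngle_of_ge (a := 1 / 3) (by linarith), stageAngle_of_ge (a := 0) (by linarith)]
      rw [e, hbt]
      simp only [homeo_mul_apply]
      refine separated_thirdStage (sin_stageAngle_nonneg _ _) hsin ?_ hj hjl
      apply Real.cos_neg_of_pi_div_two_lt_of_lt <;> nlinarith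

/-- The half-twists along the three pairs of three adjacent blocks of sizes `u`, `v`, `w` compose, up
to isotopy, to the half-twist along all of them and the half-twists along each. -/
theorem mapIso_three_blocks {u v w k : ℕ} (h : u + v + w ≤ k) :
    MapIso k (tw 0 (u + v) * tw v (u + w) * tw 0 (v + w))
      (tw 0 u * tw u v * tw (u + v) w * tw 0 (u + v + w)) := by
  have c1 : (tw (v + w) u)⁻¹ * tw 0 (v + w) = tw 0 (v + w) * (tw (v + w) u)⁻¹ :=
    ((tw_commute_disjoint (p := 0) (s := v + w) (p' := v + w) (s' := u) (by omega)).symm.inv_left).eq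
  have c2 : tw v w * tw 0 (v + w) = tw 0 (v + w) * tw 0 w := by
    have := tw_mul_tw_nested (p := 0) (x := 0) (y := w) (z := v) (s := v + w) (by omega)
    simpa using this.symm
  have c2' : (tw v w)⁻¹ * tw 0 (v + w) = tw 0 (v + w) * (tw 0 w)⁻¹ := by
    rw [inv_mul_eq_iff_eq_mul, ← mul_assoc, c2, mul_assoc, mul_inv_cancel, mul_one]
  have n1 : tw 0 (u + v + w) * tw w v = tw u v * tw 0 (u + v + w) := by
    have := tw_mul_tw_nested (p := 0) (x := w) (y := v) (z := u) (s := u + v + w) (by omega)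
    simpa using this
  have n2 : tw 0 (u + v + w) * tw 0 w = tw (u + v) w * tw 0 (u + v + w) := by
    have := tw_mul_tw_nested (p := 0) (x := 0) (y := w) (z := u + v) (s := u + v + w) (by omega)
    simpa using this
  have n3 : tw 0 (u + v + w) * tw (v + w) u = tw 0 u * tw 0 (u + v + w) := by
    have := tw_mul_tw_nested (p := 0) (x := v + w) (y := u) (z := 0) (s := u + v + w) (by omega)
    simpa using this
  have d1 : tw w v * tw (v + w) u = tw (v + w) u * tw w v :=
    (tw_commute_disjoint (by omega)).eq
  have d2 : tw 0 w * tw (v + w) u = tw (v + w) u * tw 0 w :=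
    (tw_commute_disjoint (by omega)).eq
  have d3 : tw 0 w * tw w v = tw w v * tw 0 w := (tw_commute_disjoint (by omega)).eq
  have d4 : tw 0 u * tw u v = tw u v * tw 0 u := (tw_commute_disjoint (by omega)).eq
  have d5 : tw 0 u * tw (u + v) w = tw (u + v) w * tw 0 u := (tw_commute_disjoint (by omega)).eq
  have d6 : tw u v * tw (u + v) w = tw (u + v) w * tw u v := (tw_commute_disjoint (by omega)).eq
  -- Keeping blocks parallel costs an inverse half-twist along each of them. Multiplying by the
  -- half-twists along the three initial blocks cancels these on the left-hand side; on the
  -- right-hand side they pass through the full half-twist and become those along the final blocks.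
  have key := (mapIso_stages h).mul_right (h := tw w v * tw 0 w * tw (v + w) u)
    (mul_mem (mul_mem (tw_mem_holeStabilizer (by omega)) (tw_mem_holeStabilizer (by omega)))
      (tw_mem_holeStabilizer (by omega)))
  have e1 : thirdStage u v Real.pi * secondStage u v w Real.pi * firstStage v w Real.pi *
      (tw w v * tw 0 w * tw (v + w) u) = tw 0 (u + v) * tw v (u + w) * tw 0 (v + w) := by
    simp only [thirdStage, secondStage, firstStage, ← ptw_inv]
    change tw 0 (u + v) * (tw v (u + w) * ((tw v w)⁻¹ * (tw (v + w) u)⁻¹)) *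
      (tw 0 (v + w) * (tw w v)⁻¹) * (tw w v * tw 0 w * tw (v + w) u) = _
    calc _ = tw 0 (u + v) * tw v (u + w) * (tw v w)⁻¹ * ((tw (v + w) u)⁻¹ * tw 0 (v + w)) *
          (tw 0 w * tw (v + w) u) := by group
      _ = tw 0 (u + v) * tw v (u + w) * ((tw v w)⁻¹ * tw 0 (v + w)) * (tw (v + w) u)⁻¹ *
          (tw (v + w) u * tw 0 w) := by rw [c1, d2]; group
      _ = _ := by rw [c2']; group
  have e2 : tw 0 (u + v + w) * (tw w v * tw 0 w * tw (v + w) u) =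
      tw 0 u * tw u v * tw (u + v) w * tw 0 (u + v + w) := by
    calc _ = (tw 0 (u + v + w) * tw w v) * tw 0 w * tw (v + w) u := by group
      _ = tw u v * (tw 0 (u + v + w) * tw 0 w) * tw (v + w) u := by rw [n1]; group
      _ = tw u v * tw (u + v) w * (tw 0 (u + v + w) * tw (v + w) u) := by rw [n2]; group
      _ = tw u v * (tw (u + v) w * tw 0 u) * tw 0 (u + v + w) := by rw [n3]; group
      _ = tw u v * tw 0 u * tw (u + v) w * tw 0 (u + v + w) := by rw [← d5]; group
      _ = _ := by rw [← d4]
  rwa [e1, e2] at key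

/-! ## Curves bounding the region under a graph -/

/-- The factor by which a point of the unit circle is stretched to lie on the boundary of the
square. -/
noncomputable def squareNorm (θ : Circle) : ℝ := max |(θ : ℂ).re| |(θ : ℂ).im|

theorem squareNorm_pos (θ : Circle) : 0 < squareNorm θ := by
  by_contra h
  push Not at h
  have h1 : |(θ : ℂ).re| ≤ 0 := (le_max_left _ _).trans h
  have h2 : |(θ : ℂ).im| ≤ 0 := (le_max_right _ _).trans h
  have : (θ : ℂ) = 0 := Complex.ext (abs_nonpos_iff.1 h1) (abs_nonpos_iff.1 h2)
  exact Circle.coe_ne_zero θ this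

theorem continuous_squareNorm : Continuous squareNorm := by
  unfold squareNorm
  have h1 : Continuous fun θ : Circle => (θ : ℂ).re := Complex.continuous_re.comp continuous_subtype_val
  have h2 : Continuous fun θ : Circle => (θ : ℂ).im := Complex.continuous_im.comp continuous_subtype_val
  exact h1.abs.max h2.abs

theorem circle_eq_of_smul {θ θ' : Circle} {a b : ℝ} (ha : 0 < a) (hb : 0 < b)
    (h : (a : ℂ) * θ = b * θ') : θ = θ' := by
  have h1 := congrArg norm h
  rw [norm_mul, norm_mul, Circle.norm_coe, Circle.norm_coe, Complex.norm_real, Complex.norm_real,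
    Real.norm_of_nonneg ha.le, Real.norm_of_nonneg hb.le, mul_one, mul_one] at h1
  subst h1
  exact Subtype.ext (mul_left_cancel₀ (by exact_mod_cast ha.ne') h)

/-- The abscissa of the point of the boundary of the square in the direction `θ`. -/
noncomputable def squareX (θ : Circle) : ℝ := (θ : ℂ).re / squareNorm θ

/-- The ordinate of the point of the boundary of the square in the direction `θ`. -/
noncomputable def squareY (θ : Circle) : ℝ := (θ : ℂ).im / squareNorm θ

theorem continuous_squareX : Continuous squareX :=
  (Complex.continuous_re.comp continuous_subtype_val).div continuous_squareNorm
    fun θ => (squareNorm_pos θ).ne'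

theorem continuous_squareY : Continuous squareY :=
  (Complex.continuous_im.comp continuous_subtype_val).div continuous_squareNorm
    fun θ => (squareNorm_pos θ).ne'

theorem square_max (θ : Circle) : max |squareX θ| |squareY θ| = 1 := by
  have h := squareNorm_pos θ
  rw [squareX, squareY, abs_div, abs_div, abs_of_pos h, max_div_div_right h.le]
  exact div_self h.ne'

theorem abs_squareX_le (θ : Circle) : |squareX θ| ≤ 1 := (le_max_left _ _).trans (square_max θ).le

theorem abs_squareY_le (θ : Circle) : |squareY θ| ≤ 1 := (le_max_right _ _).trans (square_max θ).le

theorem square_injective {θ θ' : Circle} (hX : squareX θ = squareX θ') (hY : squareY θ = squareY θ') :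
    θ = θ' := by
  have h := squareNorm_pos θ
  have h' := squareNorm_pos θ'
  refine circle_eq_of_smul (inv_pos.2 h) (inv_pos.2 h') (Complex.ext ?_ ?_)
  · rw [Complex.re_ofReal_mul, Complex.re_ofReal_mul]
    unfold squareX at hX; rw [inv_mul_eq_div, inv_mul_eq_div, hX]
  · rw [Complex.im_ofReal_mul, Complex.im_ofReal_mul]
    unfold squareY at hY; rw [inv_mul_eq_div, inv_mul_eq_div, hY]

theorem exists_square_eq {X Y : ℝ} (h : max |X| |Y| = 1) : ∃ θ, squareX θ = X ∧ squareY θ = Y := by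
  have hne : (⟨X, Y⟩ : ℂ) ≠ 0 := by
    intro h0
    have hX : X = 0 := congrArg Complex.re h0
    have hY : Y = 0 := congrArg Complex.im h0
    simp [hX, hY] at h
  have hn : 0 < ‖(⟨X, Y⟩ : ℂ)‖ := norm_pos_iff.2 hne
  refine ⟨⟨(⟨X / ‖(⟨X, Y⟩ : ℂ)‖, Y / ‖(⟨X, Y⟩ : ℂ)‖⟩ : ℂ), ?_⟩, ?_⟩
  · change _ ∈ Metric.sphere (0 : ℂ) 1
    rw [mem_sphere_zero_iff_norm]
    have : (⟨X / ‖(⟨X, Y⟩ : ℂ)‖, Y / ‖(⟨X, Y⟩ : ℂ)‖⟩ : ℂ) = ((‖(⟨X, Y⟩ : ℂ)‖⁻¹ : ℝ) : ℂ) * ⟨X, Y⟩ := by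
      apply Complex.ext
      · rw [Complex.re_ofReal_mul, inv_mul_eq_div]
      · rw [Complex.im_ofReal_mul, inv_mul_eq_div]
    rw [this, norm_mul, Complex.norm_real, Real.norm_of_nonneg (inv_nonneg.2 hn.le),
      inv_mul_cancel₀ hn.ne']
  · simp only [squareX, squareY, squareNorm]
    rw [abs_div, abs_div, abs_of_pos hn, max_div_div_right hn.le, h]
    constructor <;> field_simp

/-- The parametrization by the circle of the boundary of the region between the horizontal line at
height `-L` and the graph of `u`, over the interval `[x₀, x₁]`. -/
noncomputable def graphPoint (x₀ x₁ L : ℝ) (u : ℝ → ℝ) (θ : Circle) : ℂ :=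
  ⟨(x₀ + x₁) / 2 + (x₁ - x₀) / 2 * squareX θ,
    -L + (squareY θ + 1) / 2 * (u ((x₀ + x₁) / 2 + (x₁ - x₀) / 2 * squareX θ) + L)⟩

/-- The boundary of the region between the horizontal line at height `-L` and the graph of `u`, over
the interval `[x₀, x₁]`. -/
def graphCurve (x₀ x₁ L : ℝ) (u : ℝ → ℝ) : Set ℂ :=
  {z | x₀ ≤ z.re ∧ z.re ≤ x₁ ∧ -L ≤ z.im ∧ z.im ≤ u z.re ∧
    (z.re = x₀ ∨ z.re = x₁ ∨ z.im = -L ∨ z.im = u z.re)}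

section Graph

variable {x₀ x₁ L : ℝ} {u : ℝ → ℝ}

theorem graphPoint_re_mem (h : x₀ < x₁) (θ : Circle) :
    x₀ ≤ (graphPoint x₀ x₁ L u θ).re ∧ (graphPoint x₀ x₁ L u θ).re ≤ x₁ := by
  have := abs_le.1 (abs_squareX_le θ)
  change x₀ ≤ (x₀ + x₁) / 2 + (x₁ - x₀) / 2 * squareX θ ∧
    (x₀ + x₁) / 2 + (x₁ - x₀) / 2 * squareX θ ≤ x₁
  constructor <;> nlinarith

/-- The abscissa determines `squareX`, and over a fixed abscissa the ordinate is an affine function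
of `squareY` with positive slope. -/
theorem graphPoint_injective (h : x₀ < x₁) (hu : ∀ x, x₀ ≤ x → x ≤ x₁ → -L < u x) :
    Function.Injective (graphPoint x₀ x₁ L u) := by
  intro θ θ' heq
  have hre := congrArg Complex.re heq
  have him := congrArg Complex.im heq
  have hX : squareX θ = squareX θ' := by
    simp only [graphPoint] at hre
    have : (x₁ - x₀) / 2 ≠ 0 := by linarith
    exact mul_left_cancel₀ this (by linarith)
  refine square_injective hX ?_
  have hm := graphPoint_re_mem (L := L) (u := u) h θ'
  simp only [graphPoint, hX] at him hm
  have := hu _ hm.1 hm.2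
  have h0 : (u ((x₀ + x₁) / 2 + (x₁ - x₀) / 2 * squareX θ') + L) ≠ 0 := by linarith
  have := mul_right_cancel₀ h0 (add_left_cancel him)
  linarith

theorem range_graphPoint (h : x₀ < x₁) (hu : ∀ x, x₀ ≤ x → x ≤ x₁ → -L < u x) :
    Set.range (graphPoint x₀ x₁ L u) = graphCurve x₀ x₁ L u := by
  ext z
  constructor
  · rintro ⟨θ, rfl⟩
    have hm := graphPoint_re_mem (L := L) (u := u) h θ
    have hpos := hu _ hm.1 hm.2
    have hX := abs_le.1 (abs_squareX_le θ)
    have hY := abs_le.1 (abs_squareY_le θ)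
    refine ⟨hm.1, hm.2, ?_⟩
    simp only [graphPoint] at hpos ⊢
    set a := u ((x₀ + x₁) / 2 + (x₁ - x₀) / 2 * squareX θ)
    refine ⟨by nlinarith, by nlinarith, ?_⟩
    rcases max_choice |squareX θ| |squareY θ| with hc | hc
    · rw [square_max] at hc
      rcases eq_or_eq_neg_of_abs_eq hc.symm with hc | hc
      · right; left; rw [hc]; ring
      · left; rw [hc]; ring
    · rw [square_max] at hc
      rcases eq_or_eq_neg_of_abs_eq hc.symm with hc | hc
      · right; right; right; rw [hc]; ring
      · right; right; left; rw [hc]; ring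
  · rintro ⟨h1, h2, h3, h4, h5⟩
    have hpos := hu _ h1 h2
    have hd : 0 < (x₁ - x₀) / 2 := by linarith
    have hd' : 0 < (u z.re + L) / 2 := by linarith
    have hX : |(z.re - (x₀ + x₁) / 2) / ((x₁ - x₀) / 2)| ≤ 1 := by
      rw [abs_div, abs_of_pos hd, div_le_one hd, abs_le]; constructor <;> linarith
    have hY : |(z.im + L) / ((u z.re + L) / 2) - 1| ≤ 1 := by
      rw [abs_le]
      have : (z.im + L) / ((u z.re + L) / 2) ≤ 2 := by rw [div_le_iff₀ hd']; linarith
      have : 0 ≤ (z.im + L) / ((u z.re + L) / 2) := div_nonneg (by linarith) hd'.le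
      constructor <;> linarith
    obtain ⟨θ, e1, e2⟩ := exists_square_eq (X := (z.re - (x₀ + x₁) / 2) / ((x₁ - x₀) / 2))
      (Y := (z.im + L) / ((u z.re + L) / 2) - 1) (by
        apply le_antisymm (max_le hX hY)
        rcases h5 with h | h | h | h
        · refine le_trans ?_ (le_max_left _ _)
          rw [h, abs_div, abs_of_pos hd, le_div_iff₀ hd]
          rw [show x₀ - (x₀ + x₁) / 2 = -((x₁ - x₀) / 2) by ring, abs_neg, abs_of_pos hd, one_mul]
        · refine le_trans ?_ (le_max_left _ _)
          rw [h, abs_div, abs_of_pos hd, le_div_iff₀ hd]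
          rw [show x₁ - (x₀ + x₁) / 2 = (x₁ - x₀) / 2 by ring, abs_of_pos hd, one_mul]
        · refine le_trans ?_ (le_max_right _ _)
          rw [h]; simp
        · refine le_trans ?_ (le_max_right _ _)
          have : (z.im + L) / ((u z.re + L) / 2) = 2 := by
            rw [div_eq_iff hd'.ne', h]; ring
          rw [this]; norm_num)
    have e3 : (x₀ + x₁) / 2 + (x₁ - x₀) / 2 * squareX θ = z.re := by
      rw [e1, mul_div_cancel₀ _ hd.ne']; ring
    refine ⟨θ, Complex.ext e3 ?_⟩
    change -L + (squareY θ + 1) / 2 * (u ((x₀ + x₁) / 2 + (x₁ - x₀) / 2 * squareX θ) + L) = z.im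
    have hne : u z.re + L ≠ 0 := by linarith
    rw [e3, e2]
    field_simp
    ring

/-- A sufficient condition for a point not to lie on a graph curve. -/
def OffGraph (x₀ x₁ L : ℝ) (u : ℝ → ℝ) (z : ℂ) : Prop :=
  x₀ ≤ z.re → z.re ≤ x₁ → u z.re < z.im ∨ (x₀ < z.re ∧ z.re < x₁ ∧ -L < z.im ∧ z.im < u z.re)

theorem OffGraph.graphPoint_ne {z : ℂ} (hz : OffGraph x₀ x₁ L u z) (h : x₀ < x₁)
    (hu : ∀ x, x₀ ≤ x → x ≤ x₁ → -L < u x) (θ : Circle) : graphPoint x₀ x₁ L u θ ≠ z := by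
  rintro rfl
  have := (range_graphPoint h hu).le ⟨θ, rfl⟩
  obtain ⟨h1, h2, h3, h4, h5⟩ := this
  rcases hz h1 h2 with h | ⟨a, b, c, d⟩
  · linarith
  · rcases h5 with h | h | h | h <;> linarith

end Graph

theorem continuous_graphPoint {T : Type*} [TopologicalSpace T] {x₀ x₁ L : T → ℝ} {u : T → ℝ → ℝ}
    (h₀ : Continuous x₀) (h₁ : Continuous x₁) (hL : Continuous L)
    (hu : Continuous fun p : T × ℝ => u p.1 p.2) :
    Continuous fun p : T × Circle => graphPoint (x₀ p.1) (x₁ p.1) (L p.1) (u p.1) p.2 := by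
  have hX := continuous_squareX
  have hY := continuous_squareY
  have h1 : Continuous fun p : T × Circle =>
      (x₀ p.1 + x₁ p.1) / 2 + (x₁ p.1 - x₀ p.1) / 2 * squareX p.2 := by fun_prop
  have h2 : Continuous fun p : T × Circle =>
      u p.1 ((x₀ p.1 + x₁ p.1) / 2 + (x₁ p.1 - x₀ p.1) / 2 * squareX p.2) :=
    hu.comp (continuous_fst.prodMk h1)
  have h3 : Continuous fun p : T × Circle => -L p.1 + (squareY p.2 + 1) / 2 *
      (u p.1 ((x₀ p.1 + x₁ p.1) / 2 + (x₁ p.1 - x₀ p.1) / 2 * squareX p.2) + L p.1) := by fun_prop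
  have : (fun p : T × Circle => graphPoint (x₀ p.1) (x₁ p.1) (L p.1) (u p.1) p.2) = fun p =>
      ((((x₀ p.1 + x₁ p.1) / 2 + (x₁ p.1 - x₀ p.1) / 2 * squareX p.2 : ℝ) : ℂ) +
        ((-L p.1 + (squareY p.2 + 1) / 2 *
      (u p.1 ((x₀ p.1 + x₁ p.1) / 2 + (x₁ p.1 - x₀ p.1) / 2 * squareX p.2) + L p.1) : ℝ) : ℂ) *
        Complex.I) := by
    funext p; apply Complex.ext <;> simp [graphPoint]
  rw [this]
  fun_prop

open unitInterval in
/-- An isotopy through graph curves, carried along by an ambient isotopy. -/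
theorem isotopicIn_of_graph_family {k : ℕ} {x₀ x₁ L : I → ℝ} {u : I → ℝ → ℝ}
    (h₀ : Continuous x₀) (h₁ : Continuous x₁) (hL : Continuous L)
    (hu : Continuous fun p : I × ℝ => u p.1 p.2) (hlt : ∀ t, x₀ t < x₁ t)
    (hpos : ∀ t x, x₀ t ≤ x → x ≤ x₁ t → -L t < u t x) {a : I → (ℂ ≃ₜ ℂ)}
    (ha : IsContFamily a) (ha1 : a 1 ∈ holeStabilizer k)
    (hoff : ∀ t, ∀ z ∈ holes k, OffGraph (x₀ t) (x₁ t) (L t) (u t) (a t z)) :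
    IsotopicIn (holes k)ᶜ (a 1 '' ((a 0).symm '' graphCurve (x₀ 0) (x₁ 0) (L 0) (u 0)))
      (graphCurve (x₀ 1) (x₁ 1) (L 1) (u 1)) := by
  -- The graph curve at time `t` avoids the moved centres `a t z`. Pulling it back by `a t` and
  -- pushing it forward by `a 1` gives a curve that avoids the centres themselves.
  refine ⟨fun p => a 1 ((a p.1).symm (graphPoint (x₀ p.1) (x₁ p.1) (L p.1) (u p.1) p.2)), ?_, ?_, ?_,
    ?_, ?_⟩
  · exact (a 1).continuous.comp (ha.2.comp
      (continuous_fst.prodMk (continuous_graphPoint h₀ h₁ hL hu)))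
  · exact fun t => (a 1).injective.comp
      ((a t).symm.injective.comp (graphPoint_injective (hlt t) (hpos t)))
  · intro t θ
    apply mapsTo_compl_of_mem_holeStabilizer ha1
    intro hz
    refine (hoff t _ hz).graphPoint_ne (hlt t) (hpos t) θ ?_
    rw [Homeomorph.apply_symm_apply]
  · rw [← range_graphPoint (hlt 0) (hpos 0), ← Set.range_comp, ← Set.range_comp]; rfl
  · rw [← range_graphPoint (hlt 1) (hpos 1)]
    congr 1; funext θ
    exact (a 1).apply_symm_apply _

open unitInterval in
theorem isotopicIn_graphCurve {k : ℕ} {x₀ x₁ L : I → ℝ} {u : I → ℝ → ℝ}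
    (h₀ : Continuous x₀) (h₁ : Continuous x₁) (hL : Continuous L)
    (hu : Continuous fun p : I × ℝ => u p.1 p.2) (hlt : ∀ t, x₀ t < x₁ t)
    (hpos : ∀ t x, x₀ t ≤ x → x ≤ x₁ t → -L t < u t x)
    (hoff : ∀ t, ∀ z ∈ holes k, OffGraph (x₀ t) (x₁ t) (L t) (u t) z) :
    IsotopicIn (holes k)ᶜ (graphCurve (x₀ 0) (x₁ 0) (L 0) (u 0))
      (graphCurve (x₀ 1) (x₁ 1) (L 1) (u 1)) := by
  have h := isotopicIn_of_graph_family (k := k) h₀ h₁ hL hu hlt hpos (a := fun _ => 1)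
    ⟨continuous_snd, continuous_snd⟩ (one_mem _) hoff
  have e : ∀ C : Set ℂ, (1 : ℂ ≃ₜ ℂ) '' ((1 : ℂ ≃ₜ ℂ).symm '' C) = C := fun C => by
    change id '' (id '' C) = C
    simp
  rwa [e] at h

theorem combination_lt {t a b c d : ℝ} (h0 : 0 ≤ t) (h1 : t ≤ 1) (hac : a < c) (hbd : b < d) :
    (1 - t) * a + t * b < (1 - t) * c + t * d := by
  rcases h0.eq_or_lt with rfl | h0
  · linarith
  · nlinarith

/-- Isotopy of graph curves by linear interpolation. -/
theorem isotopicIn_graphCurve_linear {k : ℕ} {x₀ x₁ L y₀ y₁ M : ℝ} {u v : ℝ → ℝ}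
    (hu : Continuous u) (hv : Continuous v) (hx : x₀ < x₁) (hy : y₀ < y₁)
    (hpos : ∀ x, (x₀ ≤ x ∨ y₀ ≤ x) → (x ≤ x₁ ∨ x ≤ y₁) → -L < u x ∧ -M < v x)
    (hL : 0 < L) (hM : 0 < M)
    (hoff : ∀ j : ℕ, 1 ≤ j → j ≤ k →
      ((j : ℝ) < x₀ ∧ (j : ℝ) < y₀) ∨ (x₁ < (j : ℝ) ∧ y₁ < (j : ℝ)) ∨ (u j < 0 ∧ v j < 0) ∨
      ((x₀ < (j : ℝ) ∧ (j : ℝ) < x₁ ∧ 0 < u j) ∧ (y₀ < (j : ℝ) ∧ (j : ℝ) < y₁ ∧ 0 < v j))) :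
    IsotopicIn (holes k)ᶜ (graphCurve x₀ x₁ L u) (graphCurve y₀ y₁ M v) := by
  have h := isotopicIn_graphCurve (k := k) (x₀ := fun t => (1 - t) * x₀ + t * y₀)
    (x₁ := fun t => (1 - t) * x₁ + t * y₁) (L := fun t => (1 - t) * L + t * M)
    (u := fun t x => (1 - t) * u x + t * v x) (by fun_prop) (by fun_prop) (by fun_prop)
    (by fun_prop) ?_ ?_ ?_
  · simpa using h
  · exact fun t => combination_lt t.2.1 t.2.2 hx hy
  · intro t x h1 h2
    have h := fun {a b c d : ℝ} => @combination_lt t a b c d t.2.1 t.2.2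
    have e : (1 - (t : ℝ)) * x + t * x = x := by ring
    have := hpos x (by
      by_contra hc; push Not at hc
      have := h hc.1 hc.2; linarith) (by
      by_contra hc; push Not at hc
      have := h hc.1 hc.2; linarith)
    have := h this.1 this.2
    linarith
  · rintro t _ ⟨j, hj1, hj2, rfl⟩ h1 h2
    have h := fun {a b c d : ℝ} => @combination_lt t a b c d t.2.1 t.2.2
    have e : (1 - (t : ℝ)) * j + t * j = j := by ring
    simp only [Complex.natCast_re, Complex.natCast_im] at h1 h2 ⊢
    -- A centre is left of, right of, above or inside both end curves in the same way, and each of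
    -- these conditions survives linear interpolation.
    rcases hoff j hj1 hj2 with ⟨a, b⟩ | ⟨a, b⟩ | ⟨a, b⟩ | ⟨⟨a, b, c⟩, a', b', c'⟩
    · have := h a b; linarith
    · have := h a b; linarith
    · left; have := h a b; linarith
    · right
      have := h a a'; have := h b b'; have := h c c'; have := h hL hM
      refine ⟨?_, ?_, ?_, ?_⟩ <;> linarith

/-! ## The image of a convex curve under the half-twist along an overlapping block -/

/-- The circle is expanded radially to a concentric square. On the real axis the radius stays
between `n / 2 - 1 / 4` and `n / 2`, so the axis is crossed only in the gaps before hole `1` and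
after hole `n`. -/
theorem isotopicIn_conv_square (k : ℕ) {n : ℕ} (hn : 1 ≤ n) :
    IsotopicIn (holes k)ᶜ (conv 0 n)
      (graphCurve (1 / 2) (n + 1 / 2) (n / 2) fun _ => (n : ℝ) / 2) := by
  have hn' : (1 : ℝ) ≤ n := by exact_mod_cast hn
  have ho1 := quarter_le_outR hn
  have ho2 := outR_lt n
  let ρ : unitInterval → Circle → ℝ := fun t θ =>
    (1 - t) * outR n + t * ((n : ℝ) / 2 / squareNorm θ)
  have hρ : ∀ t θ, 0 < ρ t θ := fun t θ => by
    have := div_pos (by linarith : (0 : ℝ) < n / 2) (squareNorm_pos θ)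
    have h := combination_lt t.2.1 t.2.2 (by linarith : 0 < outR n) this
    simp only [mul_zero, add_zero] at h
    exact h
  have hρc : Continuous fun p : unitInterval × Circle => ρ p.1 p.2 := by
    have h1 := continuous_squareNorm.comp (continuous_snd (X := unitInterval) (Y := Circle))
    have h2 : Continuous fun p : unitInterval × Circle => (n : ℝ) / 2 / squareNorm p.2 :=
      continuous_const.div h1 fun p => (squareNorm_pos _).ne'
    simp only [ρ]; fun_prop
  have hcoe : Continuous fun p : unitInterval × Circle => (p.2 : ℂ) :=
    continuous_subtype_val.comp continuous_snd
  refine ⟨fun p => cen 0 n + ρ p.1 p.2 * p.2, by fun_prop, ?_, ?_, ?_, ?_⟩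
  · intro t θ θ' h
    exact circle_eq_of_smul (hρ t θ) (hρ t θ') (add_left_cancel h)
  · rintro t θ ⟨j, hj1, hj2, h⟩
    have him := congrArg Complex.im h
    have hre := congrArg Complex.re h
    simp only [Complex.add_im, Complex.ofReal_im, Complex.im_ofReal_mul, Complex.natCast_im,
      zero_add, Complex.add_re, Complex.ofReal_re, Complex.re_ofReal_mul, Complex.natCast_re,
      mul_eq_zero, (hρ t θ).ne', false_or] at him hre
    have hnorm : (θ : ℂ).re ^ 2 = 1 := by
      have := Circle.normSq_coe θ
      rw [Complex.normSq_apply, him] at this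
      linarith
    have hone : (θ : ℂ).re = 1 ∨ (θ : ℂ).re = -1 := by
      exact sq_eq_one_iff.1 hnorm
    have hsq : squareNorm θ = 1 := by
      rw [squareNorm, him, abs_zero, max_eq_left (abs_nonneg _)]
      rcases hone with h | h <;> simp [h]
    have hr1 : (n : ℝ) / 2 - 1 / 4 ≤ ρ t θ := by
      simp only [ρ, hsq]
      have := t.2.1; have := t.2.2
      nlinarith
    have hr2 : ρ t θ ≤ (n : ℝ) / 2 := by
      simp only [ρ, hsq]
      have := t.2.1; have := t.2.2
      nlinarith
    have hc : cen 0 n = ((n : ℝ) + 1) / 2 := by simp [cen]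
    rw [hc] at hre
    rcases hone with h | h
    · rw [h] at hre
      have e1 : (n : ℝ) < j := by linarith
      have e2 : (j : ℝ) < n + 1 := by linarith
      norm_cast at e1 e2; omega
    · rw [h] at hre
      have e1 : (j : ℝ) < 1 := by linarith
      norm_cast at e1; omega
  · ext z
    simp only [conv, mem_sphere_iff_norm, Set.mem_range]
    have hout : (0 : ℝ) < outR n := by linarith
    constructor
    · rintro ⟨θ, rfl⟩
      have : ‖(θ : ℂ)‖ = 1 := Circle.norm_coe θ
      simp only [ρ, Set.Icc.coe_zero, sub_zero, one_mul, zero_mul, add_zero, add_sub_cancel_left,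
        norm_mul, this, mul_one, Complex.norm_real, Real.norm_of_nonneg hout.le]
    · intro hz
      refine ⟨⟨(outR n : ℂ)⁻¹ * (z - cen 0 n), ?_⟩, ?_⟩
      · change _ ∈ Metric.sphere (0 : ℂ) 1
        rw [mem_sphere_zero_iff_norm, norm_mul, hz, norm_inv, Complex.norm_real,
          Real.norm_of_nonneg hout.le, inv_mul_cancel₀ hout.ne']
      · have : (outR n : ℂ) ≠ 0 := by exact_mod_cast hout.ne'
        simp [ρ, mul_inv_cancel_left₀ this]
  · rw [← range_graphPoint (by linarith) (fun x _ _ => by linarith)]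
    congr 1; funext θ
    apply Complex.ext
    · simp only [graphPoint, ρ, squareX, cen]
      simp
      ring
    · simp only [graphPoint, ρ, squareY, cen]
      simp
      ring

/-- The upper boundary of a region that contains the holes `1, …, S` and lies, to the right of them,
below a line separating two rotating blocks. -/
noncomputable def tiltedTop (S c d φ x : ℝ) : ℝ :=
  max 0 (min 1 (2 * (S + 1 / 2 - x))) +
    (1 - max 0 (min 1 (2 * (S + 1 / 2 - x)))) *
      (Real.sin φ * d - Real.cos φ * (x - c - Real.cos φ * d))

theorem tiltedTop_left {S c d φ x : ℝ} (h : x ≤ S) : tiltedTop S c d φ x = 1 := by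
  rw [tiltedTop, min_eq_left (by linarith), max_eq_right (by linarith)]; ring

theorem tiltedTop_right {S c d φ x : ℝ} (h : S + 1 / 2 ≤ x) :
    tiltedTop S c d φ x = Real.sin φ * d - Real.cos φ * (x - c - Real.cos φ * d) := by
  rw [tiltedTop, min_eq_right (by linarith), max_eq_left (by linarith)]; ring

/-- The linear part is a sum of three terms bounded by `M`, and the value is a convex combination of
it with `1`. A bottom at depth `3 * M + 1` is therefore below the top at every angle. -/
theorem tiltedTop_gt {S c d φ x M : ℝ} (hd : |d| ≤ M) (hx : |x - c| ≤ M) :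
    -(3 * M + 1) < tiltedTop S c d φ x := by
  have hM : 0 ≤ M := (abs_nonneg _).trans hd
  have key : ∀ a b : ℝ, |a| ≤ 1 → |b| ≤ M → |a * b| ≤ M := fun a b ha hb => by
    rw [abs_mul]; nlinarith [abs_nonneg a, abs_nonneg b]
  have h1 := abs_le.1 (key _ _ (Real.abs_sin_le_one φ) hd)
  have h2 := abs_le.1 (key _ _ (Real.abs_cos_le_one φ) hx)
  have h3 := abs_le.1 (key _ _ (Real.abs_cos_le_one φ) (key _ _ (Real.abs_cos_le_one φ) hd))
  have e0 : 0 ≤ max 0 (min 1 (2 * (S + 1 / 2 - x))) := le_max_left _ _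
  have e1 : max 0 (min 1 (2 * (S + 1 / 2 - x))) ≤ 1 := max_le zero_le_one (min_le_left _ _)
  rw [tiltedTop]
  set q := max 0 (min 1 (2 * (S + 1 / 2 - x)))
  have : -(3 * M) ≤ Real.sin φ * d - Real.cos φ * (x - c - Real.cos φ * d) := by
    have : Real.cos φ * (x - c - Real.cos φ * d)
      = Real.cos φ * (x - c) - Real.cos φ * (Real.cos φ * d) := by ring
    linarith
  nlinarith

theorem continuous_tiltedTop (S c d : ℝ) :
    Continuous fun p : ℝ × ℝ => tiltedTop S c d p.1 p.2 := by
  unfold tiltedTop; fun_prop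

/-- The upper boundary of an arm: it passes below the holes between `a` and `b`. -/
noncomputable def armTop (a b x : ℝ) : ℝ :=
  1 / 4 - 1 / 2 * max 0 (min 1 (min (8 * (x - a + 1 / 16)) (8 * (b + 1 / 16 - x))))

theorem continuous_armTop (a b : ℝ) : Continuous (armTop a b) := by
  unfold armTop; fun_prop

theorem armTop_left {a b x : ℝ} (h : x ≤ a - 1 / 16) : armTop a b x = 1 / 4 := by
  have : min 1 (min (8 * (x - a + 1 / 16)) (8 * (b + 1 / 16 - x))) ≤ 0 :=
    (min_le_right _ _).trans ((min_le_left _ _).trans (by linarith))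
  rw [armTop, max_eq_left this]; ring

theorem armTop_right {a b x : ℝ} (h : b + 1 / 16 ≤ x) : armTop a b x = 1 / 4 := by
  have : min 1 (min (8 * (x - a + 1 / 16)) (8 * (b + 1 / 16 - x))) ≤ 0 :=
    (min_le_right _ _).trans ((min_le_right _ _).trans (by linarith))
  rw [armTop, max_eq_left this]; ring

theorem armTop_middle {a b x : ℝ} (h : a + 1 / 16 ≤ x) (h' : x ≤ b - 1 / 16) :
    armTop a b x = -1 / 4 := by
  have : (1 : ℝ) ≤ min (8 * (x - a + 1 / 16)) (8 * (b + 1 / 16 - x)) :=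
    le_min (by linarith) (by linarith)
  rw [armTop, min_eq_left this, max_eq_right zero_le_one]; ring

theorem armTop_ge (a b x : ℝ) : -1 / 4 ≤ armTop a b x := by
  have : max 0 (min 1 (min (8 * (x - a + 1 / 16)) (8 * (b + 1 / 16 - x)))) ≤ 1 :=
    max_le zero_le_one (min_le_left _ _)
  unfold armTop; linarith

theorem armTop_wall_left {a b x : ℝ} (hab : a + 1 / 8 ≤ b) (h : a - 1 / 16 ≤ x)
    (h' : x ≤ a + 1 / 16) : armTop a b x = -4 * (x - a) := by
  rw [armTop, min_eq_left (a := 8 * (x - a + 1 / 16)) (by linarith), min_eq_right (by linarith),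
    max_eq_right (by linarith)]
  ring

theorem armTop_wall_right {a b x : ℝ} (hab : a + 1 / 8 ≤ b) (h : b - 1 / 16 ≤ x)
    (h' : x ≤ b + 1 / 16) : armTop a b x = 4 * (x - b) := by
  rw [armTop, min_eq_right (a := 8 * (x - a + 1 / 16)) (by linarith), min_eq_right (by linarith),
    max_eq_right (by linarith)]
  ring

-- The curve is followed during the rotation instead of computing its image. It is first made the
-- boundary of a region over all the holes `1, …, S + β + γ` whose top runs above the first `S + γ`
-- centres and below the remaining `β`. Over the rotating block the top is the line of slope `-cos
-- φ` through the rotated midpoint of the gap between these two groups. It has no vertical position,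
-- and turns from slope `-1` to slope `1` while keeping the groups on opposite sides, so it ends
-- above the last `γ` holes and below the middle `β`.
set_option maxHeartbeats 1000000 in
theorem isotopicIn_tw_conv_armTop {S β γ k : ℕ} (hS : 1 ≤ S) (hβ : 1 ≤ β) (hγ : 1 ≤ γ)
    (hk : S + β + γ ≤ k) :
    IsotopicIn (holes k)ᶜ (tw S (β + γ) '' conv 0 (S + γ))
      (graphCurve (3 / 4) (S + β + γ + 1 / 4) (3 / 4) (armTop (S + 1 / 4) (S + β + 3 / 4))) := by
  have hS' : (1 : ℝ) ≤ S := by exact_mod_cast hS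
  have hβ' : (1 : ℝ) ≤ β := by exact_mod_cast hβ
  have hγ' : (1 : ℝ) ≤ γ := by exact_mod_cast hγ
  set N : ℝ := S + β + γ with hN
  set c : ℝ := cen S (β + γ) with hc
  -- The gap lies at `c + d = S + γ + 1 / 2`, where `c` is the centre of the rotating block.
  set d : ℝ := ((γ : ℝ) - β) / 2 with hd
  have hc' : c = S + (β + γ + 1) / 2 := by rw [hc, cen]; push_cast; ring
  set L : ℝ := 3 * N + 1 with hL
  let u : ℝ → ℝ → ℝ := fun φ x => tiltedTop S c d φ x
  have hdN : |d| ≤ N := by rw [abs_le]; constructor <;> linarith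
  have hpos : ∀ φ x, 1 / 2 ≤ x → x ≤ N + 1 / 2 → -L < u φ x := fun φ x h1 h2 =>
    tiltedTop_gt hdN (by rw [abs_le]; constructor <;> linarith)
  have hu : ∀ φ, Continuous (u φ) := fun φ =>
    (continuous_tiltedTop S c d).comp (by fun_prop : Continuous fun x : ℝ => (φ, x))
  have hu0 : ∀ x : ℝ, S + 1 / 2 ≤ x → u 0 x = S + γ + 1 / 2 - x := fun x hx => by
    simp only [u]; rw [tiltedTop_right hx, Real.sin_zero, Real.cos_zero, hc', hd]; ring
  have huπ : ∀ x : ℝ, S + 1 / 2 ≤ x → u Real.pi x = x - (S + β + 1 / 2) := fun x hx => by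
    simp only [u]; rw [tiltedTop_right hx, Real.sin_pi, Real.cos_pi, hc', hd]; ring
  have huS : ∀ φ (x : ℝ), x ≤ S → u φ x = 1 := fun φ x hx => tiltedTop_left hx
  have hcast : ∀ {a b : ℕ}, a ≤ b → (a : ℝ) ≤ b := fun h => by exact_mod_cast h
  have hst := tw_mem_holeStabilizer (p := S) (s := β + γ) (k := k) (by omega)
  have step1 : IsotopicIn (holes k)ᶜ (conv 0 (S + γ))
      (graphCurve (1 / 2) (S + γ + 1 / 2) ((S + γ) / 2) fun _ => ((S : ℝ) + γ) / 2) := by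
    have := isotopicIn_conv_square k (n := S + γ) (by omega)
    push_cast at this
    exact this
  have step2 : IsotopicIn (holes k)ᶜ
      (graphCurve (1 / 2) (S + γ + 1 / 2) ((S + γ) / 2) fun _ => ((S : ℝ) + γ) / 2)
      (graphCurve (1 / 2) (S + γ + 1 / 2) L (u 0)) := by
    refine isotopicIn_graphCurve_linear continuous_const (hu 0) (by linarith) (by linarith)
      (fun x h1 h2 => ⟨by linarith, hpos 0 x (by simpa using h1) ?_⟩) (by linarith) (by linarith)
      (fun j hj1 hj2 => ?_)
    · rw [or_self] at h2; linarith
    · have hj1' := hcast hj1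
      push_cast at hj1'
      rcases Nat.lt_or_ge (S + γ) j with h | h
      · have := hcast h
        push_cast at this
        right; left; constructor <;> linarith
      · have := hcast h
        push_cast at this
        right; right; right
        refine ⟨⟨by linarith, by linarith, by linarith⟩, by linarith, by linarith, ?_⟩
        rcases Nat.lt_or_ge S j with h' | h'
        · have := hcast h'
          push_cast at this
          rw [hu0 _ (by linarith)]; linarith
        · rw [huS _ _ (hcast h')]; norm_num
  -- The right wall slides past the other `β` centres, which it may do because the top is already
  -- below the axis there.
  have step3 : IsotopicIn (holes k)ᶜ (graphCurve (1 / 2) (S + γ + 1 / 2) L (u 0))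
      (graphCurve (1 / 2) (N + 1 / 2) L (u 0)) := by
    refine isotopicIn_graphCurve_linear (hu 0) (hu 0) (by linarith) (by linarith)
      (fun x h1 h2 => ?_) (by linarith) (by linarith) (fun j hj1 hj2 => ?_)
    · have := hpos 0 x (by simpa using h1) (by rcases h2 with h | h <;> linarith)
      exact ⟨this, this⟩
    · have hj1' := hcast hj1
      push_cast at hj1'
      rcases Nat.lt_or_ge (S + γ) j with h | h
      · have := hcast h
        push_cast at this
        right; right; left
        rw [hu0 _ (by linarith)]; constructor <;> linarith
      · have := hcast h
        push_cast at this
        have hp : 0 < u 0 j := by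
          rcases Nat.lt_or_ge S j with h' | h'
          · have := hcast h'
            push_cast at this
            rw [hu0 _ (by linarith)]; linarith
          · rw [huS _ _ (hcast h')]; norm_num
        right; right; right
        exact ⟨⟨by linarith, by linarith, hp⟩, by linarith, by linarith, hp⟩
  have step4 : IsotopicIn (holes k)ᶜ (tw S (β + γ) '' graphCurve (1 / 2) (N + 1 / 2) L (u 0))
      (graphCurve (1 / 2) (N + 1 / 2) L (u Real.pi)) := by
    have h := isotopicIn_of_graph_family (k := k) (x₀ := fun _ => 1 / 2) (x₁ := fun _ => N + 1 / 2)
      (L := fun _ => L) (u := fun t => u (Real.pi * t)) continuous_const continuous_const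
      continuous_const ((continuous_tiltedTop S c d).comp
        (by fun_prop : Continuous fun p : unitInterval × ℝ => (Real.pi * (p.1 : ℝ), p.2)))
      (fun _ => by linarith) (fun t x => hpos _ x)
      (isContFamily_ptw (f := fun t => Real.pi * (t : ℝ)) (by fun_prop) S (β + γ))
      (by simpa [tw] using hst) ?_
    · simp only [Set.Icc.coe_one, Set.Icc.coe_zero, mul_one, mul_zero, ptw_zero] at h
      have e : ∀ C : Set ℂ, (1 : ℂ ≃ₜ ℂ).symm '' C = C := fun C => by
        change id '' C = C
        simp
      rw [e] at h
      exact h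
    · rintro t _ ⟨j, hj1, hj2, rfl⟩
      have hj1' := hcast hj1
      push_cast at hj1'
      by_cases hjS : j ≤ S
      · rw [ptw_nat_of_not_mem _ (by omega)]
        intro _ _
        right
        rw [Complex.natCast_re, Complex.natCast_im, huS _ _ (hcast hjS)]
        have := hcast hjS
        refine ⟨by linarith, by linarith, by linarith, by norm_num⟩
      by_cases hjN : j ≤ S + (β + γ)
      · have h1 : (S : ℝ) + 1 ≤ j := by have := hcast (not_le.1 hjS); push_cast at this; exact this
        have h2 : (j : ℝ) ≤ N := by have := hcast hjN; push_cast at this; linarith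
        rw [ptw_nat _ (by omega) hjN, ← hc]
        intro _ _
        set φ : ℝ := Real.pi * t
        have hsin : 0 ≤ Real.sin φ := Real.sin_nonneg_of_nonneg_of_le_pi
          (mul_nonneg Real.pi_pos.le t.2.1) (by have := t.2.2; have := Real.pi_pos; simp only [φ]; nlinarith)
        have hcb := convex_bounds (Real.neg_one_le_cos φ) (Real.cos_le_one φ) h1 h2
        have hcm : ((S : ℝ) + 1 + N) / 2 = c := by rw [hc', hN]; ring
        rw [hcm] at hcb
        -- The height of a rotated centre above the line is this positive factor times `j - c - d`,
        -- so its sign depends only on the side of the gap on which `j` started.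
        have hsc : 0 < Real.sin φ + Real.cos φ ^ 2 := by
          rcases hsin.eq_or_lt with h | h
          · have := Real.sin_sq_add_cos_sq φ
            rw [← h] at this ⊢; nlinarith
          · nlinarith [sq_nonneg (Real.cos φ)]
        have hval : u φ (c + Real.cos φ * (j - c)) = Real.sin φ * (j - c) -
            (Real.sin φ + Real.cos φ ^ 2) * (j - c - d) := by
          simp only [u]; rw [tiltedTop_right (by linarith [hcb.1])]; ring
        have hjd : (j : ℝ) - c - d = j - (S + γ + 1 / 2) := by rw [hc', hd]; ring
        change u φ (c + Real.cos φ * (j - c)) < Real.sin φ * (j - c) ∨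
          (1 / 2 < c + Real.cos φ * (j - c) ∧ c + Real.cos φ * (j - c) < N + 1 / 2 ∧
            -L < Real.sin φ * (j - c) ∧ Real.sin φ * (j - c) < u φ (c + Real.cos φ * (j - c)))
        rw [hval, hjd]
        rcases Nat.lt_or_ge (S + γ) j with h | h
        · have := hcast h
          push_cast at this
          left; nlinarith
        · have := hcast h
          push_cast at this
          right
          refine ⟨by linarith [hcb.1], by linarith [hcb.2], ?_, by nlinarith⟩
          have : |Real.sin φ * (j - c)| ≤ N := by
            rw [abs_mul]
            refine (mul_le_of_le_one_left (abs_nonneg _) (Real.abs_sin_le_one φ)).trans ?_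
            rw [abs_le]; constructor <;> linarith
          linarith [(abs_le.1 this).1]
      · rw [ptw_nat_of_not_mem _ (by omega)]
        intro _ hle
        have := hcast (not_le.1 hjN)
        push_cast at this
        simp only [Complex.natCast_re] at hle
        linarith
  have step5 : IsotopicIn (holes k)ᶜ (graphCurve (1 / 2) (N + 1 / 2) L (u Real.pi))
      (graphCurve (3 / 4) (N + 1 / 4) (3 / 4) (armTop (S + 1 / 4) (S + β + 3 / 4))) := by
    refine isotopicIn_graphCurve_linear (hu _) (continuous_armTop _ _) (by linarith) (by linarith)
      (fun x h1 h2 => ⟨hpos _ x (by rcases h1 with h | h <;> linarith)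
        (by rcases h2 with h | h <;> linarith), ?_⟩) (by linarith) (by norm_num)
      (fun j hj1 hj2 => ?_)
    · have := armTop_ge (S + 1 / 4) (S + β + 3 / 4) x
      linarith
    · have hj1' := hcast hj1
      push_cast at hj1'
      by_cases hjS : j ≤ S
      · have := hcast hjS
        rw [huS _ _ this, armTop_left (by linarith)]
        right; right; right
        exact ⟨⟨by linarith, by linarith, by norm_num⟩, by linarith, by linarith, by norm_num⟩
      have h1 : (S : ℝ) + 1 ≤ j := by have := hcast (not_le.1 hjS); push_cast at this; exact this
      by_cases hjB : j ≤ S + β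
      · have := hcast hjB
        push_cast at this
        rw [huπ _ (by linarith), armTop_middle (by linarith) (by linarith)]
        right; right; left
        exact ⟨by linarith, by norm_num⟩
      have h2 : (S : ℝ) + β + 1 ≤ j := by have := hcast (not_le.1 hjB); push_cast at this; exact this
      by_cases hjN : j ≤ S + β + γ
      · have := hcast hjN
        push_cast at this
        rw [huπ _ (by linarith), armTop_right (by linarith)]
        right; right; right
        exact ⟨⟨by linarith, by linarith, by linarith⟩, by linarith, by linarith, by norm_num⟩
      · have := hcast (not_le.1 hjN)
        push_cast at this
        right; left
        constructor <;> linarith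
  exact (((step1.trans step2).trans step3).image_homeo hst).trans (step4.trans step5)

/-! ## Arms -/

/-- A horizontal segment. -/
def hseg (a b y : ℝ) : Set ℂ := {z | a ≤ z.re ∧ z.re ≤ b ∧ z.im = y}

/-- A vertical segment. -/
def vseg (x a b : ℝ) : Set ℂ := {z | z.re = x ∧ a ≤ z.im ∧ z.im ≤ b}

/-- The boundary of a rectangle with a rectangular notch above the interval `[x₁, x₂]`. -/
def lowerArm (x₀ x₁ x₂ x₃ : ℝ) : Set ℂ :=
  vseg x₀ (-3 / 4) (1 / 4) ∪ hseg x₀ x₁ (1 / 4) ∪ vseg x₁ (-1 / 4) (1 / 4) ∪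
    hseg x₁ x₂ (-1 / 4) ∪ vseg x₂ (-1 / 4) (1 / 4) ∪ hseg x₂ x₃ (1 / 4) ∪
    vseg x₃ (-3 / 4) (1 / 4) ∪ hseg x₀ x₃ (-3 / 4)

theorem segment_eq_hseg {a b : ℝ} (y : ℝ) (h : a ≤ b) :
    segment ℝ (⟨a, y⟩ : ℂ) ⟨b, y⟩ = hseg a b y := by
  have hf : ∀ x : ℝ, AffineMap.lineMap (k := ℝ) (⟨0, y⟩ : ℂ) ⟨1, y⟩ x = ⟨x, y⟩ := fun x => by
    rw [AffineMap.lineMap_apply]; apply Complex.ext <;> simp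
  have := image_segment ℝ (AffineMap.lineMap (k := ℝ) (⟨0, y⟩ : ℂ) ⟨1, y⟩) a b
  rw [hf, hf] at this
  rw [← this, segment_eq_Icc h]
  ext z
  constructor
  · rintro ⟨x, hx, rfl⟩
    rw [hf]; exact ⟨hx.1, hx.2, rfl⟩
  · rintro ⟨h1, h2, h3⟩
    exact ⟨z.re, ⟨h1, h2⟩, by rw [hf]; exact Complex.ext rfl h3.symm⟩

theorem segment_eq_vseg {a b : ℝ} (x : ℝ) (h : a ≤ b) :
    segment ℝ (⟨x, a⟩ : ℂ) ⟨x, b⟩ = vseg x a b := by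
  have hf : ∀ y : ℝ, AffineMap.lineMap (k := ℝ) (⟨x, 0⟩ : ℂ) ⟨x, 1⟩ y = ⟨x, y⟩ := fun x => by
    rw [AffineMap.lineMap_apply]; apply Complex.ext <;> simp
  have := image_segment ℝ (AffineMap.lineMap (k := ℝ) (⟨x, 0⟩ : ℂ) ⟨x, 1⟩) a b
  rw [hf, hf] at this
  rw [← this, segment_eq_Icc h]
  ext z
  constructor
  · rintro ⟨x, hx, rfl⟩
    rw [hf]; exact ⟨rfl, hx.1, hx.2⟩
  · rintro ⟨h1, h2, h3⟩
    exact ⟨z.im, ⟨h2, h3⟩, by rw [hf]; exact Complex.ext h1.symm rfl⟩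

theorem mirrorImage_hseg (a b y : ℝ) : mirrorImage (hseg a b y) = hseg a b (-y) := by
  ext z
  constructor
  · rintro ⟨w, ⟨h1, h2, h3⟩, rfl⟩
    exact ⟨by simpa using h1, by simpa using h2, by simpa using h3⟩
  · rintro ⟨h1, h2, h3⟩
    exact ⟨starRingEnd ℂ z, ⟨by simpa using h1, by simpa using h2, by simp [h3]⟩, by simp⟩

theorem mirrorImage_vseg (x a b : ℝ) : mirrorImage (vseg x a b) = vseg x (-b) (-a) := by
  ext z
  constructor
  · rintro ⟨w, ⟨h1, h2, h3⟩, rfl⟩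
    exact ⟨by simpa using h1, by simpa using h3, by simpa using h2⟩
  · rintro ⟨h1, h2, h3⟩
    exact ⟨starRingEnd ℂ z, ⟨by simpa using h1, by simp; linarith, by simp; linarith⟩, by simp⟩

theorem mirrorImage_union (C C' : Set ℂ) :
    mirrorImage (C ∪ C') = mirrorImage C ∪ mirrorImage C' := Set.image_union ..

theorem mirrorImage_armCurve {i : ℕ} (h : 1 ≤ i) :
    mirrorImage (armCurve i) = lowerArm (3 / 4) (i + 1 / 4) (i + 7 / 4) (i + 9 / 4) := by
  have hi : (1 : ℝ) ≤ i := by exact_mod_cast h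
  have e : armCurve i = hseg (3 / 4) (i + 1 / 4) (-1 / 4) ∪ vseg (i + 1 / 4) (-1 / 4) (1 / 4) ∪
      hseg (i + 1 / 4) (i + 7 / 4) (1 / 4) ∪ vseg (i + 7 / 4) (-1 / 4) (1 / 4) ∪
      hseg (i + 7 / 4) (i + 9 / 4) (-1 / 4) ∪ vseg (i + 9 / 4) (-1 / 4) (3 / 4) ∪
      hseg (3 / 4) (i + 9 / 4) (3 / 4) ∪ vseg (3 / 4) (-1 / 4) (3 / 4) := by
    rw [← segment_eq_hseg _ (by linarith), ← segment_eq_hseg _ (by linarith),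
      ← segment_eq_hseg _ (by linarith), ← segment_eq_hseg _ (by linarith),
      ← segment_eq_vseg _ (by norm_num), ← segment_eq_vseg _ (by norm_num),
      ← segment_eq_vseg _ (by norm_num), ← segment_eq_vseg _ (by norm_num),
      segment_symm ℝ (⟨i + 7 / 4, -1 / 4⟩ : ℂ) ⟨i + 7 / 4, 1 / 4⟩,
      segment_symm ℝ (⟨3 / 4, 3 / 4⟩ : ℂ) ⟨i + 9 / 4, 3 / 4⟩,
      segment_symm ℝ (⟨3 / 4, -1 / 4⟩ : ℂ) ⟨3 / 4, 3 / 4⟩]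
    ext z
    simp only [armCurve, Set.mem_iUnion, Set.mem_union, or_assoc]
    constructor
    · rintro ⟨j, hj⟩
      fin_cases j
      · exact .inl hj
      · exact .inr (.inl hj)
      · exact .inr (.inr (.inl hj))
      · exact .inr (.inr (.inr (.inl hj)))
      · exact .inr (.inr (.inr (.inr (.inl hj))))
      · exact .inr (.inr (.inr (.inr (.inr (.inl hj)))))
      · exact .inr (.inr (.inr (.inr (.inr (.inr (.inl hj))))))
      · exact .inr (.inr (.inr (.inr (.inr (.inr (.inr hj))))))
    · rintro (h | h | h | h | h | h | h | h)
      exacts [⟨0, h⟩, ⟨1, h⟩, ⟨2, h⟩, ⟨3, h⟩, ⟨4, h⟩, ⟨5, h⟩, ⟨6, h⟩, ⟨7, h⟩]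
  rw [e]
  simp only [mirrorImage_union, mirrorImage_hseg, mirrorImage_vseg, lowerArm, neg_div, neg_neg]
  ext z
  simp only [Set.mem_union]
  tauto

/-! ## Straightening the walls of an arm -/

/-- A bump of slope at most `4` that is `1` on `[-1/16, 1/16]` and `0` off `[-5/16, 5/16]`. -/
noncomputable def bump (x : ℝ) : ℝ := max 0 (min 1 (5 / 4 - 4 * |x|))

theorem continuous_bump : Continuous bump := by unfold bump; fun_prop

theorem bump_of_abs_le {x : ℝ} (h : |x| ≤ 1 / 16) : bump x = 1 := by
  rw [bump, min_eq_left (by linarith), max_eq_right zero_le_one]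

theorem bump_of_le_abs {x : ℝ} (h : 5 / 16 ≤ |x|) : bump x = 0 := by
  rw [bump, max_eq_left]; exact (min_le_right _ _).trans (by linarith)

theorem abs_bump_sub_le (x y : ℝ) : |bump x - bump y| ≤ 4 * |x - y| := by
  have h1 : |bump x - bump y| ≤ |(5 / 4 - 4 * |x|) - (5 / 4 - 4 * |y|)| := by
    unfold bump
    refine (abs_max_sub_max_le_max _ _ _ _).trans ?_
    rw [sub_self, abs_zero, max_eq_right (abs_nonneg _)]
    refine (abs_min_sub_min_le_max _ _ _ _).trans ?_
    rw [sub_self, abs_zero, max_eq_right (abs_nonneg _)]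
  have h2 : (5 / 4 - 4 * |x|) - (5 / 4 - 4 * |y|) = 4 * (|y| - |x|) := by ring
  rw [h2, abs_mul, abs_of_pos (by norm_num : (0 : ℝ) < 4)] at h1
  have := abs_abs_sub_abs_le y x
  rw [abs_sub_comm y x] at this
  linarith

theorem abs_bump_le (x : ℝ) : |bump x| ≤ 1 := by
  rw [abs_of_nonneg (le_max_left _ _)]
  exact max_le zero_le_one (min_le_left _ _)

/-- The horizontal coordinate of the map straightening the slanted walls at `x₁` and `x₂`. -/
noncomputable def straightenRe (x₁ x₂ s y x : ℝ) : ℝ :=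
  x + s * (max (-1 / 4) (min (1 / 4) y) / 4) * (bump (x - x₁) - bump (x - x₂))

theorem abs_straighten_coeff {s y : ℝ} (h0 : 0 ≤ s) (h1 : s ≤ 1) :
    |s * (max (-1 / 4) (min (1 / 4) y) / 4)| ≤ 1 / 16 := by
  have ha : |max (-1 / 4) (min (1 / 4) y)| ≤ (1 / 4 : ℝ) :=
    abs_le.2 ⟨by rw [← neg_div]; exact le_max_left _ _, max_le (by norm_num) (min_le_left _ _)⟩
  rw [abs_mul, abs_div, abs_of_nonneg h0, abs_of_pos (by norm_num : (0 : ℝ) < 4)]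
  have : |max (-1 / 4) (min (1 / 4) y)| / 4 ≤ (1 / 16 : ℝ) := by linarith
  have := mul_le_mul h1 this (by positivity) zero_le_one
  linarith

/-- The difference of the two bumps is `8`-Lipschitz and its coefficient is at most `1 / 16`, so the
perturbation of the identity has Lipschitz constant at most `1 / 2`. -/
theorem strictMono_straightenRe (x₁ x₂ y : ℝ) {s : ℝ} (h0 : 0 ≤ s) (h1 : s ≤ 1) :
    StrictMono (straightenRe x₁ x₂ s y) := by
  intro a b hab
  have hc := abs_straighten_coeff (y := y) h0 h1
  set c := s * (max (-1 / 4) (min (1 / 4) y) / 4) with hcd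
  have e1 := abs_bump_sub_le (b - x₁) (a - x₁)
  have e2 := abs_bump_sub_le (b - x₂) (a - x₂)
  rw [sub_sub_sub_cancel_right, abs_of_pos (sub_pos.2 hab)] at e1 e2
  have e3 : |(bump (b - x₁) - bump (a - x₁)) - (bump (b - x₂) - bump (a - x₂))| ≤ 8 * (b - a) := by
    refine (abs_sub _ _).trans ?_
    linarith
  have e4 := mul_le_mul hc e3 (abs_nonneg _) (by norm_num)
  rw [← abs_mul] at e4
  have e5 := (abs_le.1 e4).1
  unfold straightenRe
  rw [← hcd]
  nlinarith

theorem continuous_straightenRe (x₁ x₂ : ℝ) :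
    Continuous fun q : ℝ × ℝ × ℝ => straightenRe x₁ x₂ q.1 q.2.1 q.2.2 := by
  have := continuous_bump
  unfold straightenRe; fun_prop

theorem surjective_of_abs_sub_le {f : ℝ → ℝ} (hf : Continuous f) {M : ℝ}
    (h : ∀ x, |f x - x| ≤ M) : Function.Surjective f := by
  refine hf.surjective ?_ ?_
  · refine Filter.tendsto_atTop_mono (f := fun x => -M + x) (fun x => ?_)
      (Filter.tendsto_atTop_add_const_left _ _ Filter.tendsto_id)
    linarith [(abs_le.1 (h x)).1]
  · have hle : ∀ x, f x ≤ M + x := fun x => by linarith [(abs_le.1 (h x)).2]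
    exact Filter.tendsto_atBot_mono hle (Filter.tendsto_atBot_add_const_left _ _ Filter.tendsto_id)

theorem surjective_straightenRe (x₁ x₂ y : ℝ) {s : ℝ} (h0 : 0 ≤ s) (h1 : s ≤ 1) :
    Function.Surjective (straightenRe x₁ x₂ s y) := by
  refine surjective_of_abs_sub_le (M := 1 / 8)
    ((continuous_straightenRe x₁ x₂).comp (by fun_prop : Continuous fun x : ℝ => (s, y, x))) fun x => ?_
  have hc := abs_straighten_coeff (y := y) h0 h1
  unfold straightenRe
  rw [add_sub_cancel_left, abs_mul]
  have e : |bump (x - x₁) - bump (x - x₂)| ≤ 2 :=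
    (abs_sub _ _).trans (by linarith [abs_bump_le (x - x₁), abs_bump_le (x - x₂)])
  have := mul_le_mul hc e (abs_nonneg _) (by norm_num)
  linarith

/-- The map straightening the slanted walls at `x₁` and `x₂`. -/
noncomputable def straighten (x₁ x₂ s : ℝ) (z : ℂ) : ℂ := ⟨straightenRe x₁ x₂ s z.im z.re, z.im⟩

theorem straighten_zero (x₁ x₂ : ℝ) (z : ℂ) : straighten x₁ x₂ 0 z = z := by
  apply Complex.ext <;> simp [straighten, straightenRe]

theorem straighten_injective (x₁ x₂ : ℝ) {s : ℝ} (h0 : 0 ≤ s) (h1 : s ≤ 1) :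
    Function.Injective (straighten x₁ x₂ s) := by
  intro z w h
  have him : z.im = w.im := by simpa [straighten] using congrArg Complex.im h
  have hre : straightenRe x₁ x₂ s z.im z.re = straightenRe x₁ x₂ s w.im w.re := congrArg Complex.re h
  rw [him] at hre
  exact Complex.ext ((strictMono_straightenRe x₁ x₂ _ h0 h1).injective hre) him

theorem straighten_surjective (x₁ x₂ : ℝ) {s : ℝ} (h0 : 0 ≤ s) (h1 : s ≤ 1) :
    Function.Surjective (straighten x₁ x₂ s) := by
  intro w
  obtain ⟨x, hx⟩ := surjective_straightenRe x₁ x₂ w.im h0 h1 w.re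
  exact ⟨⟨x, w.im⟩, Complex.ext hx rfl⟩

/-- The axis of the holes is fixed, which keeps the straightening isotopy off the centres. -/
theorem straighten_of_im_eq_zero (x₁ x₂ s : ℝ) {z : ℂ} (h : z.im = 0) : straighten x₁ x₂ s z = z := by
  apply Complex.ext
  · simp only [straighten, straightenRe, h]; norm_num
  · rfl

theorem straightenRe_of_far {x₁ x₂ x : ℝ} (s y : ℝ) (h1 : 5 / 16 ≤ |x - x₁|)
    (h2 : 5 / 16 ≤ |x - x₂|) : straightenRe x₁ x₂ s y x = x := by
  rw [straightenRe, bump_of_le_abs h1, bump_of_le_abs h2]; ring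

theorem straightenRe_wall_left {x₁ x₂ y : ℝ} (h : x₁ + 5 / 8 ≤ x₂) (hy : |y| ≤ 1 / 4) :
    straightenRe x₁ x₂ 1 y (x₁ - y / 4) = x₁ := by
  have := abs_le.1 hy
  rw [straightenRe, bump_of_abs_le (by rw [abs_le]; constructor <;> linarith),
    bump_of_le_abs (by rw [abs_of_neg (by linarith)]; linarith), min_eq_right (by linarith),
    max_eq_right (by linarith)]
  ring

theorem straightenRe_wall_right {x₁ x₂ y : ℝ} (h : x₁ + 5 / 8 ≤ x₂) (hy : |y| ≤ 1 / 4) :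
    straightenRe x₁ x₂ 1 y (x₂ + y / 4) = x₂ := by
  have := abs_le.1 hy
  rw [straightenRe, bump_of_abs_le (x := x₂ + y / 4 - x₂) (by rw [abs_le]; constructor <;> linarith),
    bump_of_le_abs (by rw [abs_of_pos (by linarith)]; linarith), min_eq_right (by linarith),
    max_eq_right (by linarith)]
  ring

/-- The eight pieces are those of `lowerArm`, in the same order, except that the two inner walls are
slanted, with abscissas `x₁ - y / 4` and `x₂ + y / 4` at height `y`. -/
theorem mem_graphCurve_armTop {x₀ x₁ x₂ x₃ : ℝ} (h₀ : x₀ + 5 / 16 ≤ x₁) (h₁ : x₁ + 5 / 8 ≤ x₂)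
    (h₂ : x₂ + 5 / 16 ≤ x₃) (z : ℂ) :
    z ∈ graphCurve x₀ x₃ (3 / 4) (armTop x₁ x₂) ↔
      (z.re = x₀ ∧ -3 / 4 ≤ z.im ∧ z.im ≤ 1 / 4) ∨
      (x₀ ≤ z.re ∧ z.re ≤ x₁ - z.im / 4 ∧ z.im = 1 / 4) ∨
      (z.re = x₁ - z.im / 4 ∧ -1 / 4 ≤ z.im ∧ z.im ≤ 1 / 4) ∨
      (x₁ - z.im / 4 ≤ z.re ∧ z.re ≤ x₂ + z.im / 4 ∧ z.im = -1 / 4) ∨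
      (z.re = x₂ + z.im / 4 ∧ -1 / 4 ≤ z.im ∧ z.im ≤ 1 / 4) ∨
      (x₂ + z.im / 4 ≤ z.re ∧ z.re ≤ x₃ ∧ z.im = 1 / 4) ∨
      (z.re = x₃ ∧ -3 / 4 ≤ z.im ∧ z.im ≤ 1 / 4) ∨
      (x₀ ≤ z.re ∧ z.re ≤ x₃ ∧ z.im = -3 / 4) := by
  obtain ⟨x, y⟩ := z
  simp only [graphCurve, Set.mem_ofPred_eq]
  have hge := armTop_ge x₁ x₂ x
  have L : x ≤ x₁ - 1 / 16 → armTop x₁ x₂ x = 1 / 4 := armTop_left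
  have R : x₂ + 1 / 16 ≤ x → armTop x₁ x₂ x = 1 / 4 := armTop_right
  have M : x₁ + 1 / 16 ≤ x → x ≤ x₂ - 1 / 16 → armTop x₁ x₂ x = -1 / 4 := armTop_middle
  have WL : x₁ - 1 / 16 ≤ x → x ≤ x₁ + 1 / 16 → armTop x₁ x₂ x = -4 * (x - x₁) :=
    armTop_wall_left (by linarith)
  have WR : x₂ - 1 / 16 ≤ x → x ≤ x₂ + 1 / 16 → armTop x₁ x₂ x = 4 * (x - x₂) :=
    armTop_wall_right (by linarith)
  generalize armTop x₁ x₂ x = a at *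
  constructor
  · rintro ⟨h1, h2, h3, h4, rfl | rfl | rfl | rfl⟩
    · rw [L (by linarith)] at h4
      exact .inl ⟨rfl, by linarith, h4⟩
    · rw [R (by linarith)] at h4
      exact .inr (.inr (.inr (.inr (.inr (.inr (.inl ⟨rfl, by linarith, h4⟩))))))
    · exact .inr (.inr (.inr (.inr (.inr (.inr (.inr ⟨h1, h2, by norm_num⟩))))))
    · rcases le_total x (x₁ - 1 / 16) with c1 | c1
      · have := L c1
        exact .inr (.inl ⟨h1, by linarith, this⟩)
      rcases le_total x (x₁ + 1 / 16) with c2 | c2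
      · have := WL c1 c2
        exact .inr (.inr (.inl ⟨by linarith, by linarith, by linarith⟩))
      rcases le_total x (x₂ - 1 / 16) with c3 | c3
      · have := M c2 c3
        exact .inr (.inr (.inr (.inl ⟨by linarith, by linarith, this⟩)))
      rcases le_total x (x₂ + 1 / 16) with c4 | c4
      · have := WR c3 c4
        exact .inr (.inr (.inr (.inr (.inl ⟨by linarith, by linarith, by linarith⟩))))
      · have := R c4
        exact .inr (.inr (.inr (.inr (.inr (.inl ⟨by linarith, h2, this⟩)))))
  · rintro (⟨h1, h2, h3⟩ | ⟨h1, h2, h3⟩ | ⟨h1, h2, h3⟩ | ⟨h1, h2, h3⟩ | ⟨h1, h2, h3⟩ |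
      ⟨h1, h2, h3⟩ | ⟨h1, h2, h3⟩ | ⟨h1, h2, h3⟩)
    · have := L (by linarith)
      exact ⟨by linarith, by linarith, by linarith, by linarith, .inl h1⟩
    · have := L (by linarith)
      exact ⟨by linarith, by linarith, by linarith, by linarith, .inr (.inr (.inr (by linarith)))⟩
    · have := WL (by linarith) (by linarith)
      exact ⟨by linarith, by linarith, by linarith, by linarith, .inr (.inr (.inr (by linarith)))⟩
    · have := M (by linarith) (by linarith)
      exact ⟨by linarith, by linarith, by linarith, by linarith, .inr (.inr (.inr (by linarith)))⟩
    · have := WR (by linarith) (by linarith)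
      exact ⟨by linarith, by linarith, by linarith, by linarith, .inr (.inr (.inr (by linarith)))⟩
    · have := R (by linarith)
      exact ⟨by linarith, by linarith, by linarith, by linarith, .inr (.inr (.inr (by linarith)))⟩
    · have := R (by linarith)
      exact ⟨by linarith, by linarith, by linarith, by linarith, .inr (.inl h1)⟩
    · exact ⟨by linarith, by linarith, by linarith, by linarith, .inr (.inr (.inl (by linarith)))⟩

/-- On each horizontal line straightening is strictly increasing, fixes `x₀` and `x₃`, and takes the
slanted walls to `x₁` and `x₂`; the conditions for the pieces correspond one by one. -/
theorem straighten_mem_lowerArm {x₀ x₁ x₂ x₃ : ℝ} (h₀ : x₀ + 5 / 16 ≤ x₁) (h₁ : x₁ + 5 / 8 ≤ x₂)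
    (h₂ : x₂ + 5 / 16 ≤ x₃) (z : ℂ) :
    straighten x₁ x₂ 1 z ∈ lowerArm x₀ x₁ x₂ x₃ ↔
      z ∈ graphCurve x₀ x₃ (3 / 4) (armTop x₁ x₂) := by
  rw [mem_graphCurve_armTop h₀ h₁ h₂]
  have hm := strictMono_straightenRe x₁ x₂ z.im zero_le_one le_rfl
  have e0 : straightenRe x₁ x₂ 1 z.im x₀ = x₀ := straightenRe_of_far _ _
    (by rw [abs_of_neg (by linarith)]; linarith) (by rw [abs_of_neg (by linarith)]; linarith)
  have e3 : straightenRe x₁ x₂ 1 z.im x₃ = x₃ := straightenRe_of_far _ _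
    (by rw [abs_of_pos (by linarith)]; linarith) (by rw [abs_of_pos (by linarith)]; linarith)
  have a0 := (hm.le_iff_le (a := x₀) (b := z.re)).symm
  have a3 := (hm.le_iff_le (a := z.re) (b := x₃)).symm
  have b0 := (hm.injective.eq_iff (a := z.re) (b := x₀)).symm
  have b3 := (hm.injective.eq_iff (a := z.re) (b := x₃)).symm
  rw [e0] at a0 b0
  rw [e3] at a3 b3
  have w1 := fun hy : |z.im| ≤ 1 / 4 => straightenRe_wall_left h₁ hy
  have w2 := fun hy : |z.im| ≤ 1 / 4 => straightenRe_wall_right h₁ hy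
  simp only [lowerArm, Set.mem_union, hseg, vseg, Set.mem_ofPred_eq, straighten, or_assoc]
  by_cases hy : |z.im| ≤ 1 / 4
  · have a1 := (hm.le_iff_le (a := z.re) (b := x₁ - z.im / 4)).symm
    have a1' := (hm.le_iff_le (a := x₁ - z.im / 4) (b := z.re)).symm
    have b1 := (hm.injective.eq_iff (a := z.re) (b := x₁ - z.im / 4)).symm
    have a2 := (hm.le_iff_le (a := z.re) (b := x₂ + z.im / 4)).symm
    have a2' := (hm.le_iff_le (a := x₂ + z.im / 4) (b := z.re)).symm
    have b2 := (hm.injective.eq_iff (a := z.re) (b := x₂ + z.im / 4)).symm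
    rw [w1 hy] at a1 a1' b1
    rw [w2 hy] at a2 a2' b2
    rw [a0, a3, b0, b3, a1, a1', b1, a2, a2', b2]
  · have n1 : ¬ (z.im = 1 / 4) := fun h => hy (by rw [h]; norm_num)
    have n2 : ¬ (z.im = -1 / 4) := fun h => hy (by rw [h]; norm_num)
    have n3 : ¬ (-1 / 4 ≤ z.im ∧ z.im ≤ 1 / 4) := fun h => hy (abs_le.2 ⟨by linarith, h.2⟩)
    simp only [n1, n2, n3, and_false, false_or, a0, a3, b0, b3]

theorem straighten_image_graphCurve {x₀ x₁ x₂ x₃ : ℝ} (h₀ : x₀ + 5 / 16 ≤ x₁)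
    (h₁ : x₁ + 5 / 8 ≤ x₂) (h₂ : x₂ + 5 / 16 ≤ x₃) :
    straighten x₁ x₂ 1 '' graphCurve x₀ x₃ (3 / 4) (armTop x₁ x₂) = lowerArm x₀ x₁ x₂ x₃ := by
  have : graphCurve x₀ x₃ (3 / 4) (armTop x₁ x₂) =
      straighten x₁ x₂ 1 ⁻¹' lowerArm x₀ x₁ x₂ x₃ := by
    ext z; exact (straighten_mem_lowerArm h₀ h₁ h₂ z).symm
  rw [this, Set.image_preimage_eq _ (straighten_surjective x₁ x₂ zero_le_one le_rfl)]

/-- The isotopy `h` serves only to provide a parametrization of `C` away from the centres. -/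
theorem isotopicIn_straighten {C C' : Set ℂ} {k : ℕ} (x₁ x₂ : ℝ)
    (h : IsotopicIn (holes k)ᶜ C C') :
    IsotopicIn (holes k)ᶜ C (straighten x₁ x₂ 1 '' C) := by
  obtain ⟨H, hc, hi, hX, h0, h1⟩ := h
  have hcont : Continuous fun q : ℝ × ℂ => straighten x₁ x₂ q.1 q.2 := by
    have h1 := (continuous_straightenRe x₁ x₂).comp
      (by fun_prop : Continuous fun q : ℝ × ℂ => (q.1, q.2.im, q.2.re))
    have : (fun q : ℝ × ℂ => straighten x₁ x₂ q.1 q.2) = fun q : ℝ × ℂ =>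
        ((straightenRe x₁ x₂ q.1 q.2.im q.2.re : ℝ) : ℂ) + (q.2.im : ℂ) * Complex.I := by
      funext q; apply Complex.ext <;> simp [straighten]
    rw [this]
    have h2 : Continuous fun q : ℝ × ℂ => straightenRe x₁ x₂ q.1 q.2.im q.2.re := h1
    fun_prop
  refine ⟨fun q => straighten x₁ x₂ (q.1 : ℝ) (H (0, q.2)), ?_, fun t θ θ' he => ?_, fun t θ hh => ?_, ?_, ?_⟩
  · exact hcont.comp (by fun_prop : Continuous fun q : unitInterval × Circle => ((q.1 : ℝ), H (0, q.2)))
  · exact hi 0 (straighten_injective x₁ x₂ t.2.1 t.2.2 he)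
  · obtain ⟨j, hj1, hj2, hj⟩ := hh
    have him : (H (0, θ)).im = 0 := by
      have := congrArg Complex.im hj
      simpa [straighten] using this
    simp only [straighten_of_im_eq_zero x₁ x₂ _ him] at hj
    exact hX 0 θ ⟨j, hj1, hj2, hj⟩
  · simp only [Set.Icc.coe_zero, straighten_zero]; exact h0
  · simp only [Set.Icc.coe_one]
    rw [← h0, ← Set.range_comp]; rfl

theorem isotopicIn_tw_conv_lowerArm {S β γ k : ℕ} (hS : 1 ≤ S) (hβ : 1 ≤ β) (hγ : 1 ≤ γ)
    (hk : S + β + γ ≤ k) :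
    IsotopicIn (holes k)ᶜ (tw S (β + γ) '' conv 0 (S + γ))
      (lowerArm (3 / 4) (S + 1 / 4) (S + β + 3 / 4) (S + β + γ + 1 / 4)) := by
  have hS' : (1 : ℝ) ≤ S := by exact_mod_cast hS
  have hβ' : (1 : ℝ) ≤ β := by exact_mod_cast hβ
  have hγ' : (1 : ℝ) ≤ γ := by exact_mod_cast hγ
  have h := isotopicIn_tw_conv_armTop hS hβ hγ hk
  have h2 := isotopicIn_straighten (S + 1 / 4) (S + β + 3 / 4) h.symm
  rw [straighten_image_graphCurve (by linarith) (by linarith) (by linarith)] at h2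
  exact h.trans h2

/-! ## Stretching horizontally -/

/-- The map of the plane that acts by `φ` on abscissas. -/
def stretch (φ : ℝ → ℝ) (z : ℂ) : ℂ := ⟨φ z.re, z.im⟩

theorem StrictMono.image_le_le {φ : ℝ → ℝ} (hφ : StrictMono φ) (hc : Continuous φ) {a b x : ℝ}
    (ha : φ a ≤ x) (hb : x ≤ φ b) : ∃ w, φ w = x ∧ a ≤ w ∧ w ≤ b := by
  have hab : a ≤ b := hφ.le_iff_le.1 (ha.trans hb)
  obtain ⟨w, hw, rfl⟩ := intermediate_value_Icc hab hc.continuousOn ⟨ha, hb⟩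
  exact ⟨w, rfl, hw.1, hw.2⟩

theorem stretch_image_hseg {φ : ℝ → ℝ} (hφ : StrictMono φ) (hc : Continuous φ) (a b y : ℝ) :
    stretch φ '' hseg a b y = hseg (φ a) (φ b) y := by
  ext z
  constructor
  · rintro ⟨w, ⟨h1, h2, h3⟩, rfl⟩
    exact ⟨hφ.monotone h1, hφ.monotone h2, h3⟩
  · rintro ⟨h1, h2, h3⟩
    obtain ⟨w, hw, hw1, hw2⟩ := hφ.image_le_le hc h1 h2
    exact ⟨⟨w, y⟩, ⟨hw1, hw2, rfl⟩, Complex.ext hw h3.symm⟩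

theorem stretch_image_vseg (φ : ℝ → ℝ) (x a b : ℝ) :
    stretch φ '' vseg x a b = vseg (φ x) a b := by
  ext z
  constructor
  · rintro ⟨w, ⟨h1, h2, h3⟩, rfl⟩
    exact ⟨congrArg φ h1, h2, h3⟩
  · rintro ⟨h1, h2, h3⟩
    exact ⟨⟨x, z.im⟩, ⟨rfl, h2, h3⟩, Complex.ext h1.symm rfl⟩

theorem stretch_image_lowerArm {φ : ℝ → ℝ} (hφ : StrictMono φ) (hc : Continuous φ)
    (x₀ x₁ x₂ x₃ : ℝ) :
    stretch φ '' lowerArm x₀ x₁ x₂ x₃ = lowerArm (φ x₀) (φ x₁) (φ x₂) (φ x₃) := by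
  simp only [lowerArm, Set.image_union, stretch_image_hseg hφ hc, stretch_image_vseg]

theorem stretch_mirrorImage (φ : ℝ → ℝ) (C : Set ℂ) :
    stretch φ '' mirrorImage C = mirrorImage (stretch φ '' C) := by
  simp only [mirrorImage, Set.image_image]
  rfl

theorem stretch_comp (φ ψ : ℝ → ℝ) (C : Set ℂ) :
    stretch φ '' (stretch ψ '' C) = stretch (φ ∘ ψ) '' C := by
  rw [Set.image_image]; rfl

theorem mirrorImage_conv (p s : ℕ) : mirrorImage (conv p s) = conv p s := by
  have h : ∀ z, z ∈ conv p s → starRingEnd ℂ z ∈ conv p s := fun z hz => by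
    rw [conv, mem_sphere_iff_norm] at hz ⊢
    rw [← Complex.conj_ofReal (cen p s), ← map_sub, Complex.norm_conj, hz]
  ext z
  constructor
  · rintro ⟨w, hw, rfl⟩; exact h w hw
  · intro hz; exact ⟨_, h z hz, by simp⟩

theorem outR_one : outR 1 = 1 / 4 := by norm_num [outR]

theorem range_circle_eq_conv (p s : ℕ) (hs : 1 ≤ s) :
    (Set.range fun θ : Circle => (⟨cen p s + outR s * (θ : ℂ).re, outR s * (θ : ℂ).im⟩ : ℂ)) =
      conv p s := by
  have hpos : 0 < outR s := by
    have h : (1 : ℝ) ≤ s := by exact_mod_cast hs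
    linarith [quarter_le_outR hs]
  have e : ∀ θ : Circle, (⟨cen p s + outR s * (θ : ℂ).re, outR s * (θ : ℂ).im⟩ : ℂ) =
      cen p s + outR s * θ := fun θ => by apply Complex.ext <;> simp
  ext z
  rw [conv, mem_sphere_iff_norm]
  constructor
  · rintro ⟨θ, rfl⟩
    simp only [e]
    rw [add_sub_cancel_left, norm_mul, Circle.norm_coe, mul_one, Complex.norm_real,
      Real.norm_of_nonneg hpos.le]
  · intro hz
    refine ⟨⟨(outR s : ℂ)⁻¹ * (z - cen p s), ?_⟩, ?_⟩
    · change _ ∈ Metric.sphere (0 : ℂ) 1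
      rw [mem_sphere_zero_iff_norm, norm_mul, hz, norm_inv, Complex.norm_real,
        Real.norm_of_nonneg hpos.le, inv_mul_cancel₀ hpos.ne']
    · refine (e _).trans ?_
      change (cen p s : ℂ) + outR s * ((outR s : ℂ)⁻¹ * (z - cen p s)) = z
      rw [mul_inv_cancel_left₀ (by exact_mod_cast hpos.ne')]; ring

/-- Both curves have an abscissa increasing in `θ.re` and an ordinate proportional to `θ.im`, and so
do their linear interpolations. These meet the axis only at `θ = ±1`, in the gaps just before and
just after the block. -/
theorem isotopicIn_stretch_conv {φ : ℝ → ℝ} (hφ : StrictMono φ) (hc : Continuous φ) {r N μ : ℕ}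
    (k : ℕ) (hμ : 1 ≤ μ) (h1 : φ (r + 3 / 4) = N + 3 / 4) (h2 : φ (r + 5 / 4) = N + μ + 1 / 4) :
    IsotopicIn (holes k)ᶜ (conv N μ) (stretch φ '' conv r 1) := by
  have hμ' : (1 : ℝ) ≤ μ := by exact_mod_cast hμ
  have hR := quarter_le_outR hμ
  have hR' := outR_lt μ
  have hcen : cen N μ = N + (μ + 1) / 2 := rfl
  have hcen1 : cen r 1 = r + 1 := by simp [cen]
  have hcoef : ∀ t : unitInterval, 0 < (t : ℝ) / 4 + (1 - t) * outR μ := fun t => by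
    have := t.2.1; have := t.2.2; nlinarith
  have hcont : Continuous fun q : unitInterval × Circle =>
      (((q.1 * φ (r + 1 + 1 / 4 * (q.2 : ℂ).re) + (1 - q.1) * (cen N μ + outR μ * (q.2 : ℂ).re) : ℝ) : ℂ)
        + ((((q.1 : ℝ) / 4 + (1 - q.1) * outR μ) * (q.2 : ℂ).im : ℝ) : ℂ) * Complex.I) := by
    have hre : Continuous fun q : unitInterval × Circle => (q.2 : ℂ).re :=
      Complex.continuous_re.comp (continuous_subtype_val.comp continuous_snd)
    have him : Continuous fun q : unitInterval × Circle => (q.2 : ℂ).im :=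
      Complex.continuous_im.comp (continuous_subtype_val.comp continuous_snd)
    fun_prop
  refine ⟨fun q => ⟨q.1 * φ (r + 1 + 1 / 4 * (q.2 : ℂ).re) +
    (1 - q.1) * (cen N μ + outR μ * (q.2 : ℂ).re), ((q.1 : ℝ) / 4 + (1 - q.1) * outR μ) * (q.2 : ℂ).im⟩,
    ?_, fun t θ θ' he => ?_, fun t θ => ?_, ?_, ?_⟩
  · convert hcont using 2 with q
    apply Complex.ext <;> simp
  · have ht0 := t.2.1
    have ht1 := t.2.2
    have hmono : StrictMono fun x : ℝ =>
        t * φ (r + 1 + 1 / 4 * x) + (1 - t) * (cen N μ + outR μ * x) := fun x y hxy => by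
      have e1 : φ (r + 1 + 1 / 4 * x) < φ (r + 1 + 1 / 4 * y) := hφ (by linarith)
      have e2 : cen N μ + outR μ * x < cen N μ + outR μ * y := by nlinarith
      have := combination_lt (t := 1 - t) (by linarith) (by linarith) e1 e2
      simpa only [sub_sub_cancel] using this
    have hre := congrArg Complex.re he
    have him := congrArg Complex.im he
    exact Subtype.ext (Complex.ext (hmono.injective hre) (mul_left_cancel₀ (hcoef t).ne' him))
  · rintro ⟨j, hj1, hj2, hj⟩
    have ht0 := t.2.1
    have ht1 := t.2.2
    have hre : t * φ (r + 1 + 1 / 4 * (θ : ℂ).re) + (1 - t) * (cen N μ + outR μ * (θ : ℂ).re) = j :=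
      (congrArg Complex.re hj).trans (Complex.natCast_re j)
    have him : ((t : ℝ) / 4 + (1 - t) * outR μ) * (θ : ℂ).im = 0 :=
      (congrArg Complex.im hj).trans (Complex.natCast_im j)
    have him' := (mul_eq_zero.1 him).resolve_left (hcoef t).ne'
    have hsq : (θ : ℂ).re ^ 2 = 1 := by
      have := Circle.normSq_coe θ
      rw [Complex.normSq_apply, him'] at this
      linarith
    have hint : ∀ a b : ℕ, (a : ℝ) < b → (b : ℝ) < a + 1 → False := fun a b h h' => by
      have h1 : a < b := by exact_mod_cast h
      have h2 : b < a + 1 := by exact_mod_cast h'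
      omega
    rcases eq_or_eq_neg_of_sq_eq_sq _ 1 (hsq.trans (one_pow 2).symm) with h | h
    · rw [h, show (r : ℝ) + 1 + 1 / 4 * 1 = r + 5 / 4 by ring, h2, hcen] at hre
      apply hint (N + μ) j <;> push_cast <;> nlinarith
    · rw [h, show (r : ℝ) + 1 + 1 / 4 * -1 = r + 3 / 4 by ring, h1, hcen] at hre
      apply hint N j <;> nlinarith
  · rw [← range_circle_eq_conv N μ hμ]
    simp
  · rw [← range_circle_eq_conv r 1 le_rfl, ← Set.range_comp]
    simp only [Set.Icc.coe_one, one_mul, sub_self, zero_mul, add_zero, outR_one, hcen1]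
    congr 1

/-! ## From the complement of the centres of the holes to the disk with holes -/

/-- A radial map about `c`. -/
noncomputable def radial (c : ℂ) (g : ℝ → ℝ) (z : ℂ) : ℂ := c + (g ‖z - c‖ : ℂ) * (z - c)

theorem norm_radial_sub {c : ℂ} {g : ℝ → ℝ} {z : ℂ} (hg : 0 ≤ g ‖z - c‖) :
    ‖radial c g z - c‖ = g ‖z - c‖ * ‖z - c‖ := by
  rw [radial, add_sub_cancel_left, norm_mul, Complex.norm_real, Real.norm_of_nonneg hg]

theorem radial_eq_self {c : ℂ} {g : ℝ → ℝ} {z : ℂ} (hg : g ‖z - c‖ = 1) : radial c g z = z := by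
  rw [radial, hg]; simp

theorem radial_injOn {c : ℂ} {g : ℝ → ℝ} {X : Set ℂ} {s : Set ℝ} (hX : ∀ z ∈ X, ‖z - c‖ ∈ s)
    (hg : ∀ x ∈ s, 0 < g x) (hm : StrictMonoOn (fun x => g x * x) s) : Set.InjOn (radial c g) X := by
  intro z hz w hw h
  have h1 := norm_radial_sub (hg _ (hX z hz)).le
  have h2 := norm_radial_sub (hg _ (hX w hw)).le
  rw [h, h2] at h1
  have h3 := hm.injOn (hX w hw) (hX z hz) h1
  rw [radial, radial, h3] at h
  have hne : (g ‖z - c‖ : ℂ) ≠ 0 := by exact_mod_cast (hg _ (hX z hz)).ne'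
  have := mul_left_cancel₀ hne (add_left_cancel h)
  linear_combination this

/-- The factor of the radial map that pushes the punctured disk of radius `5h/4` off the disk of
radius `h`. -/
noncomputable def pushFactor (h x : ℝ) : ℝ := 1 + max 0 (h - 4 / 5 * x) / x

theorem pushFactor_pos (h : ℝ) {x : ℝ} (hx : 0 < x) : 0 < pushFactor h x := by
  have : 0 ≤ max 0 (h - 4 / 5 * x) / x := div_nonneg (le_max_left _ _) hx.le
  unfold pushFactor; linarith

/-- The two branches agree at `x = 5 * h / 4`, and the second stays above `h`. This is where the
factor `5 / 4` of the safe region comes from. -/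
theorem pushFactor_mul (h : ℝ) {x : ℝ} (hx : 0 < x) :
    pushFactor h x * x = max x (h + x / 5) := by
  rw [pushFactor, add_mul, one_mul, div_mul_cancel₀ _ hx.ne', ← max_add_add_left]
  congr 1 <;> ring

theorem pushFactor_of_ge {h x : ℝ} (hx : 5 / 4 * h ≤ x) : pushFactor h x = 1 := by
  rw [pushFactor, max_eq_left (by linarith)]; simp

theorem strictMonoOn_pushFactor (h : ℝ) : StrictMonoOn (fun x => pushFactor h x * x) (Set.Ioi 0) := by
  intro x hx y hy hxy
  simp only [pushFactor_mul h hx, pushFactor_mul h hy]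
  exact max_lt_max hxy (by linarith)

/-- The factor of the radial map that squashes the plane into the open disk of radius `2R`, fixing the
disk of radius `R`. -/
noncomputable def squashFactor (R x : ℝ) : ℝ := R * (2 * max x R - R) / (max x R) ^ 2

theorem squashFactor_of_le {R x : ℝ} (hR : 0 < R) (hx : x ≤ R) : squashFactor R x = 1 := by
  rw [squashFactor, max_eq_right hx]; field_simp; ring

theorem squashFactor_mul {R x : ℝ} (hR : 0 < R) (hx : R ≤ x) :
    squashFactor R x * x = 2 * R - R ^ 2 / x := by
  have : 0 < x := hR.trans_le hx
  rw [squashFactor, max_eq_left hx]; field_simp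

theorem squashFactor_pos {R : ℝ} (hR : 0 < R) (x : ℝ) : 0 < squashFactor R x := by
  have := le_max_right x R
  unfold squashFactor
  apply div_pos (mul_pos hR (by linarith)) (pow_pos (by linarith) 2)

theorem strictMono_squashFactor {R : ℝ} (hR : 0 < R) : StrictMono fun x => squashFactor R x * x := by
  intro x y hxy
  simp only
  rcases le_total y R with hy | hy
  · rw [squashFactor_of_le hR hy, squashFactor_of_le hR (by linarith)]; linarith
  have hy0 : 0 < y := hR.trans_le hy
  rw [squashFactor_mul hR hy]
  rcases le_total x R with hx | hx
  · rw [squashFactor_of_le hR hx]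
    have : R ^ 2 / y ≤ R := by rw [div_le_iff₀ hy0]; nlinarith
    rcases hy.eq_or_lt with rfl | hy'
    · linarith
    · have : R ^ 2 / y < R := by rw [div_lt_iff₀ hy0]; nlinarith
      linarith
  · rw [squashFactor_mul hR hx]
    have : R ^ 2 / y < R ^ 2 / x := div_lt_div_of_pos_left (by positivity) (by linarith) hxy
    linarith

/-- The plane without the holes `1, …, n` and the centres of the other holes up to `k`. -/
def partialRegion (k n : ℕ) : Set ℂ :=
  {z | ∀ j : ℕ, 1 ≤ j → j ≤ k → 0 < ‖z - j‖ ∧ (j ≤ n → holeRadius k ≤ ‖z - j‖)}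

theorem one_le_norm_natCast_sub {i j : ℕ} (h : i ≠ j) : 1 ≤ ‖(i : ℂ) - j‖ := by
  have : (i : ℂ) - j = (((i : ℤ) - j : ℤ) : ℂ) := by push_cast; ring
  rw [this, Complex.norm_intCast]
  have : (i : ℤ) - j ≠ 0 := by omega
  exact_mod_cast Int.one_le_abs this

/-- The punctures are opened into holes one at a time by radial maps that do not move the end
curves. -/
theorem isotopicIn_partialRegion {k : ℕ} {C C' : Set ℂ} (hC : C ⊆ safeRegion k)
    (hC' : C' ⊆ safeRegion k) (h : IsotopicIn (holes k)ᶜ C C') :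
    ∀ n ≤ k, IsotopicIn (partialRegion k n) C C' := by
  have hp := holeRadius_pos k
  intro n
  induction n with
  | zero =>
    intro _
    refine h.mono fun z hz j hj1 hj2 => ⟨?_, fun h0 => by omega⟩
    rw [norm_pos_iff, sub_ne_zero]
    rintro rfl
    exact hz ⟨j, hj1, hj2, rfl⟩
  | succ n ih =>
    intro hn
    have hq := holeRadius_le_of_pos (show 1 ≤ k by omega)
    set f := radial ((n + 1 : ℕ) : ℂ) (pushFactor (holeRadius k)) with hf
    have hfix : ∀ D ⊆ safeRegion k, f '' D = D := fun D hD => Set.image_eq_self_of_forall fun z hz =>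
      radial_eq_self (pushFactor_of_ge ((hD hz).1 (n + 1) (by omega) hn))
    have := (ih (by omega)).image (f := f) (Y := partialRegion k (n + 1)) ?_ ?_ ?_
    · rwa [hfix C hC, hfix C' hC'] at this
    · have hne : ∀ z ∈ partialRegion k n, ‖z - ((n + 1 : ℕ) : ℂ)‖ ≠ 0 := fun z hz =>
        (hz (n + 1) (by omega) hn).1.ne'
      have h1 : ContinuousOn (fun z : ℂ => pushFactor (holeRadius k) ‖z - ((n + 1 : ℕ) : ℂ)‖)
          (partialRegion k n) := by
        unfold pushFactor
        refine continuousOn_const.add (ContinuousOn.div ?_ ?_ hne)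
        · exact Continuous.continuousOn (by fun_prop)
        · exact Continuous.continuousOn (by fun_prop)
      have h2 := Complex.continuous_ofReal.comp_continuousOn h1
      exact continuousOn_const.add (h2.mul (Continuous.continuousOn (by fun_prop)))
    · exact radial_injOn (s := Set.Ioi 0) (fun z hz => (hz (n + 1) (by omega) hn).1)
        (fun x hx => pushFactor_pos _ hx) (strictMonoOn_pushFactor _)
    · intro z hz j hj1 hj2
      have hpos := (hz (n + 1) (by omega) hn).1
      have hnorm := norm_radial_sub (pushFactor_pos (holeRadius k) hpos).le
      rw [pushFactor_mul _ hpos] at hnorm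
      rcases eq_or_ne j (n + 1) with rfl | hj
      · have : holeRadius k ≤ ‖f z - ((n + 1 : ℕ) : ℂ)‖ := by
          rw [hnorm]; exact le_max_of_le_right (by linarith)
        exact ⟨by linarith, fun _ => this⟩
      · by_cases hz' : 5 / 4 * holeRadius k ≤ ‖z - ((n + 1 : ℕ) : ℂ)‖
        · rw [hf, radial_eq_self (pushFactor_of_ge hz')]
          exact ⟨(hz j hj1 hj2).1, fun h => (hz j hj1 hj2).2 (by omega)⟩
        · push Not at hz'
          -- A point that moves stays close to the hole `n + 1`, hence far from the holes already
          -- opened.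
          have h1 : ‖f z - ((n + 1 : ℕ) : ℂ)‖ ≤ 5 / 4 * holeRadius k := by
            rw [hnorm]; exact max_le hz'.le (by linarith)
          have h2 := one_le_norm_natCast_sub hj
          have h3 := norm_sub_le (f z - ((n + 1 : ℕ) : ℂ)) (f z - j)
          rw [sub_sub_sub_cancel_left] at h3
          have : holeRadius k ≤ ‖f z - j‖ := by linarith
          exact ⟨by linarith, fun _ => this⟩

/-- With the holes open, an isotopy may still leave the outer disk. Squashing the plane into it
fixes the disk of half the radius, which contains the end curves and all the holes; points from
outside that disk remain outside. -/
theorem isotopicIn_diskWithHoles {k : ℕ} {C C' : Set ℂ} (hC : C ⊆ safeRegion k)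
    (hC' : C' ⊆ safeRegion k) (h : IsotopicIn (holes k)ᶜ C C') :
    IsotopicIn (diskWithHoles k) C C' := by
  set R : ℝ := ((k : ℝ) + 1) / 2 with hRdef
  have hR : 0 < R := by positivity
  set c : ℂ := ((k : ℂ) + 1) / 2 with hc
  set f := radial c (squashFactor R) with hf
  have hfix : ∀ D ⊆ safeRegion k, f '' D = D := fun D hD => Set.image_eq_self_of_forall fun z hz =>
    radial_eq_self (squashFactor_of_le hR (hD hz).2)
  have := (isotopicIn_partialRegion hC hC' h k le_rfl).image (f := f) (Y := diskWithHoles k) ?_ ?_ ?_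
  · rwa [hfix C hC, hfix C' hC'] at this
  · apply Continuous.continuousOn
    have : Continuous (squashFactor R) := by
      unfold squashFactor
      refine Continuous.div (by fun_prop) (by fun_prop) fun x => ?_
      have := le_max_right x R
      exact pow_ne_zero 2 (by linarith)
    rw [hf]; unfold radial; fun_prop
  · exact radial_injOn (s := Set.univ) (fun _ _ => trivial) (fun x _ => squashFactor_pos hR x)
      ((strictMono_squashFactor hR).strictMonoOn _)
  · intro z hz
    have hnorm := norm_radial_sub (squashFactor_pos hR ‖z - c‖).le
    change ‖f z - c‖ = _ at hnorm
    rcases le_total ‖z - c‖ R with hle | hge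
    · have e : f z = z := radial_eq_self (squashFactor_of_le hR hle)
      rw [e]
      refine ⟨?_, ?_⟩
      · rw [Metric.mem_closedBall, dist_eq_norm]; linarith
      · simp only [Set.mem_iUnion, Metric.mem_ball, dist_eq_norm, Finset.mem_Icc, not_exists, not_lt]
        exact fun j hj => (hz j hj.1 hj.2).2 hj.2
    · have h0 : 0 < ‖z - c‖ := hR.trans_le hge
      rw [squashFactor_mul hR hge] at hnorm
      have h1 : R ^ 2 / ‖z - c‖ ≤ R := by rw [div_le_iff₀ h0]; nlinarith
      have h2 : 0 < R ^ 2 / ‖z - c‖ := by positivity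
      refine ⟨?_, ?_⟩
      · rw [Metric.mem_closedBall, dist_eq_norm, hnorm]; linarith
      · simp only [Set.mem_iUnion, Metric.mem_ball, dist_eq_norm, Finset.mem_Icc, not_exists, not_lt]
        intro j hj
        have h3 : ‖(j : ℂ) - c‖ ≤ R - 1 := by
          have a1 : (1 : ℝ) ≤ j := by exact_mod_cast hj.1
          have a2 : (j : ℝ) ≤ k := by exact_mod_cast hj.2
          have : (j : ℂ) - c = ((j - R : ℝ) : ℂ) := by rw [hc, hRdef]; push_cast; ring
          rw [this, Complex.norm_real, Real.norm_eq_abs, abs_le]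
          constructor <;> linarith
        have h4 := norm_add_le (f z - j) (j - c)
        rw [sub_add_sub_cancel] at h4
        linarith [holeRadius_le k]

/-! ## The position of the curves -/

theorem mem_safeRegion_iff {k : ℕ} {z : ℂ} : z ∈ safeRegion k ↔
    (∀ j : ℕ, 1 ≤ j → j ≤ k → (5 / 4 * holeRadius k) ^ 2 ≤ (z.re - j) ^ 2 + z.im ^ 2) ∧
      (z.re - ((k : ℝ) + 1) / 2) ^ 2 + z.im ^ 2 ≤ (((k : ℝ) + 1) / 2) ^ 2 := by
  have e : ∀ (x : ℝ), ‖z - x‖ ^ 2 = (z.re - x) ^ 2 + z.im ^ 2 := fun x => by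
    rw [← Complex.normSq_eq_norm_sq, Complex.normSq_apply]; simp; ring
  have e1 : ((k : ℂ) + 1) / 2 = ((((k : ℝ) + 1) / 2 : ℝ) : ℂ) := by push_cast; ring
  have hp := holeRadius_pos k
  unfold safeRegion
  rw [Set.mem_ofPred_eq, e1, ← e, sq_le_sq₀ (norm_nonneg _) (by positivity)]
  refine and_congr_left fun _ => forall_congr' fun j => forall_congr' fun _ => forall_congr' fun _ => ?_
  rw [← e, sq_le_sq₀ (by positivity) (norm_nonneg _), Complex.ofReal_natCast]

theorem mirrorImage_subset_safeRegion {k : ℕ} {C : Set ℂ} (h : C ⊆ safeRegion k) :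
    mirrorImage C ⊆ safeRegion k := by
  rintro _ ⟨z, hz, rfl⟩
  have := h hz
  rw [mem_safeRegion_iff] at this ⊢
  simpa using this

/-- The part of the safe region that stays to the left of the next hole to be added. -/
def leftRegion (k : ℕ) : Set ℂ := {z ∈ safeRegion k | z.re ≤ k + 1 / 2}

theorem leftRegion_subset_succ {k : ℕ} (hk : 1 ≤ k) : leftRegion k ⊆ leftRegion (k + 1) := by
  rintro z ⟨hz, hre⟩
  have hp := holeRadius_pos k
  have hle := holeRadius_le_of_pos hk
  rw [mem_safeRegion_iff] at hz
  refine ⟨mem_safeRegion_iff.2 ⟨fun j h1 h2 => ?_, ?_⟩, by push_cast; linarith⟩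
  · rw [holeRadius_succ]
    rcases Nat.lt_or_ge k j with h | h
    · have h' : (k : ℝ) + 1 ≤ j := by exact_mod_cast h
      nlinarith [sq_nonneg z.im]
    · refine le_trans ?_ (hz.1 j h1 h)
      nlinarith
  · push_cast
    nlinarith [hz.2]

theorem conv_subset_leftRegion {p s k : ℕ} (hs : 1 ≤ s) (h : p + s ≤ k) :
    conv p s ⊆ leftRegion k := by
  intro z hz
  refine ⟨conv_subset_safeRegion hs h hz, ?_⟩
  rw [conv, mem_sphere_iff_norm] at hz
  have h1 := Complex.re_le_norm (z - cen p s)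
  have h2 := outR_lt s
  have h3 : (p : ℝ) + s ≤ k := by exact_mod_cast h
  rw [hz, Complex.sub_re, Complex.ofReal_re, cen] at h1
  linarith

/-! ### Splitting a hole, arms, and the curves α within the safe region -/

theorem splitHole_re (r p : ℕ) (z : ℂ) : (splitHole r p z).re =
    z.re + max 0 (min 1 ((z.re - p + holeRadius (r + 1)) / (2 * holeRadius (r + 1)))) := by
  rw [splitHole, Complex.add_re, Complex.ofReal_re]

theorem splitHole_im (r p : ℕ) (z : ℂ) : (splitHole r p z).im = z.im := by
  rw [splitHole, Complex.add_im, Complex.ofReal_im, add_zero]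

/-- The stretched strip is half as wide as the old hole, so a safe point in it has a height larger
than the new safety distance. Outside the strip the map is the identity or a unit translation. The
shift, between `0` and `1`, differs by at most `1 / 2` from that of the centre of the disk, and the
safe radius grows by `1 / 2`. -/
theorem splitHole_mapsTo_leftRegion {r p : ℕ} (h1 : 1 ≤ p) (hp : p ≤ r) :
    Set.MapsTo (splitHole r p) (leftRegion r) (leftRegion (r + 1)) := by
  rintro z ⟨hz, hre⟩
  have hpos := holeRadius_pos (r + 1)
  have hle := holeRadius_le_of_pos (show 1 ≤ r + 1 by omega)
  rw [mem_safeRegion_iff] at hz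
  have hh : holeRadius r = 2 * holeRadius (r + 1) := by rw [holeRadius_succ]; ring
  rw [hh] at hz
  set η := holeRadius (r + 1)
  have c0 : z.re ≤ p - η → (splitHole r p z).re = z.re := fun h => by
    rw [splitHole_re, max_eq_left, add_zero]
    exact (min_le_right _ _).trans (div_nonpos_of_nonpos_of_nonneg (by linarith) (by linarith))
  have c1 : p + η ≤ z.re → (splitHole r p z).re = z.re + 1 := fun h => by
    rw [splitHole_re, min_eq_left, max_eq_right zero_le_one]
    rw [le_div_iff₀ (by linarith)]; linarith
  have d0 : z.re ≤ (splitHole r p z).re := by rw [splitHole_re]; linarith [le_max_left 0 (min 1 ((z.re - p + η) / (2 * η)))]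
  have d1 : (splitHole r p z).re ≤ z.re + 1 := by
    rw [splitHole_re]
    linarith [max_le zero_le_one (min_le_left 1 ((z.re - p + η) / (2 * η)))]
  have him := splitHole_im r p z
  set x' := (splitHole r p z).re with hx'
  refine ⟨mem_safeRegion_iff.2 ⟨fun j hj1 hj2 => ?_, ?_⟩, by push_cast; linarith⟩
  · rw [him, ← hx']
    have far : ∀ d : ℝ, 5 / 4 * η ≤ |d| → (5 / 4 * η) ^ 2 ≤ d ^ 2 + z.im ^ 2 := fun d hd => by
      have := sq_le_sq' (by linarith) hd
      rw [sq_abs] at this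
      linarith [sq_nonneg z.im]
    rcases le_or_gt z.re (p - η) with h | h
    · rw [c0 h]
      rcases Nat.lt_or_ge p j with h' | h'
      · have h'' : (p : ℝ) + 1 ≤ j := by exact_mod_cast h'
        exact far _ (by rw [abs_of_neg (by linarith)]; linarith)
      · have := hz.1 j hj1 (by omega)
        nlinarith
    rcases le_or_gt (p + η) z.re with h2 | h2
    · rw [c1 h2]
      rcases Nat.lt_or_ge p j with h' | h'
      · obtain ⟨i, rfl⟩ : ∃ i, j = i + 1 := ⟨j - 1, by omega⟩
        have := hz.1 i (by omega) (by omega)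
        push_cast
        rw [add_sub_add_right_eq_sub]
        nlinarith
      · have h'' : (j : ℝ) ≤ p := by exact_mod_cast h'
        exact far _ (by rw [abs_of_pos (by linarith)]; linarith)
    -- With `η` the new hole radius, the old safety distance is `5 * η / 2` and the horizontal
    -- distance to the hole is at most `η`, so the height alone exceeds `5 * η / 4`.
    · have := hz.1 p h1 hp
      have h3 : (z.re - p) ^ 2 ≤ η ^ 2 := sq_le_sq' (by linarith) (by linarith)
      nlinarith [sq_nonneg (x' - j)]
  · rw [him, ← hx']
    have hz2 := hz.2
    set w := splitHole r p z
    have e : ∀ (a x y : ℝ), (x - a) ^ 2 + y ^ 2 = ‖(⟨x, y⟩ : ℂ) - a‖ ^ 2 := fun a x y => by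
      rw [← Complex.normSq_eq_norm_sq, Complex.normSq_apply]; simp; ring
    rw [e, sq_le_sq₀ (norm_nonneg _) (by positivity)] at hz2 ⊢
    have e2 : (⟨x', z.im⟩ : ℂ) - ((((r + 1 : ℕ) : ℝ) + 1) / 2 : ℝ) =
        ((⟨z.re, z.im⟩ : ℂ) - ((((r : ℝ) + 1) / 2 : ℝ) : ℂ)) + ((x' - z.re - 1 / 2 : ℝ) : ℂ) := by
      apply Complex.ext
      · simp; ring
      · simp
    rw [e2]
    refine (norm_add_le _ _).trans ?_
    rw [Complex.norm_real, Real.norm_eq_abs]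
    have : |x' - z.re - 1 / 2| ≤ 1 / 2 := abs_le.2 ⟨by linarith, by linarith⟩
    have e3 : (((r + 1 : ℕ) : ℝ) + 1) / 2 = ((r : ℝ) + 1) / 2 + 1 / 2 := by push_cast; ring
    rw [e3]
    exact add_le_add hz2 this

theorem lowerArm_bounds {x₀ x₁ x₂ x₃ : ℝ} (h₀ : x₀ ≤ x₁) (h₁ : x₁ ≤ x₂) (h₂ : x₂ ≤ x₃) {z : ℂ}
    (hz : z ∈ lowerArm x₀ x₁ x₂ x₃) : x₀ ≤ z.re ∧ z.re ≤ x₃ ∧ -3 / 4 ≤ z.im ∧ z.im ≤ 1 / 4 ∧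
      (|z.im| < 1 / 4 → z.re = x₀ ∨ z.re = x₁ ∨ z.re = x₂ ∨ z.re = x₃) := by
  simp only [lowerArm, Set.mem_union, hseg, vseg, Set.mem_ofPred_eq, or_assoc] at hz
  rcases hz with ⟨a, b, c⟩ | ⟨a, b, c⟩ | ⟨a, b, c⟩ | ⟨a, b, c⟩ | ⟨a, b, c⟩ | ⟨a, b, c⟩ | ⟨a, b, c⟩ |
    ⟨a, b, c⟩
  · exact ⟨by linarith, by linarith, by linarith, by linarith, fun _ => .inl a⟩
  · exact ⟨by linarith, by linarith, by linarith, by linarith, fun h => by rw [c] at h; norm_num at h⟩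
  · exact ⟨by linarith, by linarith, by linarith, by linarith, fun _ => .inr (.inl a)⟩
  · exact ⟨by linarith, by linarith, by linarith, by linarith, fun h => by rw [c] at h; norm_num at h⟩
  · exact ⟨by linarith, by linarith, by linarith, by linarith, fun _ => .inr (.inr (.inl a))⟩
  · exact ⟨by linarith, by linarith, by linarith, by linarith, fun h => by rw [c] at h; norm_num at h⟩
  · exact ⟨by linarith, by linarith, by linarith, by linarith, fun _ => .inr (.inr (.inr a))⟩
  · exact ⟨by linarith, by linarith, by linarith, by linarith, fun h => by rw [c] at h; norm_num at h⟩

theorem armCurve_subset_leftRegion {i k : ℕ} (hi : 1 ≤ i) (hk : i + 2 ≤ k) :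
    armCurve i ⊆ leftRegion k := by
  have hi' : (1 : ℝ) ≤ i := by exact_mod_cast hi
  have hk' : (i : ℝ) + 2 ≤ k := by exact_mod_cast hk
  have hle := holeRadius_le_of_pos (show 1 ≤ k by omega)
  have hpos := holeRadius_pos k
  intro z hz
  have hz' : starRingEnd ℂ z ∈ lowerArm (3 / 4) (i + 1 / 4) (i + 7 / 4) (i + 9 / 4) := by
    rw [← mirrorImage_armCurve hi]; exact ⟨z, hz, rfl⟩
  obtain ⟨h1, h2, h3, h4, h5⟩ := lowerArm_bounds (by linarith) (by linarith) (by linarith) hz'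
  simp only [Complex.conj_re, Complex.conj_im, abs_neg] at h1 h2 h3 h4 h5
  refine ⟨mem_safeRegion_iff.2 ⟨fun j hj1 hj2 => ?_, ?_⟩, by linarith⟩
  · have hq : (5 / 4 * holeRadius k) ^ 2 ≤ (1 / 4) ^ 2 := by nlinarith
    by_cases him : |z.im| < 1 / 4
    · have : ∀ x : ℝ, 1 / 4 ≤ |x| → (1 / 4) ^ 2 ≤ x ^ 2 + z.im ^ 2 := fun x hx => by
        have := sq_le_sq' (by linarith) hx
        rw [sq_abs] at this
        linarith [sq_nonneg z.im]
      refine hq.trans (this _ ?_)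
      have hc : ∀ a b : ℕ, a ≤ b ∨ b + 1 ≤ a := fun a b => by omega
      rcases h5 him with h | h | h | h <;> rw [h]
      · have : (1 : ℝ) ≤ j := by exact_mod_cast hj1
        rw [abs_of_neg (by linarith)]; linarith
      all_goals
        rcases hc j i with h' | h'
        · have : (j : ℝ) ≤ i := by exact_mod_cast h'
          rw [abs_of_pos (by linarith)]; linarith
        rcases hc j (i + 1) with h'' | h''
        · have a1 : (j : ℝ) ≤ i + 1 := by exact_mod_cast h''
          have a2 : (i : ℝ) + 1 ≤ j := by exact_mod_cast h'
          first
          | rw [abs_of_pos (by linarith)]; linarith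
          | rw [abs_of_neg (by linarith)]; linarith
        rcases hc j (i + 2) with h3' | h3'
        · have a1 : (j : ℝ) ≤ i + 2 := by exact_mod_cast h3'
          have a2 : (i : ℝ) + 1 + 1 ≤ j := by exact_mod_cast h''
          first
          | rw [abs_of_pos (by linarith)]; linarith
          | rw [abs_of_neg (by linarith)]; linarith
        · have a2 : (i : ℝ) + 2 + 1 ≤ j := by exact_mod_cast h3'
          rw [abs_of_neg (by linarith)]; linarith
    · push Not at him
      have := sq_le_sq' (by linarith) him
      rw [sq_abs] at this
      linarith [sq_nonneg (z.re - j)]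
  · have a : z.im ^ 2 ≤ (3 / 4) ^ 2 := sq_le_sq' (by linarith) (by linarith)
    have b : (z.re - ((k : ℝ) + 1) / 2) ^ 2 ≤ (((k : ℝ) + 1) / 2 - 3 / 4) ^ 2 :=
      sq_le_sq' (by linarith) (by linarith)
    nlinarith

theorem length_interiorBlowupTuple {n : List ℕ} {i : ℕ} (h1 : 1 ≤ i) (h : i < n.length) :
    (interiorBlowupTuple n i).length = n.length + 1 := by
  simp only [interiorBlowupTuple, List.length_append, List.length_take, List.length_drop,
    List.length_cons, List.length_nil]
  omega

theorem length_exteriorBlowupTuple {n : List ℕ} (h : 1 ≤ n.length) :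
    (exteriorBlowupTuple n).length = n.length + 1 := by
  simp only [exteriorBlowupTuple, List.length_append, List.length_dropLast,
    List.length_cons, List.length_nil]
  omega

theorem BlowupSequence.alphaCurve_subset {n : List ℕ} (σ : BlowupSequence n) :
    ∀ t, 1 ≤ t → t < n.length → σ.alphaCurve t ⊆ leftRegion n.length := by
  induction σ with
  | zero => intro t h1 h2; simp at h2; omega
  | initial =>
    intro t _ _
    exact (convexCurve_eq 1 1).subset.trans (conv_subset_leftRegion (le_refl 1) (by simp))
  | @interior n σ i h1 h ih =>
    intro t ht1 ht2
    rw [length_interiorBlowupTuple h1 h] at ht2 ⊢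
    simp only [alphaCurve]
    split_ifs with ht
    · exact armCurve_subset_leftRegion h1 (by omega)
    · rintro _ ⟨z, hz, rfl⟩
      exact splitHole_mapsTo_leftRegion (by omega) (by omega) (ih t ht1 (by omega) hz)
  | @exterior n σ h ih =>
    intro t ht1 ht2
    rw [length_exteriorBlowupTuple (by omega)] at ht2 ⊢
    simp only [alphaCurve]
    split_ifs with ht
    · exact (convexCurve_eq n.length 1).subset.trans (conv_subset_leftRegion le_rfl le_rfl)
    · exact (ih t ht1 (by omega)).trans (leftRegion_subset_succ (by omega))

/-! ## Weights and reversals of lists of wires -/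

/-- The total weight of a list of wires. -/
def wt (μ : ℕ → ℕ) (L : List ℕ) : ℕ := (L.map μ).sum

@[simp] theorem wt_nil (μ : ℕ → ℕ) : wt μ [] = 0 := rfl

@[simp] theorem wt_cons (μ : ℕ → ℕ) (v : ℕ) (L : List ℕ) : wt μ (v :: L) = μ v + wt μ L := by
  simp [wt]

@[simp] theorem wt_append (μ : ℕ → ℕ) (L M : List ℕ) : wt μ (L ++ M) = wt μ L + wt μ M := by
  simp [wt]

theorem wt_perm (μ : ℕ → ℕ) {L M : List ℕ} (h : L.Perm M) : wt μ L = wt μ M :=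
  (h.map μ).sum_nat

@[simp] theorem wt_reverse (μ : ℕ → ℕ) (L : List ℕ) : wt μ L.reverse = wt μ L :=
  wt_perm μ L.reverse_perm

theorem wt_congr {μ ν : ℕ → ℕ} {L : List ℕ} (h : ∀ v ∈ L, μ v = ν v) : wt μ L = wt ν L := by
  rw [wt, List.map_congr_left h, wt]

theorem one_le_wt {μ : ℕ → ℕ} (hμ : ∀ v, 1 ≤ μ v) {L : List ℕ} (h : L ≠ []) : 1 ≤ wt μ L := by
  obtain ⟨v, M, rfl⟩ := List.exists_cons_of_ne_nil h
  have := hμ v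
  rw [wt_cons]; omega

theorem wt_one (L : List ℕ) : wt (fun _ => 1) L = L.length := by simp [wt]

/-- The list `L`, reversed if `e` is odd. -/
def flipBy (e : ℤ) (L : List ℕ) : List ℕ := if Even e then L else L.reverse

theorem flipBy_zero (L : List ℕ) : flipBy 0 L = L := by simp [flipBy]

theorem flipBy_succ (e : ℤ) (L : List ℕ) : flipBy (e + 1) L = (flipBy e L).reverse := by
  by_cases h : Even e <;> simp [flipBy, h]

theorem flipBy_pred (e : ℤ) (L : List ℕ) : flipBy (e - 1) L = (flipBy e L).reverse := by
  have := flipBy_succ (e - 1) L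
  rw [sub_add_cancel] at this
  rw [this, List.reverse_reverse]

theorem flipBy_perm (e : ℤ) (L : List ℕ) : (flipBy e L).Perm L := by
  unfold flipBy; split_ifs
  · exact .refl _
  · exact L.reverse_perm

@[simp] theorem wt_flipBy (μ : ℕ → ℕ) (e : ℤ) (L : List ℕ) : wt μ (flipBy e L) = wt μ L :=
  wt_perm μ (flipBy_perm e L)

/-! ## Homeomorphisms supported on the first holes -/

theorem homeo_mul_image (f g : ℂ ≃ₜ ℂ) (C : Set ℂ) : (f * g) '' C = f '' (g '' C) :=
  Set.image_comp f g C

theorem homeo_image_inv {f : ℂ ≃ₜ ℂ} {C : Set ℂ} (h : f '' C = C) : (f⁻¹ : ℂ ≃ₜ ℂ) '' C = C := by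
  conv_lhs => rw [← h]
  rw [← homeo_mul_image, inv_mul_cancel]
  exact Set.image_id C

/-- The group generated by the half-twists along blocks among the first `N` holes. -/
noncomputable def blockGroup (N : ℕ) : Subgroup (ℂ ≃ₜ ℂ) := Subgroup.closure {f | ∃ p s, p + s ≤ N ∧ f = tw p s}

theorem tw_mem_blockGroup {p s N : ℕ} (h : p + s ≤ N) : tw p s ∈ blockGroup N :=
  Subgroup.subset_closure ⟨p, s, h, rfl⟩

theorem blockGroup_mono {N M : ℕ} (h : N ≤ M) : blockGroup N ≤ blockGroup M := by
  apply Subgroup.closure_mono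
  rintro f ⟨p, s, hps, rfl⟩
  exact ⟨p, s, hps.trans h, rfl⟩

theorem blockGroup_le_holeStabilizer {N k : ℕ} (h : N ≤ k) : blockGroup N ≤ holeStabilizer k := by
  rw [blockGroup, Subgroup.closure_le]
  rintro f ⟨p, s, hps, rfl⟩
  exact tw_mem_holeStabilizer (hps.trans h)

/-- Lets the part of a normal form that belongs to the upper wires pass through half-twists along
lower blocks. -/
theorem commute_of_mem_blockGroup {N p s : ℕ} {f : ℂ ≃ₜ ℂ} (hf : f ∈ blockGroup N) (h : N ≤ p) :
    Commute f (tw p s) := by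
  induction hf using Subgroup.closure_induction with
  | mem f hf => obtain ⟨q, t, hqt, rfl⟩ := hf; exact tw_commute_disjoint (hqt.trans h)
  | one => exact Commute.one_left _
  | mul f g _ _ hf hg => exact hf.mul_left hg
  | inv f _ hf => exact hf.inv_left

theorem image_conv_of_mem_blockGroup {N p s : ℕ} {f : ℂ ≃ₜ ℂ} (hf : f ∈ blockGroup N)
    (h : N ≤ p ∨ p = 0 ∧ N ≤ s) : f '' conv p s = conv p s := by
  induction hf using Subgroup.closure_induction with
  | mem f hf =>
    obtain ⟨q, t, hqt, rfl⟩ := hf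
    rcases h with h | ⟨rfl, h⟩
    · exact tw_image_conv_of_le (.inl (hqt.trans h))
    · have := tw_image_conv_of_subset (p := 0) (x := q) (y := t) (z := s - q - t) (s := s) (by omega)
      rwa [zero_add] at this
  | one => exact Set.image_id _
  | mul f g _ _ hf hg => rw [homeo_mul_image, hg, hf]
  | inv f _ hf => exact homeo_image_inv hf

theorem isotopicIn_conv_self {p s k : ℕ} (hs : 1 ≤ s) (h : p + s ≤ k) :
    IsotopicIn (holes k)ᶜ (conv p s) (conv p s) := by
  have hr := range_circle_eq_conv p s hs
  have hpos : 0 < outR s := by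
    have h : (1 : ℝ) ≤ s := by exact_mod_cast hs
    linarith [quarter_le_outR hs]
  have hcont : Continuous fun q : unitInterval × Circle =>
      (((cen p s + outR s * (q.2 : ℂ).re : ℝ) : ℂ) + ((outR s * (q.2 : ℂ).im : ℝ) : ℂ) * Complex.I) := by
    have hre : Continuous fun q : unitInterval × Circle => (q.2 : ℂ).re :=
      Complex.continuous_re.comp (continuous_subtype_val.comp continuous_snd)
    have him : Continuous fun q : unitInterval × Circle => (q.2 : ℂ).im :=
      Complex.continuous_im.comp (continuous_subtype_val.comp continuous_snd)
    fun_prop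
  refine ⟨fun q => ⟨cen p s + outR s * (q.2 : ℂ).re, outR s * (q.2 : ℂ).im⟩, ?_,
    fun _ θ θ' he => ?_, fun _ θ => conv_subset_compl_holes hs h (hr ▸ Set.mem_range_self θ), hr, hr⟩
  · convert hcont using 2 with q
    apply Complex.ext <;> simp
  · have hre := congrArg Complex.re he
    have him := congrArg Complex.im he
    exact Subtype.ext (Complex.ext (mul_left_cancel₀ hpos.ne' (add_left_cancel hre))
      (mul_left_cancel₀ hpos.ne' him))

/-! ## Normal forms -/

/-- The local order that results when each wire `v` of the list (from the lowest to the highest) lies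
on `c v` of the marked points. -/
def ord (c : ℕ → ℤ) : ℤ → List ℕ → List ℕ
  | _, [] => []
  | q, w :: Q => flipBy (c w - q) (ord c (c w) Q ++ [w])

/-- The normal form of the corresponding composition of half-twists. -/
noncomputable def nf (μ : ℕ → ℕ) (c : ℕ → ℤ) : ℤ → List ℕ → (ℂ ≃ₜ ℂ)
  | _, [] => 1
  | q, w :: Q => nf μ c (c w) Q * tw (wt μ Q) (μ w) * tw 0 (wt μ Q + μ w) ^ (c w - q)

theorem ord_perm (c : ℕ → ℤ) (q : ℤ) (Q : List ℕ) : (ord c q Q).Perm Q := by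
  induction Q generalizing q with
  | nil => exact .refl _
  | cons w Q ih =>
    exact (flipBy_perm _ _).trans (((ih _).append_right _).trans (List.perm_append_singleton w Q))

@[simp] theorem wt_ord (μ : ℕ → ℕ) (c : ℕ → ℤ) (q : ℤ) (Q : List ℕ) : wt μ (ord c q Q) = wt μ Q :=
  wt_perm μ (ord_perm c q Q)

theorem ord_congr {c c' : ℕ → ℤ} {Q : List ℕ} (h : ∀ v ∈ Q, c v = c' v) (q : ℤ) :
    ord c q Q = ord c' q Q := by
  induction Q generalizing q with
  | nil => rfl
  | cons w Q ih =>
    rw [ord, ord, ih (fun v hv => h v (List.mem_cons_of_mem _ hv)), h w List.mem_cons_self]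

theorem nf_congr {μ ν : ℕ → ℕ} {c c' : ℕ → ℤ} {Q : List ℕ} (hμ : ∀ v ∈ Q, μ v = ν v)
    (h : ∀ v ∈ Q, c v = c' v) (q : ℤ) : nf μ c q Q = nf ν c' q Q := by
  induction Q generalizing q with
  | nil => rfl
  | cons w Q ih =>
    have hμ' : ∀ v ∈ Q, μ v = ν v := fun v hv => hμ v (List.mem_cons_of_mem _ hv)
    rw [nf, nf, ih hμ' (fun v hv => h v (List.mem_cons_of_mem _ hv)), h w List.mem_cons_self,
      hμ w List.mem_cons_self, wt_congr hμ']

/-- Only differences of counts matter, the base value `q` being the last of them. Hence raising all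
counts amounts to lowering `q`, and that adds one more reversal or, in `nf_sub_one`, one more
half-twist of the whole. -/
theorem ord_add_one {c c' : ℕ → ℤ} {Q : List ℕ} (h : ∀ v ∈ Q, c' v = c v + 1) (q : ℤ) :
    ord c' (q + 1) Q = ord c q Q := by
  induction Q generalizing q with
  | nil => rfl
  | cons w Q ih =>
    rw [ord, ord, h w List.mem_cons_self, ih (fun v hv => h v (List.mem_cons_of_mem _ hv)),
      add_sub_add_right_eq_sub]

theorem nf_add_one {μ : ℕ → ℕ} {c c' : ℕ → ℤ} {Q : List ℕ} (h : ∀ v ∈ Q, c' v = c v + 1) (q : ℤ) :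
    nf μ c' (q + 1) Q = nf μ c q Q := by
  induction Q generalizing q with
  | nil => rfl
  | cons w Q ih =>
    rw [nf, nf, h w List.mem_cons_self, ih (fun v hv => h v (List.mem_cons_of_mem _ hv)),
      add_sub_add_right_eq_sub]

theorem ord_sub_one {c : ℕ → ℤ} (Q : List ℕ) (q : ℤ) : ord c (q - 1) Q = (ord c q Q).reverse := by
  cases Q with
  | nil => rfl
  | cons w Q => rw [ord, ord, ← flipBy_succ]; congr 1; ring

theorem nf_sub_one {μ : ℕ → ℕ} {c : ℕ → ℤ} {Q : List ℕ} (hQ : Q ≠ []) (q : ℤ) :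
    nf μ c (q - 1) Q = nf μ c q Q * tw 0 (wt μ Q) := by
  cases Q with
  | nil => exact absurd rfl hQ
  | cons w Q =>
    rw [nf, nf, wt_cons, add_comm (μ w), mul_assoc _ _ (tw 0 (wt μ Q + μ w)), ← zpow_add_one]
    congr 2; ring

theorem nf_mem_blockGroup (μ : ℕ → ℕ) (c : ℕ → ℤ) (q : ℤ) (Q : List ℕ) :
    nf μ c q Q ∈ blockGroup (wt μ Q) := by
  induction Q generalizing q with
  | nil => exact one_mem _
  | cons w Q ih =>
    rw [nf]
    refine mul_mem (mul_mem (blockGroup_mono ?_ (ih _)) (tw_mem_blockGroup ?_))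
      (zpow_mem (tw_mem_blockGroup ?_) _) <;> rw [wt_cons] <;> omega

/-! ## Adding a marked point -/

/-- Passing a marked point on the wires `S` takes the local order `o` to `n` and the composition `f`
of half-twists, up to isotopy, to `g`, and the vanishing cycle is isotopic to `C`. -/
def Passes (μ : ℕ → ℕ) (k : ℕ) (S : Finset ℕ) (C : Set ℂ) (o n : List ℕ) (f g : ℂ ≃ₜ ℂ) : Prop :=
  ∃ X Y Z, o = X ++ Y ++ Z ∧ Y ≠ [] ∧ Y.toFinset = S ∧ n = X ++ Y.reverse ++ Z ∧
    MapIso k (f * tw (wt μ X) (wt μ Y)) g ∧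
    IsotopicIn (holes k)ᶜ (f '' conv (wt μ X) (wt μ Y)) C

section Passes

variable {μ : ℕ → ℕ} {k : ℕ} {S : Finset ℕ} {C : Set ℂ} {o n : List ℕ} {f g : ℂ ≃ₜ ℂ}

theorem Passes.perm (h : Passes μ k S C o n f g) : n.Perm o := by
  obtain ⟨X, Y, Z, rfl, -, -, rfl, -, -⟩ := h
  exact ((Y.reverse_perm.append_left X).append_right Z)

/-- The half-twist along the new lowest wire is supported off the block of the marked point: it
commutes with the half-twist of the point and fixes its curve. -/
theorem Passes.append (h : Passes μ k S C o n f g) {v : ℕ} (hk : wt μ o + μ v ≤ k) :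
    Passes μ k S C (o ++ [v]) (n ++ [v]) (f * tw (wt μ o) (μ v)) (g * tw (wt μ o) (μ v)) := by
  obtain ⟨X, Y, Z, rfl, hY, hS, rfl, hM, hC⟩ := h
  have hle : wt μ X + wt μ Y ≤ wt μ (X ++ Y ++ Z) := by simp only [wt_append]; omega
  have hcomm := tw_commute_disjoint (s' := μ v) hle
  refine ⟨X, Y, Z ++ [v], by simp, hY, hS, by simp, ?_, ?_⟩
  · rw [mul_assoc, ← hcomm.eq, ← mul_assoc]
    exact hM.mul_right (tw_mem_holeStabilizer hk)
  · rw [homeo_mul_image, tw_image_conv_of_le (.inr hle)]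
    exact hC

theorem tw_whole_mul {x y z N : ℕ} (h : x + y + z = N) : tw 0 N * tw x y = tw z y * tw 0 N := by
  have := tw_mul_tw_nested (p := 0) h
  rwa [zero_add, zero_add] at this

/-- Reversing the local order moves the block of the marked point to the reflected position, and the
half-twist of the whole conjugates one position into the other, so the vanishing cycle does not
change. -/
theorem Passes.flip (h : Passes μ k S C o n f g) {N : ℕ} (hN : N = wt μ o) (hk : N ≤ k) :
    Passes μ k S C o.reverse n.reverse (f * tw 0 N) (g * tw 0 N) ∧
      Passes μ k S C o.reverse n.reverse (f * (tw 0 N)⁻¹) (g * (tw 0 N)⁻¹) := by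
  obtain ⟨X, Y, Z, rfl, hY, hS, rfl, hM, hC⟩ := h
  have hT : tw 0 N ∈ holeStabilizer k := tw_mem_holeStabilizer (by omega)
  have e1 : tw 0 N * tw (wt μ Z) (wt μ Y) = tw (wt μ X) (wt μ Y) * tw 0 N :=
    tw_whole_mul (by rw [hN]; simp only [wt_append]; omega)
  have e2 : tw 0 N * tw (wt μ X) (wt μ Y) = tw (wt μ Z) (wt μ Y) * tw 0 N :=
    tw_whole_mul (by rw [hN]; simp only [wt_append])
  have e3 : (tw 0 N)⁻¹ * tw (wt μ Z) (wt μ Y) = tw (wt μ X) (wt μ Y) * (tw 0 N)⁻¹ := by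
    rw [inv_mul_eq_iff_eq_mul, ← mul_assoc, e2, mul_inv_cancel_right]
  have i1 : tw 0 N '' conv (wt μ Z) (wt μ Y) = conv (wt μ X) (wt μ Y) := by
    have := tw_image_conv_nested (p := 0) (x := wt μ Z) (y := wt μ Y) (z := wt μ X) (s := N)
      (by rw [hN]; simp only [wt_append]; omega)
    rwa [zero_add, zero_add] at this
  have i2 : tw 0 N '' conv (wt μ X) (wt μ Y) = conv (wt μ Z) (wt μ Y) := by
    have := tw_image_conv_nested (p := 0) (x := wt μ X) (y := wt μ Y) (z := wt μ Z) (s := N)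
      (by rw [hN]; simp only [wt_append])
    rwa [zero_add, zero_add] at this
  have i3 : ((tw 0 N)⁻¹ : ℂ ≃ₜ ℂ) '' conv (wt μ Z) (wt μ Y) = conv (wt μ X) (wt μ Y) := by
    rw [← i2, ← homeo_mul_image, inv_mul_cancel]
    exact Set.image_id _
  have ho : (X ++ Y ++ Z).reverse = Z.reverse ++ Y.reverse ++ X.reverse := by simp
  have hn : (X ++ Y.reverse ++ Z).reverse = Z.reverse ++ Y.reverse.reverse ++ X.reverse := by simp
  have hY' : Y.reverse ≠ [] := by simpa using hY
  have hS' : Y.reverse.toFinset = S := by rw [List.toFinset_reverse, hS]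
  refine ⟨⟨_, _, _, ho, hY', hS', hn, ?_, ?_⟩, ⟨_, _, _, ho, hY', hS', hn, ?_, ?_⟩⟩
  · rw [wt_reverse, wt_reverse, mul_assoc, e1, ← mul_assoc]
    exact hM.mul_right hT
  · rw [wt_reverse, wt_reverse, homeo_mul_image, i1]
    exact hC
  · rw [wt_reverse, wt_reverse, mul_assoc, e3, ← mul_assoc]
    exact hM.mul_right (inv_mem hT)
  · rw [wt_reverse, wt_reverse, homeo_mul_image, i3]
    exact hC

theorem Passes.flipBy (h : Passes μ k S C o n f g) {N : ℕ} (hN : N = wt μ o) (hk : N ≤ k) (e : ℤ) :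
    Passes μ k S C (flipBy e o) (flipBy e n) (f * tw 0 N ^ e) (g * tw 0 N ^ e) := by
  induction e using Int.induction_on with
  | zero => simpa [flipBy_zero] using h
  | succ e ih =>
    rw [flipBy_succ, flipBy_succ, zpow_add_one, ← mul_assoc, ← mul_assoc]
    exact (ih.flip (by rw [wt_flipBy, hN]) hk).1
  | pred e ih =>
    rw [flipBy_pred, flipBy_pred, zpow_sub_one, ← mul_assoc, ← mul_assoc]
    exact (ih.flip (by rw [wt_flipBy, hN]) hk).2

end Passes

/-- A marked point on wires above the wires `P` extends to the normal forms of all the wires. -/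
theorem Passes.outward {μ ν : ℕ → ℕ} {k : ℕ} {S : Finset ℕ} {C : Set ℂ} {c c' : ℕ → ℤ} {A B : List ℕ}
    {D : ℤ → List ℕ → List ℕ} (hAB : wt ν A = wt μ B)
    (base : ∀ q, Passes μ k S C (D q (ord c q A)) (ord c' q B) (nf ν c q A) (nf μ c' q B))
    {P : List ℕ} (hν : ∀ v ∈ P, ν v = μ v) (hc : ∀ v ∈ P, c' v = c v)
    (hD : ∀ v ∈ P, ∀ q L, D q (_root_.flipBy (c v - q) (L ++ [v])) = _root_.flipBy (c v - q) (D (c v) L ++ [v]))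
    (hk : wt μ (P ++ B) ≤ k) (q : ℤ) :
    Passes μ k S C (D q (ord c q (P ++ A))) (ord c' q (P ++ B)) (nf ν c q (P ++ A))
      (nf μ c' q (P ++ B)) := by
  induction P generalizing q with
  | nil => exact base q
  | cons v P ih =>
    have hν' : ∀ v ∈ P, ν v = μ v := fun v hv => hν v (List.mem_cons_of_mem _ hv)
    rw [List.cons_append, wt_cons] at hk
    have h := ih hν' (fun v hv => hc v (List.mem_cons_of_mem _ hv))
      (fun v hv => hD v (List.mem_cons_of_mem _ hv)) (by omega) (c v)
    have hwo : wt μ (D (c v) (ord c (c v) (P ++ A))) = wt μ (P ++ B) := by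
      rw [← wt_perm μ h.perm, wt_ord]
    have hw : wt ν (P ++ A) = wt μ (P ++ B) := by rw [wt_append, wt_append, hAB, wt_congr hν']
    rw [List.cons_append, List.cons_append, ord, ord, nf, nf, hD v List.mem_cons_self,
      hc v List.mem_cons_self, hν v List.mem_cons_self, hw]
    have h2 := h.append (v := v) (by rw [hwo]; omega)
    rw [hwo] at h2
    exact h2.flipBy (by rw [wt_append μ _ [v], hwo]; simp) (by omega) _

/-- For the wires `A` alone the new point reverses everything and multiplies the normal form by the
half-twist of the whole, which is the effect of raising all their counts. The vanishing cycle is the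
image of an enclosing curve under twists inside it. -/
theorem passes_initial_block {μ : ℕ → ℕ} (hμ : ∀ v, 1 ≤ μ v) {k : ℕ} {c c' : ℕ → ℤ} {P A : List ℕ}
    (hA : A ≠ []) (hc : ∀ v ∈ A, c' v = c v + 1) (hc' : ∀ v ∈ P, c' v = c v)
    (hk : wt μ (P ++ A) ≤ k) (q : ℤ) :
    Passes μ k A.toFinset (conv 0 (wt μ A)) (ord c q (P ++ A)) (ord c' q (P ++ A))
      (nf μ c q (P ++ A)) (nf μ c' q (P ++ A)) := by
  have hk' : wt μ A ≤ k := by rw [wt_append] at hk; omega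
  refine Passes.outward (D := fun _ L => L) rfl (fun q => ?_) (fun _ _ => rfl) hc'
    (fun _ _ _ _ => rfl) hk q
  have h1 : ord c' q A = (ord c q A).reverse := by
    rw [← ord_sub_one, ← ord_add_one hc, sub_add_cancel]
  have h2 : nf μ c' q A = nf μ c q A * tw 0 (wt μ A) := by
    rw [← nf_sub_one hA, ← nf_add_one hc, sub_add_cancel]
  have hmem := nf_mem_blockGroup μ c q A
  have hne : ord c q A ≠ [] := fun h => by
    have := (ord_perm c q A).length_eq
    rw [h] at this
    exact hA (List.eq_nil_of_length_eq_zero this.symm)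
  refine ⟨[], ord c q A, [], by simp, hne, ?_, by simp [h1], ?_, ?_⟩
  · ext v; simp [(ord_perm c q A).mem_iff]
  · rw [h2, wt_nil, wt_ord]
    exact MapIso.refl (blockGroup_le_holeStabilizer hk'
      (mul_mem hmem (tw_mem_blockGroup (by omega))))
  · rw [wt_nil, wt_ord, image_conv_of_mem_blockGroup hmem (.inr ⟨rfl, le_rfl⟩)]
    exact isotopicIn_conv_self (one_le_wt hμ hA) (by omega)

/-! ## Doubling a wire -/

/-- The list obtained by doubling the wire `w`, the new wire `w'` being below `w` or above it. -/
def dbl (w w' : ℕ) (b : Bool) (L : List ℕ) : List ℕ :=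
  L.flatMap fun v => if v = w then (if b then [w, w'] else [w', w]) else [v]

section Dbl

variable {w w' : ℕ}

@[simp] theorem dbl_nil (b : Bool) : dbl w w' b [] = [] := rfl

@[simp] theorem dbl_append (b : Bool) (L M : List ℕ) :
    dbl w w' b (L ++ M) = dbl w w' b L ++ dbl w w' b M := List.flatMap_append

theorem dbl_cons (b : Bool) (v : ℕ) (L : List ℕ) : dbl w w' b (v :: L) =
    (if v = w then (if b then [w, w'] else [w', w]) else [v]) ++ dbl w w' b L := rfl

theorem dbl_of_not_mem (b : Bool) {L : List ℕ} (h : w ∉ L) : dbl w w' b L = L := by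
  induction L with
  | nil => rfl
  | cons v L ih =>
    rw [dbl_cons, if_neg (fun hv : v = w => h (hv ▸ List.mem_cons_self)),
      ih (fun hv => h (List.mem_cons_of_mem _ hv))]
    rfl

/-- The copy changes sides at each reversal, so its side is given by the parity of the number of
reversals. -/
theorem dbl_reverse (b : Bool) (L : List ℕ) :
    dbl w w' b L.reverse = (dbl w w' (!b) L).reverse := by
  induction L with
  | nil => rfl
  | cons v L ih =>
    rw [List.reverse_cons, dbl_append, ih, dbl_cons (!b), List.reverse_append]
    congr 1
    rw [dbl_cons]
    split_ifs <;> cases b <;> simp_all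

theorem toFinset_dbl (b : Bool) (L : List ℕ) :
    (dbl w w' b L).toFinset = if w ∈ L then insert w' L.toFinset else L.toFinset := by
  split_ifs with h
  · induction L with
    | nil => simp at h
    | cons v L ih =>
      rw [dbl_cons, List.toFinset_append]
      by_cases hv : v = w
      · subst hv
        have e : (if b then [v, w'] else [w', v]).toFinset = insert w' {v} := by
          cases b
          · simp
          · simp [Finset.pair_comm]
        rw [if_pos rfl, e]
        by_cases hL : v ∈ L
        · rw [ih hL]; ext x; simp
        · rw [dbl_of_not_mem b hL]; ext x; simp
      · have hL : w ∈ L := by simpa [Ne.symm hv] using h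
        rw [if_neg hv, ih hL]; ext x; simp
  · rw [dbl_of_not_mem b h]

theorem dbl_ne_nil (b : Bool) {L : List ℕ} (h : L ≠ []) : dbl w w' b L ≠ [] := by
  obtain ⟨v, M, rfl⟩ := List.exists_cons_of_ne_nil h
  rw [dbl_cons]
  split_ifs <;> simp

theorem wt_dbl {μ ν : ℕ → ℕ} (hw : ν w = μ w + μ w') {L : List ℕ} (hν : ∀ v ∈ L, v ≠ w → ν v = μ v)
    (b : Bool) : wt μ (dbl w w' b L) = wt ν L := by
  induction L with
  | nil => rfl
  | cons v L ih =>
    rw [dbl_cons, wt_append, ih (fun v hv => hν v (List.mem_cons_of_mem _ hv)), wt_cons]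
    congr 1
    by_cases hv : v = w
    · subst hv
      rw [hw, if_pos rfl]
      cases b <;> simp [add_comm]
    · rw [if_neg hv, hν v List.mem_cons_self hv]; simp

theorem dbl_flipBy (b : Bool) (e : ℤ) (L : List ℕ) :
    dbl w w' (xor b (decide (Odd e))) (flipBy e L) = flipBy e (dbl w w' b L) := by
  by_cases h : Even e
  · have h' : ¬ Odd e := Int.not_odd_iff_even.2 h
    simp [flipBy, h, h']
  · have h' : Odd e := Int.not_even_iff_odd.1 h
    simp [flipBy, h, h', dbl_reverse]

end Dbl

/-- The three-block relation with blocks `β`, `S`, `γ`, solved for the last two factors on its left.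
The right-hand side is the normal-form factor for the new counts: one more on `S`, none on `β`, one
more on `γ`. -/
theorem mapIso_interior {S β γ k : ℕ} (hk : S + β + γ ≤ k) :
    MapIso k (tw S (β + γ) * tw 0 (S + γ))
      (tw 0 S * tw S β * (tw 0 (S + β))⁻¹ * tw (S + β) γ * tw 0 (S + β + γ)) := by
  have h := mapIso_three_blocks (u := β) (v := S) (w := γ) (k := k) (by omega)
  rw [add_comm β S] at h
  have h2 := h.mul_left (inv_mem (tw_mem_holeStabilizer (p := 0) (s := S + β) (k := k) (by omega)))
  have e1 : tw 0 (S + β) * tw 0 S = tw β S * tw 0 (S + β) := tw_whole_mul (by omega)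
  have e2 : tw 0 (S + β) * tw S β = tw 0 β * tw 0 (S + β) := tw_whole_mul (by omega)
  have e3 : tw 0 β * tw β S = tw β S * tw 0 β := (tw_commute_disjoint (by omega)).eq
  have e4 : (tw 0 (S + β))⁻¹ * (tw 0 β * tw β S) = tw 0 S * tw S β * (tw 0 (S + β))⁻¹ := by
    rw [inv_mul_eq_iff_eq_mul, ← mul_assoc, ← mul_assoc, e1, mul_assoc (tw β S), e2, ← mul_assoc,
      mul_inv_cancel_right, e3]
  have e5 : (tw 0 (S + β))⁻¹ * (tw 0 (S + β) * tw S (β + γ) * tw 0 (S + γ)) =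
      tw S (β + γ) * tw 0 (S + γ) := by
    rw [mul_assoc (tw 0 (S + β)), inv_mul_cancel_left]
  have e6 : (tw 0 (S + β))⁻¹ * (tw 0 β * tw β S * tw (S + β) γ * tw 0 (S + β + γ)) =
      tw 0 S * tw S β * (tw 0 (S + β))⁻¹ * tw (S + β) γ * tw 0 (S + β + γ) := by
    rw [← e4]; simp only [mul_assoc]
  rwa [e5, e6] at h2

/-- It suffices to consider the wires `A` and the two copies, where up to flips `w'` stands between
`A` and `w`. The factor of the normal form that belongs to `A` commutes with the half-twist along
the doubled wire and fixes the convex curve, so the vanishing cycle is the arm computed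
geometrically. -/
theorem passes_interior {μ ν : ℕ → ℕ} (hμ : ∀ v, 1 ≤ μ v) {k : ℕ} {c c' : ℕ → ℤ} {w w' : ℕ}
    {P A : List ℕ} (hA : A ≠ []) (hcA : ∀ v ∈ A, c' v = c v + 1) (hcw : c' w = c w)
    (hcw' : c' w' = c w + 1) (hcP : ∀ v ∈ P, c' v = c v) (hνA : ∀ v ∈ A, ν v = μ v)
    (hνw : ν w = μ w + μ w') (hνP : ∀ v ∈ P, ν v = μ v) (hwA : w ∉ A) (hwP : w ∉ P)
    (hk : wt μ (P ++ w' :: w :: A) ≤ k) (q : ℤ) :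
    Passes μ k (insert w' A.toFinset)
      (lowerArm (3 / 4) (wt μ A + 1 / 4) (wt μ A + μ w + 3 / 4) (wt μ A + μ w + μ w' + 1 / 4))
      (dbl w w' (decide (Odd (c w - q))) (ord c q (P ++ w :: A))) (ord c' q (P ++ w' :: w :: A))
      (nf ν c q (P ++ w :: A)) (nf μ c' q (P ++ w' :: w :: A)) := by
  have hk' : wt μ A + μ w + μ w' ≤ k := by simp only [wt_append, wt_cons] at hk; omega
  have hwν : wt ν A = wt μ A := wt_congr hνA
  -- Without flips `w'` is above `w`; the flips between the levels `c w` and `q` put it below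
  -- exactly when their number is odd.
  refine Passes.outward (D := fun q L => dbl w w' (decide (Odd (c w - q))) L) ?_ (fun q => ?_) hνP hcP
    (fun v hv q L => ?_) hk q
  · rw [wt_cons, wt_cons, wt_cons, hνw, hwν]; omega
  · have o1 : ord c' (c w) A = (ord c (c w) A).reverse := by
      rw [← ord_sub_one, ← ord_add_one hcA, sub_add_cancel]
    have n1 : nf μ c' (c w) A = nf μ c (c w) A * tw 0 (wt μ A) := by
      rw [← nf_sub_one hA, ← nf_add_one hcA, sub_add_cancel]
    have hmem := nf_mem_blockGroup μ c (c w) A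
    have hwo : w ∉ ord c (c w) A := fun h => hwA ((ord_perm c (c w) A).mem_iff.1 h)
    have e0 : dbl w w' (decide (Odd (c w - q))) (ord c q (w :: A)) =
        flipBy (c w - q) (ord c (c w) A ++ [w'] ++ [w]) := by
      have h0 : dbl w w' false (ord c (c w) A ++ [w]) = ord c (c w) A ++ [w'] ++ [w] := by
        rw [dbl_append, dbl_of_not_mem false hwo, dbl_cons]; simp
      rw [ord, ← h0, ← dbl_flipBy, Bool.false_xor]
    have e1 : ord c' q (w' :: w :: A) = flipBy (c w - q) ([w'] ++ (ord c (c w) A).reverse ++ [w]) := by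
      rw [ord, ord, hcw', hcw, o1, show c w - (c w + 1) = 0 - 1 by ring, flipBy_pred, flipBy_zero,
        show c w + 1 - q = c w - q + 1 by ring, flipBy_succ]
      by_cases h : Even (c w - q) <;> simp [flipBy, h]
    have e2 : nf ν c q (w :: A) =
        nf μ c (c w) A * tw (wt μ A) (μ w + μ w') * tw 0 (wt μ A + μ w + μ w') ^ (c w - q) := by
      rw [nf, hwν, hνw, nf_congr hνA (fun _ _ => rfl), add_assoc]
    have e3 : nf μ c' q (w' :: w :: A) = nf μ c (c w) A * (tw 0 (wt μ A) * tw (wt μ A) (μ w) *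
        (tw 0 (wt μ A + μ w))⁻¹ * tw (wt μ A + μ w) (μ w') * tw 0 (wt μ A + μ w + μ w')) *
        tw 0 (wt μ A + μ w + μ w') ^ (c w - q) := by
      rw [nf, nf, hcw', hcw, n1, wt_cons, add_comm (μ w) (wt μ A), show c w - (c w + 1) = -1 by ring,
        zpow_neg_one, show c w + 1 - q = 1 + (c w - q) by ring, zpow_add, zpow_one]
      simp only [mul_assoc]
    rw [e0, e1, e2, e3]
    have hne : ord c (c w) A ++ [w'] ≠ [] := by simp
    refine Passes.flipBy ⟨[], ord c (c w) A ++ [w'], [w], by simp, hne, ?_, by simp, ?_, ?_⟩ ?_ hk' _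
    · ext v; simp [(ord_perm c (c w) A).mem_iff]
    · rw [wt_nil, wt_append, wt_ord, wt_cons, wt_nil, add_zero, mul_assoc]
      exact (mapIso_interior hk').mul_left (blockGroup_le_holeStabilizer (by omega) hmem)
    · rw [wt_nil, wt_append, wt_ord, wt_cons, wt_nil, add_zero,
        (commute_of_mem_blockGroup hmem le_rfl).eq, homeo_mul_image,
        image_conv_of_mem_blockGroup hmem (.inr ⟨rfl, by omega⟩)]
      exact isotopicIn_tw_conv_lowerArm (one_le_wt hμ hA) (hμ w) (hμ w') hk'
    · simp only [wt_append, wt_ord, wt_cons, wt_nil]; omega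
  · have hv' : w ≠ v := fun h => hwP (h ▸ hv)
    have hd : dbl w w' (decide (Odd (c w - c v))) (L ++ [v]) =
        dbl w w' (decide (Odd (c w - c v))) L ++ [v] := by
      rw [dbl_append, dbl_of_not_mem _ (L := [v]) (by simpa using hv')]
    rw [← hd, ← dbl_flipBy]
    congr 1
    have : c w - q = (c w - c v) + (c v - q) := by ring
    rw [this]
    generalize c w - c v = a, c v - q = b
    by_cases h1 : Even a <;> by_cases h2 : Even b <;>
      simp [← Int.not_even_iff_odd, Int.even_add, h1, h2]

/-- The new wire has count `1`, the base value, so its normal form adds only the half-twist along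
its own block. -/
theorem passes_exterior {μ : ℕ → ℕ} {k : ℕ} {c c' : ℕ → ℤ} {A : List ℕ} {w : ℕ} (hμ : 1 ≤ μ w)
    (hc : ∀ v ∈ A, c' v = c v) (hcw : c' w = 1) (hk : wt μ (w :: A) ≤ k) :
    Passes μ k {w} (conv (wt μ A) (μ w)) (ord c 1 A ++ [w]) (ord c' 1 (w :: A))
      (nf μ c 1 A) (nf μ c' 1 (w :: A)) := by
  rw [wt_cons] at hk
  have hmem := nf_mem_blockGroup μ c 1 A
  refine ⟨ord c 1 A, [w], [], by simp, by simp, by simp, ?_, ?_, ?_⟩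
  · rw [ord, hcw, sub_self, flipBy_zero, ord_congr hc]; simp
  · rw [nf, hcw, sub_self, zpow_zero, mul_one, nf_congr (fun _ _ => rfl) hc, wt_ord, wt_cons, wt_nil,
      add_zero]
    exact MapIso.refl (mul_mem (blockGroup_le_holeStabilizer (by omega) hmem)
      (tw_mem_holeStabilizer (by omega)))
  · rw [wt_ord, wt_cons, wt_nil, add_zero, image_conv_of_mem_blockGroup hmem (.inl le_rfl)]
    exact isotopicIn_conv_self hμ (by omega)

/-! ## Sweeping a wiring diagram with weighted wires -/

/-- The relation between the sets of wires at the marked points, from right to left, the resulting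
local order of the wires, and the resulting composition of half-twists, where each wire `v` stands for
`μ v` parallel wires and `R` is the order on the right-hand side. -/
inductive Run (μ : ℕ → ℕ) (R : List ℕ) : List (Finset ℕ) → List ℕ → (ℂ ≃ₜ ℂ) → Prop
  | nil : Run μ R [] R 1
  | snoc {Ss : List (Finset ℕ)} {X Y Z : List ℕ} {Φ : ℂ ≃ₜ ℂ} (h : Run μ R Ss (X ++ Y ++ Z) Φ)
      (hY : Y ≠ []) : Run μ R (Ss ++ [Y.toFinset]) (X ++ Y.reverse ++ Z) (Φ * tw (wt μ X) (wt μ Y))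

section Run

variable {μ ν : ℕ → ℕ} {R L : List ℕ} {Ss : List (Finset ℕ)} {Φ : ℂ ≃ₜ ℂ}

theorem Run.perm (h : Run μ R Ss L Φ) : L.Perm R := by
  induction h with
  | nil => exact .refl _
  | @snoc Ss X Y Z Φ h hY ih => exact ((Y.reverse_perm.append_left X).append_right Z).trans ih

theorem Run.subset (h : Run μ R Ss L Φ) : ∀ S ∈ Ss, ∀ v ∈ S, v ∈ R := by
  induction h with
  | nil => simp
  | @snoc Ss X Y Z Φ h hY ih =>
    intro S hS v hv
    rcases List.mem_append.1 hS with hS | hS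
    · exact ih S hS v hv
    · rw [List.mem_singleton.1 hS, List.mem_toFinset] at hv
      exact h.perm.mem_iff.1 (by simp [hv])

theorem Run.exists_take (h : Run μ R Ss L Φ) {j : ℕ} {S : Finset ℕ} (hj : Ss[j]? = some S) :
    ∃ X Y Z Ψ, Run μ R (Ss.take j) (X ++ Y ++ Z) Ψ ∧ Y ≠ [] ∧ Y.toFinset = S := by
  induction h with
  | nil => simp at hj
  | @snoc Ss X Y Z Φ h hY ih =>
    rcases Nat.lt_or_ge j Ss.length with hlt | hge
    · rw [List.getElem?_append_left hlt] at hj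
      rw [List.take_append_of_le_length hlt.le]
      exact ih hj
    · rw [List.getElem?_append_right hge] at hj
      have h0 : j - Ss.length = 0 := by
        by_contra hne
        rw [List.getElem?_eq_none (by simp; omega)] at hj
        simp at hj
      rw [h0] at hj
      have : j = Ss.length := by omega
      subst this
      rw [List.take_left']
      · exact ⟨X, Y, Z, Φ, h, hY, by simpa using hj⟩
      · rfl

theorem Run.append (h : Run μ R Ss L Φ) (v : ℕ) : Run μ (R ++ [v]) Ss (L ++ [v]) Φ := by
  induction h with
  | nil => exact .nil
  | @snoc Ss X Y Z Φ h hY ih =>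
    have ih' : Run μ (R ++ [v]) Ss (X ++ Y ++ (Z ++ [v])) Φ := by simpa using ih
    simpa using ih'.snoc hY

/-- Replaces the actual composition by an isotopic normal form, both for the next step of the sweep
and for the vanishing cycle. -/
theorem Run.passes {k : ℕ} {S : Finset ℕ} {C : Set ℂ} {n : List ℕ} {f g : ℂ ≃ₜ ℂ}
    (hμ : ∀ v, 1 ≤ μ v) (hk : wt μ R ≤ k) (h : Run μ R Ss L Φ) (hf : MapIso k Φ f)
    (hp : Passes μ k S C L n f g) :
    (∃ Ψ, Run μ R (Ss ++ [S]) n Ψ ∧ MapIso k Ψ g) ∧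
      ∃ X Y Z, Run μ R Ss (X ++ Y ++ Z) Φ ∧ Y ≠ [] ∧ Y.toFinset = S ∧
        IsotopicIn (holes k)ᶜ (Φ '' conv (wt μ X) (wt μ Y)) C := by
  obtain ⟨X, Y, Z, rfl, hY, rfl, rfl, hM, hC⟩ := hp
  have hle : wt μ X + wt μ Y ≤ k := by
    have := wt_perm μ h.perm
    simp only [wt_append] at this; omega
  refine ⟨⟨_, h.snoc hY, (hf.mul_right (tw_mem_holeStabilizer hle)).trans hM⟩, X, Y, Z, h, hY, rfl, ?_⟩
  exact (hf.isotopicIn (isotopicIn_conv_self (one_le_wt hμ hY) hle)).trans hC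

/-! ## Counting marked points -/

/-- The number of the sets in the list that contain `v`. -/
def cnt (Ss : List (Finset ℕ)) (v : ℕ) : ℤ := (Ss.countP fun S => decide (v ∈ S) : ℕ)

theorem cnt_append_of_mem {S : Finset ℕ} {v : ℕ} (h : v ∈ S) : cnt (Ss ++ [S]) v = cnt Ss v + 1 := by
  simp [cnt, List.countP_append, h]

theorem cnt_append_of_not_mem {S : Finset ℕ} {v : ℕ} (h : v ∉ S) : cnt (Ss ++ [S]) v = cnt Ss v := by
  simp [cnt, List.countP_append, h]

theorem cnt_eq_zero {v : ℕ} (h : ∀ S ∈ Ss, v ∉ S) : cnt Ss v = 0 := by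
  simpa [cnt, List.countP_eq_zero] using h

/-- The set `S`, with `w'` added if it contains `w`. -/
def dblSet (w w' : ℕ) (S : Finset ℕ) : Finset ℕ := if w ∈ S then insert w' S else S

theorem mem_dblSet_of_ne {w w' v : ℕ} (h : v ≠ w') (S : Finset ℕ) : v ∈ dblSet w w' S ↔ v ∈ S := by
  unfold dblSet; split_ifs <;> simp [h]

theorem mem_dblSet_new {w w' : ℕ} {S : Finset ℕ} (h : w' ∉ S) : w' ∈ dblSet w w' S ↔ w ∈ S := by
  unfold dblSet; split_ifs with hw <;> simp [h, hw]

theorem cnt_map_dblSet_of_ne {w w' v : ℕ} (h : v ≠ w') : cnt (Ss.map (dblSet w w')) v = cnt Ss v := by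
  simp only [cnt, List.countP_map, Function.comp_def, mem_dblSet_of_ne h]

theorem cnt_map_dblSet_new {w w' : ℕ} (h : ∀ S ∈ Ss, w' ∉ S) :
    cnt (Ss.map (dblSet w w')) w' = cnt Ss w := by
  rw [cnt, cnt, List.countP_map]
  congr 1
  exact List.countP_congr fun S hS => by simp [mem_dblSet_new (h S hS)]

/-- Half-twists depend only on the weights of the wires above and at a point, and a wire of weight
`μ w + μ w'` weighs as much as its two copies; so the composition `Φ` is literally the same. The
copy starts below `w` and changes sides at each marked point on `w`. -/
theorem Run.double {w w' : ℕ} (hw : ν w = μ w + μ w') (hν : ∀ v, v ≠ w → ν v = μ v) (hR : R.Nodup)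
    (h : Run ν R Ss L Φ) :
    Run μ (dbl w w' true R) (Ss.map (dblSet w w')) (dbl w w' (decide (Even (cnt Ss w))) L) Φ := by
  induction h with
  | nil => simpa [cnt] using Run.nil
  | @snoc Ss X Y Z Φ h hY ih =>
    have hnd : (X ++ Y ++ Z).Nodup := h.perm.nodup_iff.2 hR
    set b := decide (Even (cnt Ss w)) with hb
    have hs : dblSet w w' Y.toFinset = (dbl w w' b Y).toFinset := by
      rw [toFinset_dbl, dblSet]; simp
    rw [dbl_append, dbl_append] at ih
    have := ih.snoc (dbl_ne_nil b hY)
    rw [wt_dbl hw fun v _ => hν v, wt_dbl hw fun v _ => hν v, ← hs] at this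
    rw [List.map_append, List.map_singleton]
    convert this using 1
    rw [dbl_append, dbl_append]
    by_cases hwY : w ∈ Y
    · have hX : w ∉ X := fun hX => by
        have := (List.nodup_append.1 (List.nodup_append.1 hnd).1).2.2 w hX w hwY
        exact this rfl
      have hZ : w ∉ Z := fun hZ => by
        have := (List.nodup_append.1 hnd).2.2 w (by simp [hwY]) w hZ
        exact this rfl
      rw [dbl_of_not_mem _ hX, dbl_of_not_mem _ hX, dbl_of_not_mem _ hZ, dbl_of_not_mem _ hZ,
        dbl_reverse, cnt_append_of_mem (by simpa using hwY)]
      congr 3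
      have he' : Odd (cnt Ss w) ↔ ¬ Even (cnt Ss w) := Int.not_even_iff_odd.symm
      by_cases he : Even (cnt Ss w) <;> simp [hb, he, he', -Int.not_even_iff_odd]
    · rw [cnt_append_of_not_mem (by simpa using hwY), dbl_of_not_mem b hwY,
        dbl_of_not_mem (L := Y.reverse) _ (by simpa using hwY)]

end Run

/-! ## The local order and the vanishing cycles of a wiring diagram -/

namespace WiringDiagram

/-- The sets of wires at the marked points. -/
def wireSets (W : WiringDiagram) : List (Finset ℕ) := W.marks.map MarkedPoint.wires

theorem wiresAt_eq {W : WiringDiagram} {j : ℕ} {S : Finset ℕ} (h : W.wireSets[j]? = some S) :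
    W.wiresAt j = S := by
  rw [wireSets, List.getElem?_map] at h
  rw [wiresAt, h]; rfl

theorem above_eq {W : WiringDiagram} {j : ℕ} {X Y Z : List ℕ} (hL : W.localOrder j = X ++ Y ++ Z)
    (hnd : (X ++ Y ++ Z).Nodup) (hY : Y ≠ []) (hS : W.wiresAt j = Y.toFinset) :
    W.above j = X.length ∧ (W.wiresAt j).card = Y.length := by
  have hd := List.nodup_append.1 (List.nodup_append.1 hnd).1
  refine ⟨?_, by rw [hS, List.toFinset_card_of_nodup hd.2.1]⟩
  obtain ⟨v, M, rfl⟩ := List.exists_cons_of_ne_nil hY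
  rw [above, hL, hS, List.append_assoc, List.findIdx_append, if_neg, List.cons_append,
    List.findIdx_cons]
  · simp
  · rw [List.findIdx_lt_length]
    rintro ⟨x, hx, hx'⟩
    exact hd.2.2 x hx x (by simpa using hx') rfl

theorem localOrder_succ_eq {W : WiringDiagram} {j : ℕ} {X Y Z : List ℕ}
    (hL : W.localOrder j = X ++ Y ++ Z) (hnd : (X ++ Y ++ Z).Nodup) (hY : Y ≠ [])
    (hS : W.wiresAt j = Y.toFinset) : W.localOrder (j + 1) = X ++ Y.reverse ++ Z := by
  obtain ⟨h1, h2⟩ := above_eq hL hnd hY hS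
  unfold above at h1
  simp only [localOrder]
  rw [h1, h2, hL, List.append_assoc X Y Z, List.take_left, List.drop_left, List.take_left,
    ← List.append_assoc X Y Z, ← List.length_append, List.drop_left]

theorem halfTwist_eq {W : WiringDiagram} {j : ℕ} {X Y Z : List ℕ}
    (hL : W.localOrder j = X ++ Y ++ Z) (hnd : (X ++ Y ++ Z).Nodup) (hY : Y ≠ [])
    (hS : W.wiresAt j = Y.toFinset) :
    halfTwist (W.top j) (W.bottom j) = tw X.length Y.length ∧
      convexCurve (W.top j) (W.bottom j) = conv X.length Y.length := by
  obtain ⟨h1, h2⟩ := above_eq hL hnd hY hS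
  rw [top, bottom, h1, h2, coe_tw, convexCurve_eq]
  exact ⟨rfl, rfl⟩

/-- With all weights equal to one, a run is the actual sweep of the diagram. -/
theorem localOrder_of_run {W : WiringDiagram} (hR : W.right.Nodup) {Ss : List (Finset ℕ)} {L : List ℕ}
    {Φ : ℂ ≃ₜ ℂ} (h : Run (fun _ => 1) W.right Ss L Φ) (hp : Ss <+: W.wireSets) :
    W.localOrder Ss.length = L ∧ W.twistComp Ss.length = Φ := by
  induction h with
  | nil => exact ⟨rfl, rfl⟩
  | @snoc Ss X Y Z Φ h hY ih =>
    obtain ⟨i1, i2⟩ := ih ((List.prefix_append _ _).trans hp)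
    have hS : W.wiresAt Ss.length = Y.toFinset := wiresAt_eq (by
      obtain ⟨T, hT⟩ := hp
      rw [← hT]; simp)
    have hnd : (X ++ Y ++ Z).Nodup := h.perm.nodup_iff.2 hR
    rw [List.length_append, List.length_singleton]
    refine ⟨localOrder_succ_eq i1 hnd hY hS, ?_⟩
    rw [twistComp, i2, (halfTwist_eq i1 hnd hY hS).1, wt_one, wt_one]
    rfl

theorem vanishingCycle_of_run {W : WiringDiagram} (hR : W.right.Nodup) {j : ℕ} {X Y Z : List ℕ}
    {Φ : ℂ ≃ₜ ℂ} (h : Run (fun _ => 1) W.right (W.wireSets.take j) (X ++ Y ++ Z) Φ) (hY : Y ≠ [])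
    (hS : W.wireSets[j]? = some Y.toFinset) :
    W.vanishingCycle j = Φ '' conv (wt (fun _ => 1) X) (wt (fun _ => 1) Y) := by
  have hlt : j < W.wireSets.length := by
    by_contra hcon
    rw [List.getElem?_eq_none (not_lt.1 hcon)] at hS
    simp at hS
  obtain ⟨i1, i2⟩ := localOrder_of_run hR h (List.take_prefix _ _)
  rw [List.length_take, min_eq_left hlt.le] at i1 i2
  rw [vanishingCycle, i2, (halfTwist_eq i1 (h.perm.nodup_iff.2 hR) hY (wiresAt_eq hS)).2, wt_one, wt_one]

theorem isRealizable_of_run {W : WiringDiagram} (hR : W.right.Nodup) {L : List ℕ} {Φ : ℂ ≃ₜ ℂ}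
    (h : Run (fun _ => 1) W.right W.wireSets L Φ) : W.IsRealizable := by
  refine ⟨hR, fun j hj => ?_⟩
  have hj' : j < W.wireSets.length := by rwa [wireSets, List.length_map]
  have hS : W.wireSets[j]? = some W.wireSets[j] := List.getElem?_eq_getElem hj'
  obtain ⟨X, Y, Z, Ψ, hr, hY, hYS⟩ := h.exists_take hS
  obtain ⟨i1, -⟩ := localOrder_of_run hR hr (List.take_prefix _ _)
  rw [List.length_take, min_eq_left hj'.le] at i1
  have hw : W.wiresAt j = Y.toFinset := (wiresAt_eq hS).trans hYS.symm
  obtain ⟨h1, h2⟩ := above_eq i1 (hr.perm.nodup_iff.2 hR) hY hw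
  rw [h1, h2, i1, hw, List.append_assoc, List.drop_left, List.take_left]
  exact ⟨List.toFinset_nonempty_iff _ |>.2 hY, rfl⟩

end WiringDiagram

/-! ## Wiring diagrams in normal form -/

/-- Sweeping the marked points gives the normal form that is determined by the numbers of marked
points on the wires. -/
def IsNormal (μ : ℕ → ℕ) (k : ℕ) (R : List ℕ) (Ss : List (Finset ℕ)) : Prop :=
  ∃ Φ, Run μ R Ss (ord (cnt Ss) 1 R.reverse) Φ ∧ MapIso k Φ (nf μ (cnt Ss) 1 R.reverse)

theorem IsNormal.initial_block {μ : ℕ → ℕ} (hμ : ∀ v, 1 ≤ μ v) {k : ℕ} {R : List ℕ} (hR : R.Nodup)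
    (hk : wt μ R ≤ k) {Ss : List (Finset ℕ)} (h : IsNormal μ k R Ss) {s : ℕ} (h1 : 1 ≤ s)
    (hs : s ≤ R.length) :
    IsNormal μ k R (Ss ++ [(R.take s).toFinset]) ∧
      ∃ X Y Z Φ, Run μ R Ss (X ++ Y ++ Z) Φ ∧ Y ≠ [] ∧ Y.toFinset = (R.take s).toFinset ∧
        IsotopicIn (holes k)ᶜ (Φ '' conv (wt μ X) (wt μ Y)) (conv 0 (wt μ (R.take s))) := by
  obtain ⟨Φ, hr, hm⟩ := h
  have hQ : R.reverse = (R.drop s).reverse ++ (R.take s).reverse := by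
    rw [← List.reverse_append, List.take_append_drop]
  have hne : (R.take s).reverse ≠ [] := by
    rw [Ne, List.reverse_eq_nil_iff, List.take_eq_nil_iff]
    rintro (h | h)
    · omega
    · rw [h] at hs; simp at hs; omega
  have hdisj : ∀ v ∈ R.drop s, v ∉ R.take s := fun v hv hv' => by
    have := hR
    rw [← List.take_append_drop s R] at this
    exact (List.nodup_append.1 this).2.2 v hv' v hv rfl
  have hp := passes_initial_block hμ (k := k) (c := cnt Ss) (c' := cnt (Ss ++ [(R.take s).toFinset]))
    (P := (R.drop s).reverse) hne (fun v hv => cnt_append_of_mem (by simpa using hv))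
    (fun v hv => cnt_append_of_not_mem (by
      rw [List.mem_toFinset]; exact hdisj v (by simpa using hv))) (by rw [← hQ, wt_reverse]; exact hk) 1
  rw [← hQ, List.toFinset_reverse, wt_reverse] at hp
  obtain ⟨h1, X, Y, Z, h2⟩ := hr.passes hμ hk hm hp
  exact ⟨h1, X, Y, Z, Φ, h2⟩

/-- A map of the line that makes room for the parallel wires. -/
structure IsSplitting (μ : ℕ → ℕ) (R : List ℕ) (φ : ℝ → ℝ) : Prop where
  strictMono : StrictMono φ
  continuous : Continuous φ
  apply_eq : ∀ s ≤ R.length, ∀ x : ℝ, s + 1 / 4 ≤ x → x ≤ s + 3 / 4 → φ x = x + wt μ (R.take s) - s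

/-- The vanishing cycle of each marked point `x_t`, for any weights of the wires, is the mirror image
of `α t` with its holes split accordingly. -/
def Realizes (W : WiringDiagram) (α : ℕ → Set ℂ) : Prop :=
  ∀ (μ : ℕ → ℕ), (∀ v, 1 ≤ μ v) → ∀ k, wt μ W.right ≤ k → ∀ φ, IsSplitting μ W.right φ →
    ∀ (j : ℕ) (P : MarkedPoint), W.marks[j]? = some P → ∀ t, P.label = MarkLabel.x t →
      ∃ X Y Z Φ, Run μ W.right (W.wireSets.take j) (X ++ Y ++ Z) Φ ∧ Y ≠ [] ∧ Y.toFinset = P.wires ∧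
        IsotopicIn (holes k)ᶜ (Φ '' conv (wt μ X) (wt μ Y)) (stretch φ '' mirrorImage (α t))

/-- The properties of a wiring diagram and its curves that are preserved by blowups. -/
structure IsGood (W : WiringDiagram) (α : ℕ → Set ℂ) : Prop where
  nodup : W.right.Nodup
  le_length : ∀ v ∈ W.right, v ≤ W.right.length
  label : ∀ P ∈ W.marks, ∃ t < W.right.length, P.label = MarkLabel.x t
  normal : ∀ μ : ℕ → ℕ, (∀ v, 1 ≤ μ v) → ∀ k, wt μ W.right ≤ k → IsNormal μ k W.right W.wireSets
  realizes : Realizes W α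

/-- The map of the line that stretches the middle of the hole `p` by one unit. -/
noncomputable def splitAt (r p : ℕ) (x : ℝ) : ℝ :=
  x + max 0 (min 1 ((x - p + holeRadius (r + 1)) / (2 * holeRadius (r + 1))))

theorem splitHole_eq_stretch (r p : ℕ) : splitHole r p = stretch (splitAt r p) := by
  funext z
  exact Complex.ext (splitHole_re r p z) (splitHole_im r p z)

theorem strictMono_splitAt (r p : ℕ) : StrictMono (splitAt r p) := by
  have hp := holeRadius_pos (r + 1)
  refine strictMono_id.add_monotone fun x y hxy => ?_
  exact max_le_max le_rfl (min_le_min le_rfl (div_le_div_of_nonneg_right (by linarith) (by linarith)))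

theorem continuous_splitAt (r p : ℕ) : Continuous (splitAt r p) := by
  have hp := holeRadius_pos (r + 1)
  unfold splitAt
  exact continuous_id.add (continuous_const.max (continuous_const.min
    ((by fun_prop : Continuous fun x : ℝ => x - p + holeRadius (r + 1)).div_const _)))

theorem splitAt_of_le {r p : ℕ} {x : ℝ} (h : x ≤ p - 1 / 4) : splitAt r p x = x := by
  have hp := holeRadius_pos (r + 1)
  have hle := holeRadius_le (r + 1)
  rw [splitAt, max_eq_left, add_zero]
  exact (min_le_right _ _).trans (div_nonpos_of_nonpos_of_nonneg (by linarith) (by linarith))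

theorem splitAt_of_ge {r p : ℕ} {x : ℝ} (h : p + 1 / 4 ≤ x) : splitAt r p x = x + 1 := by
  have hp := holeRadius_pos (r + 1)
  have hle := holeRadius_le (r + 1)
  rw [splitAt, min_eq_left, max_eq_right zero_le_one]
  rw [le_div_iff₀ (by linarith)]; linarith

/-! ### Normal forms under interior and exterior blowups -/

section Interior

variable {μ ν : ℕ → ℕ} {R₁ R₂ : List ℕ} {w w' : ℕ} {Ss : List (Finset ℕ)}

theorem dbl_middle (h₁ : w ∉ R₁) (h₂ : w ∉ R₂) :
    dbl w w' true (R₁ ++ w :: R₂) = R₁ ++ w :: w' :: R₂ := by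
  rw [dbl_append, dbl_cons, dbl_of_not_mem _ h₁, dbl_of_not_mem _ h₂]; simp

/-- The gaps beyond the split hole move one place to the right, and the total weight before them is
the same whether `w` and `w'` are counted together or separately. -/
theorem IsSplitting.comp_splitAt {φ : ℝ → ℝ} (h : IsSplitting μ (R₁ ++ w :: w' :: R₂) φ)
    (hw : ν w = μ w + μ w') (hν : ∀ v, v ≠ w → ν v = μ v) (h₁ : w ∉ R₁) (h₂ : w ∉ R₂) (r : ℕ) :
    IsSplitting ν (R₁ ++ w :: R₂) (φ ∘ splitAt r (R₁.length + 1)) := by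
  refine ⟨h.strictMono.comp (strictMono_splitAt _ _), h.continuous.comp (continuous_splitAt _ _),
    fun s hs x hx1 hx2 => ?_⟩
  simp only [List.length_append, List.length_cons] at hs
  rw [Function.comp_apply]
  rcases Nat.lt_or_ge R₁.length s with hlt | hge
  · have hlt' : (R₁.length : ℝ) + 1 ≤ s := by exact_mod_cast hlt
    rw [splitAt_of_ge (by push_cast; linarith), h.apply_eq (s + 1)
      (by simp only [List.length_append, List.length_cons]; omega) _ (by push_cast; linarith)
      (by push_cast; linarith)]
    obtain ⟨d, rfl⟩ : ∃ d, s = R₁.length + 1 + d := ⟨s - (R₁.length + 1), by omega⟩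
    have e1 : (R₁ ++ w :: w' :: R₂).take (R₁.length + 1 + d + 1) = R₁ ++ w :: w' :: R₂.take d := by
      rw [show R₁.length + 1 + d + 1 = R₁.length + (d + 2) by ring, List.take_length_add_append]; rfl
    have e2 : (R₁ ++ w :: R₂).take (R₁.length + 1 + d) = R₁ ++ w :: R₂.take d := by
      rw [show R₁.length + 1 + d = R₁.length + (d + 1) by ring, List.take_length_add_append]; rfl
    have e3 : wt ν (R₂.take d) = wt μ (R₂.take d) := wt_congr fun v hv =>
      hν v fun hv' => h₂ (hv' ▸ List.mem_of_mem_take hv)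
    have e4 : wt ν R₁ = wt μ R₁ := wt_congr fun v hv => hν v fun hv' => h₁ (hv' ▸ hv)
    rw [e1, e2]
    simp only [wt_append, wt_cons, e3, e4, hw]
    push_cast; ring
  · have hge' : (s : ℝ) ≤ R₁.length := by exact_mod_cast hge
    rw [splitAt_of_le (by push_cast; linarith), h.apply_eq s
      (by simp only [List.length_append, List.length_cons]; omega) x hx1 hx2,
      List.take_append_of_le_length hge, List.take_append_of_le_length hge]
    have e4 : wt ν (R₁.take s) = wt μ (R₁.take s) := wt_congr fun v hv =>
      hν v fun hv' => h₁ (hv' ▸ List.mem_of_mem_take hv)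
    rw [e4]

/-- Doubling the wire `w` and adding a marked point on the new wire and the wires above it. -/
theorem IsNormal.interior {k : ℕ} (hμ : ∀ v, 1 ≤ μ v) (hw : ν w = μ w + μ w')
    (hν : ∀ v, v ≠ w → ν v = μ v) (hR : (R₁ ++ w :: R₂).Nodup) (hw' : w' ∉ R₁ ++ w :: R₂)
    (hne : R₁ ≠ []) (hk : wt μ (R₁ ++ w :: w' :: R₂) ≤ k) (h : IsNormal ν k (R₁ ++ w :: R₂) Ss) :
    IsNormal μ k (R₁ ++ w :: w' :: R₂) (Ss.map (dblSet w w') ++ [insert w' R₁.toFinset]) ∧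
      ∃ X Y Z Φ, Run μ (R₁ ++ w :: w' :: R₂) (Ss.map (dblSet w w')) (X ++ Y ++ Z) Φ ∧ Y ≠ [] ∧
        Y.toFinset = insert w' R₁.toFinset ∧
        IsotopicIn (holes k)ᶜ (Φ '' conv (wt μ X) (wt μ Y))
          (lowerArm (3 / 4) (wt μ R₁ + 1 / 4) (wt μ R₁ + μ w + 3 / 4) (wt μ R₁ + μ w + μ w' + 1 / 4)) := by
  obtain ⟨Φ, hr, hm⟩ := h
  have hsub := hr.subset
  have hSs : ∀ S ∈ Ss, w' ∉ S := fun S hS hS' => hw' (hsub S hS _ hS')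
  have hnd := List.nodup_append.1 hR
  have h₁ : w ∉ R₁ := fun h => hnd.2.2 w h w List.mem_cons_self rfl
  have h₂ : w ∉ R₂ := (List.nodup_cons.1 hnd.2.1).1
  have h12 : ∀ v ∈ R₂, v ∉ R₁ := fun v hv hv' => hnd.2.2 v hv' v (List.mem_cons_of_mem _ hv) rfl
  have hw'1 : w' ∉ R₁ := fun h => hw' (by simp [h])
  have hw'2 : w' ∉ R₂ := fun h => hw' (by simp [h])
  have hww' : w ≠ w' := fun h => hw' (by simp [h])
  have hr' := hr.double hw hν hR (w' := w')
  rw [dbl_middle h₁ h₂] at hr'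
  set c' := cnt (Ss.map (dblSet w w') ++ [insert w' R₁.toFinset]) with hc'
  have c1 : ∀ v ∈ R₁.reverse, c' v = cnt Ss v + 1 := fun v hv => by
    have hv' : v ≠ w' := fun h => hw'1 (h ▸ by simpa using hv)
    rw [hc', cnt_append_of_mem (by simpa using .inr (by simpa using hv)), cnt_map_dblSet_of_ne hv']
  have c2 : c' w = cnt Ss w := by
    rw [hc', cnt_append_of_not_mem (by simp [hww', h₁]), cnt_map_dblSet_of_ne hww']
  have c3 : c' w' = cnt Ss w + 1 := by
    rw [hc', cnt_append_of_mem (by simp), cnt_map_dblSet_new hSs]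
  have c4 : ∀ v ∈ R₂.reverse, c' v = cnt Ss v := fun v hv => by
    rw [List.mem_reverse] at hv
    have hv' : v ≠ w' := fun h => hw'2 (h ▸ hv)
    rw [hc', cnt_append_of_not_mem (by simp [hv', h12 v hv]), cnt_map_dblSet_of_ne hv']
  have e1 : (R₁ ++ w :: R₂).reverse = R₂.reverse ++ w :: R₁.reverse := by simp
  have e2 : (R₁ ++ w :: w' :: R₂).reverse = R₂.reverse ++ w' :: w :: R₁.reverse := by simp
  have hp := passes_interior hμ (k := k) (ν := ν) (c := cnt Ss) (c' := c') (w := w) (w' := w')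
    (P := R₂.reverse) (A := R₁.reverse) (by simpa using hne) c1 c2 c3 c4
    (fun v hv => hν v fun h => h₁ (h ▸ by simpa using hv)) hw
    (fun v hv => hν v fun h => h₂ (h ▸ by simpa using hv)) (by simpa using h₁) (by simpa using h₂)
    (by rw [← e2, wt_reverse]; exact hk) 1
  -- The shift by one comes from the base value `1` of the normal form.
  have e3 : decide (Odd (cnt Ss w - 1)) = decide (Even (cnt Ss w)) :=
    decide_eq_decide.2 (by rw [← Int.not_even_iff_odd, Int.even_sub_one, not_not])
  rw [← e1, ← e2, e3, List.toFinset_reverse, wt_reverse] at hp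
  obtain ⟨a1, X, Y, Z, a2⟩ := hr'.passes hμ hk hm hp
  exact ⟨a1, X, Y, Z, Φ, a2⟩

end Interior

theorem IsNormal.exterior {μ : ℕ → ℕ} {R : List ℕ} {w : ℕ} {Ss : List (Finset ℕ)} {k : ℕ}
    (hμ : ∀ v, 1 ≤ μ v) (hw : w ∉ R) (hk : wt μ (R ++ [w]) ≤ k) (h : IsNormal μ k R Ss) :
    IsNormal μ k (R ++ [w]) (Ss ++ [{w}]) ∧
      ∃ X Y Z Φ, Run μ (R ++ [w]) Ss (X ++ Y ++ Z) Φ ∧ Y ≠ [] ∧ Y.toFinset = {w} ∧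
        IsotopicIn (holes k)ᶜ (Φ '' conv (wt μ X) (wt μ Y)) (conv (wt μ R) (μ w)) := by
  obtain ⟨Φ, hr, hm⟩ := h
  have hSs : ∀ S ∈ Ss, w ∉ S := fun S hS hS' => hw (hr.subset S hS _ hS')
  have e2 : (R ++ [w]).reverse = w :: R.reverse := by simp
  have hp := passes_exterior (k := k) (c := cnt Ss) (c' := cnt (Ss ++ [{w}])) (A := R.reverse) (hμ w)
    (fun v hv => cnt_append_of_not_mem (by
      rw [Finset.mem_singleton]; rintro rfl; exact hw (by simpa using hv)))
    (by rw [cnt_append_of_mem (by simp), cnt_eq_zero hSs, zero_add])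
    (by rw [← e2, wt_reverse]; exact hk)
  rw [← e2, wt_reverse] at hp
  obtain ⟨a1, X, Y, Z, a2⟩ := (hr.append w).passes hμ hk hm hp
  exact ⟨a1, X, Y, Z, Φ, a2⟩

/-! ### Blowups preserve the induction hypothesis -/

theorem IsGood.exteriorBlowup {W : WiringDiagram} {α : ℕ → Set ℂ} (h : IsGood W α) :
    IsGood W.exteriorBlowup fun t =>
      if t = W.right.length then conv W.right.length 1 else α t := by
  set r := W.right.length with hr
  have hnew : r + 1 ∉ W.right := fun hm => by have := h.le_length _ hm; omega
  have hright : W.exteriorBlowup.right = W.right ++ [r + 1] := rfl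
  have hsets : W.exteriorBlowup.wireSets = W.wireSets ++ [{r + 1}] := by
    simp [WiringDiagram.wireSets, WiringDiagram.exteriorBlowup, hr]
  have hlen : W.exteriorBlowup.right.length = r + 1 := by simp [hright, hr]
  have hle : ∀ {μ : ℕ → ℕ} {k : ℕ}, wt μ W.exteriorBlowup.right ≤ k → wt μ W.right ≤ k := fun hk => by
    rw [hright, wt_append] at hk; omega
  refine ⟨?_, fun v hv => ?_, fun P hP => ?_, fun μ hμ k hk => ?_, fun μ hμ k hk φ hφ j P hj t ht => ?_⟩
  · rw [hright, List.nodup_append]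
    refine ⟨h.nodup, by simp, fun a ha b hb => ?_⟩
    rw [List.mem_singleton.1 hb]
    rintro rfl; exact hnew ha
  · rw [hlen]
    rcases List.mem_append.1 hv with hv | hv
    · exact (h.le_length v hv).trans (by omega)
    · rw [List.mem_singleton.1 hv]
  · rw [hlen]
    rcases List.mem_append.1 hP with hP | hP
    · obtain ⟨t, h1, h2⟩ := h.label P hP
      exact ⟨t, by omega, h2⟩
    · rw [List.mem_singleton.1 hP]
      exact ⟨r, by omega, rfl⟩
  · rw [hsets]
    exact ((h.normal μ hμ k (hle hk)).exterior hμ hnew hk).1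
  · have hφ' : IsSplitting μ W.right φ := ⟨hφ.strictMono, hφ.continuous, fun s hs x h1 h2 => by
      rw [hφ.apply_eq s (by rw [hlen]; omega) x h1 h2, hright, List.take_append_of_le_length hs]⟩
    rcases Nat.lt_or_ge j W.marks.length with hlt | hge
    · have hj' : W.marks[j]? = some P := by
        rw [← hj]; exact (List.getElem?_append_left hlt).symm
      obtain ⟨t', h1, h2⟩ := h.label P (List.mem_of_getElem? hj')
      rw [ht, MarkLabel.x.injEq] at h2
      subst h2
      obtain ⟨X, Y, Z, Φ, a1, a2, a3, a4⟩ := h.realizes μ hμ k (hle hk) φ hφ' j P hj' t ht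
      refine ⟨X, Y, Z ++ [r + 1], Φ, ?_, a2, a3, ?_⟩
      · rw [hsets, List.take_append_of_le_length (by simpa [WiringDiagram.wireSets] using hlt.le),
          ← List.append_assoc]
        exact a1.append (r + 1)
      · rw [if_neg (by omega)]
        exact a4
    · have hj' : j = W.marks.length ∧ P = ⟨.x r, {r + 1}⟩ := by
        have : (W.marks ++ [⟨.x r, {r + 1}⟩])[j]? = some P := hj
        rw [List.getElem?_append_right hge, List.getElem?_singleton] at this
        split_ifs at this with h0
        · exact ⟨by omega, (Option.some.inj this).symm⟩
      obtain ⟨rfl, rfl⟩ := hj'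
      obtain rfl : r = t := MarkLabel.x.inj ht
      obtain ⟨X, Y, Z, Φ, a1, a2, a3, a4⟩ := ((h.normal μ hμ k (hle hk)).exterior hμ hnew hk).2
      refine ⟨X, Y, Z, Φ, ?_, a2, a3, a4.trans ?_⟩
      · rw [hsets, List.take_left' (by simp [WiringDiagram.wireSets])]
        exact a1
      -- The vanishing cycle encloses the block of holes of the new wire, and the new α is a small
      -- circle about the single hole that `φ` widens to this block.
      · rw [if_pos rfl, mirrorImage_conv]
        refine isotopicIn_stretch_conv hφ.strictMono hφ.continuous k (hμ _) ?_ ?_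
        · rw [hφ'.apply_eq r le_rfl _ (by linarith) le_rfl, hr, List.take_length]; ring
        · rw [show (r : ℝ) + 5 / 4 = ((r + 1 : ℕ) : ℝ) + 1 / 4 by push_cast; ring,
            hφ.apply_eq (r + 1) hlen.ge _ le_rfl (by linarith), hright,
            List.take_of_length_le (by simp [hr]), wt_append, wt_cons, wt_nil]
          push_cast; ring

/-- The walls of the arm stand in gaps between holes, where the values of `φ` are prescribed. -/
theorem stretch_image_armCurve {μ : ℕ → ℕ} {R₁ R₂ : List ℕ} {w w' : ℕ} {φ : ℝ → ℝ}
    (h : IsSplitting μ (R₁ ++ w :: w' :: R₂) φ) (hne : R₁ ≠ []) :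
    stretch φ '' mirrorImage (armCurve R₁.length) =
      lowerArm (3 / 4) (wt μ R₁ + 1 / 4) (wt μ R₁ + μ w + 3 / 4) (wt μ R₁ + μ w + μ w' + 1 / 4) := by
  set i := R₁.length with hi
  have hlen : (R₁ ++ w :: w' :: R₂).length = i + 2 + R₂.length := by simp [hi]; omega
  have t0 := h.apply_eq 0 (by omega) (3 / 4) (by norm_num) (by norm_num)
  have t1 := h.apply_eq i (by omega) (i + 1 / 4) (by linarith) (by linarith)
  have t2 := h.apply_eq (i + 1) (by omega) (i + 7 / 4) (by push_cast; linarith) (by push_cast; linarith)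
  have t3 := h.apply_eq (i + 2) (by omega) (i + 9 / 4) (by push_cast; linarith) (by push_cast; linarith)
  have e1 : (R₁ ++ w :: w' :: R₂).take i = R₁ := List.take_left' hi.symm
  have e2 : (R₁ ++ w :: w' :: R₂).take (i + 1) = R₁ ++ [w] := by
    rw [hi, List.take_length_add_append]; rfl
  have e3 : (R₁ ++ w :: w' :: R₂).take (i + 2) = R₁ ++ [w, w'] := by
    rw [hi, List.take_length_add_append]; rfl
  rw [e1] at t1
  rw [e2] at t2
  rw [e3] at t3
  rw [mirrorImage_armCurve (List.length_pos_iff.2 hne), stretch_image_lowerArm h.strictMono h.continuous,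
    t0, t1, t2, t3]
  simp only [List.take_zero, wt_nil, wt_append, wt_cons]
  push_cast
  congr 1 <;> ring

theorem IsGood.interiorBlowup {W : WiringDiagram} {α : ℕ → Set ℂ} (h : IsGood W α) {i : ℕ}
    (hi : 1 ≤ i) (hir : i < W.right.length) :
    IsGood (W.interiorBlowup i) fun t =>
      if t = W.right.length then armCurve i else splitHole W.right.length (i + 1) '' α t := by
  set r := W.right.length with hr
  set R₁ := W.right.take i with hR₁
  set R₂ := W.right.drop (i + 1) with hR₂
  -- Counted from zero, index `i` is the `(i + 1)`-st wire, so `R₁` consists of the `i` wires above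
  -- it; the default value is never used since `i` is less than the number of wires.
  set w := W.right.getD i 0 with hw
  have hwget : w = W.right[i] := by rw [hw, List.getD_eq_getElem _ _ hir]
  have hlen₁ : R₁.length = i := by rw [hR₁, List.length_take, min_eq_left (by omega)]
  have hright : W.right = R₁ ++ w :: R₂ := by
    rw [hwget, hR₁, hR₂, List.getElem_cons_drop, List.take_append_drop]
  have hright' : (W.interiorBlowup i).right = R₁ ++ w :: (r + 1) :: R₂ := by
    have : W.right.take (i + 1) = R₁ ++ [w] := by
      rw [hwget, hR₁, List.take_append_getElem]
    simp only [WiringDiagram.interiorBlowup]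
    rw [this]; simp [hr, hR₂]
  have hsets : (W.interiorBlowup i).wireSets =
      W.wireSets.map (dblSet w (r + 1)) ++ [insert (r + 1) R₁.toFinset] := by
    simp only [WiringDiagram.wireSets, WiringDiagram.interiorBlowup, List.map_append, List.map_map,
      List.map_singleton]
    congr 1
    refine List.map_congr_left fun P _ => ?_
    simp only [Function.comp_apply, dblSet, ← hw, ← hr]
    split_ifs <;> rfl
  have hlen : (W.interiorBlowup i).right.length = r + 1 := by
    rw [hright', hr, hright]; simp; omega
  have hnew : r + 1 ∉ R₁ ++ w :: R₂ := fun hm => by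
    rw [← hright] at hm
    have := h.le_length _ hm; omega
  have hnd : (R₁ ++ w :: R₂).Nodup := hright ▸ h.nodup
  have hnd' := List.nodup_append.1 hnd
  have h₁ : w ∉ R₁ := fun h => hnd'.2.2 w h w List.mem_cons_self rfl
  have h₂ : w ∉ R₂ := (List.nodup_cons.1 hnd'.2.1).1
  have hperm : (R₁ ++ w :: (r + 1) :: R₂).Perm ((r + 1) :: (R₁ ++ w :: R₂)) := by
    have : (R₁ ++ w :: (r + 1) :: R₂).Perm (R₁ ++ (r + 1) :: w :: R₂) :=
      (List.Perm.swap _ _ _).append_left _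
    exact this.trans List.perm_middle
  have hne : R₁ ≠ [] := by rw [← List.length_pos_iff, hlen₁]; exact hi
  -- The old diagram is used with the weights in which `w` carries the weight of both copies.
  have hpos : ∀ {μ : ℕ → ℕ}, (∀ v, 1 ≤ μ v) →
      ∀ v, 1 ≤ Function.update μ w (μ w + μ (r + 1)) v := fun hμ v => by
    have := hμ v
    rcases eq_or_ne v w with rfl | hv
    · rw [Function.update_self]; omega
    · rw [Function.update_of_ne hv]; exact this
  have hν : ∀ (μ : ℕ → ℕ), ∀ v, v ≠ w → Function.update μ w (μ w + μ (r + 1)) v = μ v :=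
    fun μ v hv => Function.update_of_ne hv _ _
  have hνw : ∀ μ : ℕ → ℕ, Function.update μ w (μ w + μ (r + 1)) w = μ w + μ (r + 1) :=
    fun μ => Function.update_self _ _ _
  have hwt : ∀ {μ : ℕ → ℕ} {k : ℕ}, wt μ (W.interiorBlowup i).right ≤ k →
      wt (Function.update μ w (μ w + μ (r + 1))) W.right ≤ k := fun {μ k} hk => by
    rw [hright', ← dbl_middle h₁ h₂, wt_dbl (hνw μ) fun v _ => hν μ v, ← hright] at hk
    exact hk
  refine ⟨?_, fun v hv => ?_, fun P hP => ?_, fun μ hμ k hk => ?_, fun μ hμ k hk φ hφ j P hj t ht => ?_⟩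
  · rw [hright', hperm.nodup_iff]
    exact List.nodup_cons.2 ⟨hnew, hnd⟩
  · rw [hlen]
    rw [hright', hperm.mem_iff, ← hright] at hv
    rcases List.mem_cons.1 hv with rfl | hv
    · exact le_rfl
    · exact (h.le_length v hv).trans (by omega)
  · rw [hlen]
    rcases List.mem_append.1 hP with hP | hP
    · obtain ⟨P', hP', rfl⟩ := List.mem_map.1 hP
      obtain ⟨t, h1, h2⟩ := h.label P' hP'
      refine ⟨t, by omega, ?_⟩
      split_ifs <;> exact h2
    · rw [List.mem_singleton.1 hP]
      exact ⟨r, by omega, rfl⟩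
  · have hN := h.normal _ (hpos hμ) k (hwt hk)
    rw [hright] at hN
    rw [hright'] at hk
    rw [hsets, hright']
    exact (hN.interior hμ (hνw μ) (hν μ) hnd hnew hne hk).1
  · have hkν := hwt hk
    have hN := h.normal _ (hpos hμ) k hkν
    rw [hright] at hN
    rw [hright'] at hk hφ
    rw [hsets, hright']
    have hlenS : (W.wireSets.map (dblSet w (r + 1))).length = W.marks.length := by
      simp [WiringDiagram.wireSets]
    rcases Nat.lt_or_ge j W.marks.length with hlt | hge
    · obtain ⟨P', hj', hP', hP''⟩ : ∃ P', W.marks[j]? = some P' ∧ P'.label = P.label ∧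
          P.wires = dblSet w (r + 1) P'.wires := by
        have : (W.interiorBlowup i).marks[j]? = some P := hj
        simp only [WiringDiagram.interiorBlowup] at this
        rw [List.getElem?_append_left (by simpa using hlt), List.getElem?_map] at this
        obtain ⟨P', hP', rfl⟩ := Option.map_eq_some_iff.1 this
        refine ⟨P', hP', ?_, ?_⟩
        · split_ifs <;> rfl
        · simp only [dblSet, ← hw, ← hr]; split_ifs <;> rfl
      obtain ⟨t', h1, h2⟩ := h.label P' (List.mem_of_getElem? hj')
      rw [hP', ht, MarkLabel.x.injEq] at h2
      subst h2
      have hφ' := hφ.comp_splitAt (hνw μ) (hν μ) h₁ h₂ r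
      rw [← hright, hlen₁] at hφ'
      obtain ⟨X, Y, Z, Φ, a1, a2, a3, a4⟩ :=
        h.realizes _ (hpos hμ) k hkν _ hφ' j P' hj' t (hP'.trans ht)
      have a5 := a1.double (hνw μ) (hν μ) (hright ▸ hnd)
      rw [hright, dbl_middle h₁ h₂, dbl_append, dbl_append, List.map_take] at a5
      -- The side on which the copy lies is irrelevant here: only the wires at the point and the
      -- weights enter the conclusion.
      generalize decide (Even (cnt (W.wireSets.take j) w)) = b at a5
      refine ⟨dbl w (r + 1) b X, dbl w (r + 1) b Y, dbl w (r + 1) b Z, Φ, ?_, dbl_ne_nil _ a2, ?_, ?_⟩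
      · rw [List.take_append_of_le_length (by rw [hlenS]; exact hlt.le)]
        exact a5
      · rw [toFinset_dbl, hP'', dblSet, ← a3]; simp
      · rw [if_neg (by omega), splitHole_eq_stretch, ← stretch_mirrorImage, stretch_comp,
          wt_dbl (hνw μ) fun v _ => hν μ v, wt_dbl (hνw μ) fun v _ => hν μ v]
        exact a4
    · have hj' : j = W.marks.length ∧ P = ⟨.x r, insert (r + 1) R₁.toFinset⟩ := by
        have : (W.interiorBlowup i).marks[j]? = some P := hj
        simp only [WiringDiagram.interiorBlowup] at this
        rw [List.getElem?_append_right (by simpa using hge), List.getElem?_singleton] at this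
        split_ifs at this with h0
        · exact ⟨by simp at h0; omega, (Option.some.inj this).symm⟩
      obtain ⟨rfl, rfl⟩ := hj'
      obtain rfl : r = t := MarkLabel.x.inj ht
      obtain ⟨X, Y, Z, Φ, a1, a2, a3, a4⟩ := (hN.interior hμ (hνw μ) (hν μ) hnd hnew hne hk).2
      refine ⟨X, Y, Z, Φ, ?_, a2, a3, a4.trans ?_⟩
      · rw [List.take_left' hlenS]
        exact a1
      · rw [if_pos rfl]
        have := stretch_image_armCurve hφ hne
        rw [hlen₁] at this
        rw [this]
        -- Reflexivity for the arm, which is a simple closed curve off the centres because it is an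
        -- end of the isotopy `a4`.
        exact a4.symm.trans a4

theorem Realizes.congr {W : WiringDiagram} {α β : ℕ → Set ℂ} (h : Realizes W α)
    (hαβ : ∀ P ∈ W.marks, ∀ t, P.label = MarkLabel.x t → α t = β t) : Realizes W β := by
  intro μ hμ k hk φ hφ j P hj t ht
  rw [← hαβ P (List.mem_of_getElem? hj) t ht]
  exact h μ hμ k hk φ hφ j P hj t ht

theorem isGood_single (α : ℕ → Set ℂ) : IsGood ⟨[1], []⟩ α where
  nodup := by simp
  le_length := by simp
  label := by simp
  normal μ hμ k hk := by
    have hμ1 := hμ 1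
    refine ⟨1, ?_, ?_⟩
    · have : Run μ [1] [] [1] 1 := .nil
      exact this
    · have e : nf μ (cnt (WiringDiagram.wireSets ⟨[1], []⟩)) 1 [1].reverse = 1 := by
        -- Count `0` against the base value `1` gives the exponent `-1`, which cancels the
        -- half-twist along the wire's own block. The base value `1` thus makes the empty
        -- composition a normal form.
        change (1 : ℂ ≃ₜ ℂ) * tw 0 (μ 1) * tw 0 (0 + μ 1) ^ ((0 : ℤ) - 1) = 1
        rw [zero_add, zero_sub, zpow_neg_one, one_mul, mul_inv_cancel]
      rw [e]
      exact MapIso.refl (one_mem _)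
  realizes μ hμ k hk φ hφ j P hj t ht := by simp at hj

theorem BlowupSequence.isGood {n : List ℕ} (σ : BlowupSequence n) :
    σ.wiringDiagram.right.length = n.length ∧ IsGood σ.wiringDiagram σ.alphaCurve := by
  induction σ with
  | zero => exact ⟨rfl, isGood_single _⟩
  | initial =>
    refine ⟨rfl, ?_⟩
    -- The initial blowup acts on the diagram as an exterior blowup of a single wire.
    have h := (isGood_single fun _ => ∅).exteriorBlowup
    refine ⟨h.nodup, h.le_length, h.label, h.normal, h.realizes.congr fun P hP t ht => ?_⟩
    obtain rfl : P = ⟨.x 1, {2}⟩ := List.mem_singleton.1 hP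
    obtain rfl : 1 = t := MarkLabel.x.inj ht
    exact (if_pos rfl).trans (convexCurve_eq 1 1).symm
  | @interior n σ i h1 h ih =>
    obtain ⟨hl, hg⟩ := ih
    have hg' := hg.interiorBlowup h1 (by omega)
    refine ⟨?_, ?_⟩
    · rw [length_interiorBlowupTuple h1 h, ← hl]
      simp only [wiringDiagram, WiringDiagram.interiorBlowup, List.length_append, List.length_take,
        List.length_drop, List.length_cons, List.length_nil]
      omega
    · rw [hl] at hg'
      exact hg'
  | @exterior n σ h ih =>
    obtain ⟨hl, hg⟩ := ih
    have hg' := hg.exteriorBlowup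
    refine ⟨?_, ?_⟩
    · rw [length_exteriorBlowupTuple (by omega), ← hl]
      simp [wiringDiagram, WiringDiagram.exteriorBlowup]
    · rw [hl, ← convexCurve_eq] at hg'
      exact hg'

/-! ## The twisting algorithm -/

theorem IsNormal.append_initial_blocks {μ : ℕ → ℕ} (hμ : ∀ v, 1 ≤ μ v) {k : ℕ} {R : List ℕ}
    (hR : R.Nodup) (hk : wt μ R ≤ k) {Ss : List (Finset ℕ)} (h : IsNormal μ k R Ss)
    {T : List (Finset ℕ)} (hT : ∀ S ∈ T, ∃ s, 1 ≤ s ∧ s ≤ R.length ∧ S = (R.take s).toFinset) :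
    IsNormal μ k R (Ss ++ T) := by
  induction T using List.reverseRecOn with
  | nil => simpa using h
  | append_singleton T S ih =>
    obtain ⟨s, h1, h2, rfl⟩ := hT S (by simp)
    rw [← List.append_assoc]
    exact ((ih fun S hS => hT S (by simp [hS])).initial_block hμ hR hk h1 h2).1

theorem Run.mapsTo_safeRegion {R : List ℕ} {Ss : List (Finset ℕ)} {L : List ℕ} {Φ : ℂ ≃ₜ ℂ}
    {μ : ℕ → ℕ} (hμ : ∀ v, 1 ≤ μ v) {k : ℕ} (hk : wt μ R ≤ k) (h : Run μ R Ss L Φ) :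
    Set.MapsTo Φ (safeRegion k) (safeRegion k) := by
  induction h with
  | nil => exact Set.mapsTo_id _
  | @snoc Ss X Y Z Φ h hY ih =>
    refine ih.comp (tw_mapsTo_safeRegion (one_le_wt hμ hY) ?_)
    have := wt_perm μ h.perm
    simp only [wt_append] at this; omega

theorem isSplitting_id (R : List ℕ) : IsSplitting (fun _ => 1) R id where
  strictMono := strictMono_id
  continuous := continuous_id
  apply_eq s hs x _ _ := by
    rw [wt_one, List.length_take, min_eq_left hs]; simp

theorem stretch_id (C : Set ℂ) : stretch id '' C = C := Set.image_id C

theorem mainTheorem2 {n : List ℕ} (σ : BlowupSequence n) (m : Fin n.length → ℕ) :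
    (σ.wiringDiagram.twist m).IsRealizable ∧
    (∀ s j : ℕ, 1 ≤ s → s ≤ n.length →
      ((σ.wiringDiagram.twist m).marks[j]?).map MarkedPoint.label = some (MarkLabel.y s) →
      IsotopicIn (diskWithHoles n.length)
        ((σ.wiringDiagram.twist m).vanishingCycle j) (gammaCurve s)) ∧
    (∀ t j : ℕ, 1 ≤ t → t ≤ n.length - 1 →
      ((σ.wiringDiagram.twist m).marks[j]?).map MarkedPoint.label = some (MarkLabel.x t) →
      IsotopicIn (diskWithHoles n.length)
        ((σ.wiringDiagram.twist m).vanishingCycle j) (mirrorImage (σ.alphaCurve t))) := by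
  obtain ⟨hl, hg⟩ := σ.isGood
  set W := σ.wiringDiagram with hW
  set Ym : List MarkedPoint := (List.finRange n.length).flatMap fun s =>
    List.replicate (m s) ⟨.y (s + 1), (W.right.take (s + 1)).toFinset⟩ with hYm
  have hmarks : (W.twist m).marks = W.marks ++ Ym := rfl
  have hright : (W.twist m).right = W.right := rfl
  have hsets : (W.twist m).wireSets = W.wireSets ++ Ym.map MarkedPoint.wires := by
    rw [WiringDiagram.wireSets, hmarks, List.map_append]; rfl
  have hYmem : ∀ P ∈ Ym, ∃ s, 1 ≤ s ∧ s ≤ W.right.length ∧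
      P = ⟨.y s, (W.right.take s).toFinset⟩ := fun P hP => by
    obtain ⟨s, -, hs⟩ := List.mem_flatMap.1 hP
    exact ⟨s + 1, by omega, by rw [hl]; exact s.2, List.eq_of_mem_replicate hs⟩
  have hμ : ∀ v : ℕ, 1 ≤ (fun _ => 1 : ℕ → ℕ) v := fun _ => le_rfl
  have hwk : wt (fun _ => 1) W.right ≤ n.length := by rw [wt_one, hl]
  have hnormal : ∀ T, (∀ S ∈ T, ∃ s, 1 ≤ s ∧ s ≤ W.right.length ∧ S = (W.right.take s).toFinset) →
      IsNormal (fun _ => 1) n.length W.right (W.wireSets ++ T) := fun T hT =>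
    (hg.normal _ hμ n.length hwk).append_initial_blocks hμ hg.nodup hwk hT
  have hTmem : ∀ S ∈ Ym.map MarkedPoint.wires, ∃ s, 1 ≤ s ∧ s ≤ W.right.length ∧
      S = (W.right.take s).toFinset := fun S hS => by
    obtain ⟨P, hP, rfl⟩ := List.mem_map.1 hS
    obtain ⟨s, h1, h2, rfl⟩ := hYmem P hP
    exact ⟨s, h1, h2, rfl⟩
  have hlenW : W.wireSets.length = W.marks.length := by simp [WiringDiagram.wireSets]
  -- The vanishing cycle itself lies in the safe region, because convex curves do and half-twists
  -- preserve that region; so an isotopy off the centres can be pushed into the disk with holes.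
  have transfer : ∀ {j : ℕ} {X Y Z : List ℕ} {Φ : ℂ ≃ₜ ℂ} {C : Set ℂ},
      Run (fun _ => 1) W.right ((W.twist m).wireSets.take j) (X ++ Y ++ Z) Φ → Y ≠ [] →
      (W.twist m).wireSets[j]? = some Y.toFinset → C ⊆ safeRegion n.length →
      IsotopicIn (holes n.length)ᶜ (Φ '' conv (wt (fun _ => 1) X) (wt (fun _ => 1) Y)) C →
      IsotopicIn (diskWithHoles n.length) ((W.twist m).vanishingCycle j) C := by
    intro j X Y Z Φ C hr hY hS hC hiso
    rw [WiringDiagram.vanishingCycle_of_run (W := W.twist m) hg.nodup hr hY hS]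
    refine isotopicIn_diskWithHoles ?_ hC hiso
    have hle : wt (fun _ => 1) X + wt (fun _ => 1) Y ≤ n.length := by
      have := wt_perm (fun _ => 1) hr.perm
      simp only [wt_append] at this; omega
    rintro _ ⟨z, hz, rfl⟩
    exact Run.mapsTo_safeRegion hμ hwk hr (conv_subset_safeRegion (one_le_wt hμ hY) hle hz)
  refine ⟨?_, ?_, ?_⟩
  · obtain ⟨Φ, hr, -⟩ := hnormal _ hTmem
    rw [← hsets] at hr
    exact WiringDiagram.isRealizable_of_run (W := W.twist m) hg.nodup hr
  · intro s j h1 h2 hj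
    obtain ⟨P, hP, hPl⟩ := Option.map_eq_some_iff.1 hj
    rw [hmarks] at hP
    rcases Nat.lt_or_ge j W.marks.length with hlt | hge
    · rw [List.getElem?_append_left hlt] at hP
      obtain ⟨t, -, ht⟩ := hg.label P (List.mem_of_getElem? hP)
      rw [hPl] at ht
      exact absurd ht (by simp)
    · have hP' := hP
      rw [List.getElem?_append_right hge] at hP
      obtain ⟨s', -, hs', rfl⟩ := hYmem P (List.mem_of_getElem? hP)
      obtain rfl : s' = s := MarkLabel.y.inj hPl
      have htake : (W.twist m).wireSets.take j =
          W.wireSets ++ (Ym.map MarkedPoint.wires).take (j - W.wireSets.length) := by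
        rw [hsets, List.take_append, List.take_of_length_le (by omega)]
      have hN := hnormal ((Ym.map MarkedPoint.wires).take (j - W.wireSets.length))
        fun S hS => hTmem S (List.mem_of_mem_take hS)
      obtain ⟨X, Y, Z, Φ, a1, a2, a3, a4⟩ := (hN.initial_block hμ hg.nodup hwk h1 hs').2
      rw [← htake] at a1
      rw [wt_one (W.right.take s'), List.length_take, min_eq_left hs'] at a4
      have hγ : gammaCurve s' = conv 0 s' := by
        have := convexCurve_eq 0 s'
        rwa [zero_add, zero_add] at this
      rw [hγ]
      refine transfer a1 a2 ?_ (conv_subset_safeRegion h1 (by omega)) a4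
      rw [a3, WiringDiagram.wireSets, List.getElem?_map, hmarks, hP']; rfl
  · intro t j h1 h2 hj
    obtain ⟨P, hP, hPl⟩ := Option.map_eq_some_iff.1 hj
    rw [hmarks] at hP
    rcases Nat.lt_or_ge j W.marks.length with hlt | hge
    · have hP' := hP
      rw [List.getElem?_append_left hlt] at hP
      -- Unit weights and the identity splitting specialize the induction hypothesis to the curves
      -- themselves; the points `y_s` lie further left and do not affect the sweep up to `x_t`.
      obtain ⟨X, Y, Z, Φ, a1, a2, a3, a4⟩ :=
        hg.realizes _ hμ n.length hwk id (isSplitting_id _) j P hP t hPl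
      rw [stretch_id] at a4
      have hsub : mirrorImage (σ.alphaCurve t) ⊆ safeRegion n.length :=
        mirrorImage_subset_safeRegion ((σ.alphaCurve_subset t h1 (by omega)).trans fun z hz => hz.1)
      refine transfer (Z := Z) ?_ a2 ?_ hsub a4
      · rw [hsets, List.take_append_of_le_length (by omega)]
        exact a1
      · rw [a3, WiringDiagram.wireSets, List.getElem?_map, hmarks, hP']; rfl
    · rw [List.getElem?_append_right hge] at hP
      obtain ⟨s', -, hs', rfl⟩ := hYmem P (List.mem_of_getElem? hP)
      exact absurd hPl (by simp)
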